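/- Let $m\ge 3$, let $M$ be a closed (compact, without boundary) connected smooth manifold of dimension $m$, and fix a direct sum decomposition $TM=E_1\oplus\cdots\oplus E_l$ into smooth vector subbundles $E_i$ of fiber dimension $m_i\ge 1$, with projections $\mathcal P_i:TM\to E_i$. For a smooth Riemannian metric $g$ on $M$ with Ricci tensor $\mathrm{Ric}^g$, scalar curvature $R^g$ and Riemannian measure $\mu^g$, let $$E(g)=\frac{\int_M R^g\,d\mu^g}{\left(\int_M d\mu^g\right)^{2/p_m}},\qquad p_m=\frac{2m}{m-2},$$ be the normalized Einstein–Hilbert functional. Let $\mathrm{Met}_\perp$ be the set of compatible metrics, i.e. of the smooth Riemannian metrics $g$ with $E_i\perp E_j$ for all $i\ne j$. For $g\in\mathrm{Met}_\perp$ put $$g_i(X,Y)=g(\mathcal P_iX,\mathcal P_iY),\qquad \mathrm{Ric}^g_i(X,Y)=\mathrm{Ric}^g(\mathcal P_iX,\mathcal P_iY),\qquad R^g_i=\mathrm{tr}^g\,\mathrm{Ric}^g_i,$$ so that $g=g_1\oplus\cdots\oplus g_l$, and let $[\![g]\!]\subset\mathrm{Met}_\perp$ be the multiconformal class of $g$,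 i.e. the set of all metrics $f_1^2g_1\oplus\cdots\oplus f_l^2g_l$ with smooth functions $f_i:M\to\mathbb R_{>0}$. For a set $S$ of smooth metrics on $M$, a metric $g\in S$ is called critical for $E|_S$ if $\frac{d}{dt}\big|_{t=0}E(\gamma_t)=0$ for every smooth curve $t\mapsto\gamma_t\in S$ ($t\in\mathbb R$, smooth jointly in $t$ and the point of $M$) with $\gamma_0=g$. Proposition. Let $g\in\mathrm{Met}_\perp$. 1. $g$ is critical for $E|_{[\![g]\!]}$ if and only if there is a real constant $c$ such that $R^g_i/m_i=c$ on $M$ for all $i\in\{1,\dots,l\}$. 2. $g$ is critical for $E|_{\mathrm{Met}_\perp}$ if and only if there is a real constant $c$ such that $\mathrm{Ric}^g_i=c\,g_i$ on $M$ for all $i\in\{1,\dots,l\}$. -/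

import Mathlib

open scoped Manifold ContDiff Topology
open MeasureTheory Bundle

noncomputable section

namespace Multiconformal

/-- The model space `ℝᵐ`. -/
abbrev Model (m : ℕ) : Type := EuclideanSpace ℝ (Fin m)

variable {m : ℕ} {M : Type*} [TopologicalSpace M] [ChartedSpace (Model m) M]
  [IsManifold (𝓡 m) ∞ M]

/-- `Met`: the smooth Riemannian metrics on `M`. -/
abbrev Met (m : ℕ) (M : Type*) [TopologicalSpace M] [ChartedSpace (Model m) M]
    [IsManifold (𝓡 m) ∞ M] : Type _ :=
  ContMDiffRiemannianMetric (𝓡 m) ∞ (Model m) (fun x : M ↦ TangentSpace (𝓡 m) x)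

/-! ### Local coordinates

Everything is expressed in the chart `extChartAt (𝓡 m) x₀`, for a base point `x₀`.
-/

/-- The coordinate vector `∂/∂xⁱ` at `p` of the chart at `x₀`. The tangent bundle is trivialized over
the domain of this chart by the differential of the chart. -/
def coordVec (x₀ p : M) (i : Fin m) : TangentSpace (𝓡 m) p :=
  (trivializationAt (Model m) (TangentSpace (𝓡 m) : M → Type _) x₀).symmL ℝ p
    (EuclideanSpace.single i 1)

/-- The component `dxⁱ(v)` of `v ∈ T_p M` in the chart at `x₀`. -/
def coord (x₀ p : M) (v : TangentSpace (𝓡 m) p) (i : Fin m) : ℝ :=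
  (trivializationAt (Model m) (TangentSpace (𝓡 m) : M → Type _) x₀).continuousLinearMapAt ℝ p v i

/-- The matrix `(g_ij)` in the chart at `x₀`, as a function on the image of the chart. -/
def gram (g : Met m M) (x₀ : M) (y : Model m) : Matrix (Fin m) (Fin m) ℝ :=
  Matrix.of fun i j ↦
    g.inner ((extChartAt (𝓡 m) x₀).symm y)
      (coordVec x₀ ((extChartAt (𝓡 m) x₀).symm y) i)
      (coordVec x₀ ((extChartAt (𝓡 m) x₀).symm y) j)

/-- The partial derivative `∂_k f`. -/
def pd (k : Fin m) (f : Model m → ℝ) (y : Model m) : ℝ :=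
  fderiv ℝ f y (EuclideanSpace.single k 1)

/-- The Christoffel symbol `Γᵏ_ij` of the Levi-Civita connection in the chart at `x₀`:
`Γᵏ_ij = (1/2) ∑_l gᵏˡ (∂_i g_jl + ∂_j g_il - ∂_l g_ij)`. -/
def christoffel (g : Met m M) (x₀ : M) (k i j : Fin m) (y : Model m) : ℝ :=
  (1 / 2 : ℝ) * ∑ l, (gram g x₀ y)⁻¹ k l *
    (pd i (fun z ↦ gram g x₀ z j l) y + pd j (fun z ↦ gram g x₀ z i l) y
      - pd l (fun z ↦ gram g x₀ z i j) y)

/-- The component `R_ij` of the Ricci tensor in the chart at `x₀`: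
`R_ij = ∑_k (∂_k Γᵏ_ij - ∂_j Γᵏ_ik) + ∑_{k,l} (Γᵏ_kl Γˡ_ij - Γᵏ_jl Γˡ_ik)`. -/
def ricciComp (g : Met m M) (x₀ : M) (i j : Fin m) (y : Model m) : ℝ :=
  ∑ k, (pd k (christoffel g x₀ k i j) y - pd j (christoffel g x₀ k i k) y)
    + ∑ k, ∑ l, (christoffel g x₀ k k l y * christoffel g x₀ l i j y
      - christoffel g x₀ k j l y * christoffel g x₀ l i k y)

/-- The Ricci tensor `Ric^g` at `p`, evaluated through the chart at `p`. -/
def ricci (g : Met m M) (p : M) (v w : TangentSpace (𝓡 m) p) : ℝ :=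
  ∑ i, ∑ j, ricciComp g p i j (extChartAt (𝓡 m) p p) * coord p p v i * coord p p w j

/-- The trace `tr^g B = ∑ gⁱʲ B(∂_i, ∂_j)` of a bilinear form `B` on `T_p M`. -/
def trace (g : Met m M) (p : M)
    (B : TangentSpace (𝓡 m) p → TangentSpace (𝓡 m) p → ℝ) : ℝ :=
  ∑ i, ∑ j, (gram g p (extChartAt (𝓡 m) p p))⁻¹ i j * B (coordVec p p i) (coordVec p p j)

/-- The scalar curvature `R^g`. -/
def scalar (g : Met m M) (p : M) : ℝ := trace g p (ricci g p)

/-! ### The Riemannian measure and the normalized Einstein-Hilbert functional -/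

section Volume

variable [MeasurableSpace M]

/-- The measure `√(det g_ij) dx` of the chart at `x₀`, carried over to the domain of that chart (and
zero outside this domain). -/
def chartVolume (g : Met m M) (x₀ : M) : Measure M :=
  ((volume.restrict (extChartAt (𝓡 m) x₀).target).withDensity
    (fun y ↦ ENNReal.ofReal (Real.sqrt (gram g x₀ y).det))).map (extChartAt (𝓡 m) x₀).symm

/-- The Riemannian measure `μ^g`: the smallest measure that dominates `√(det g_ij) dx` in every
chart. The chart measures agree on overlaps, so it restricts to `√(det g_ij) dx` in every chart. -/
def riemVolume (g : Met m M) : Measure M := ⨆ x₀ : M, chartVolume g x₀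

/-- `E(g) = (∫ R^g dμ^g) / (∫ dμ^g)^(2/p_m)`, where `p_m = 2m/(m-2)`. -/
def einsteinHilbert (g : Met m M) : ℝ :=
  (∫ x, scalar g x ∂(riemVolume g)) /
    ((riemVolume g).real Set.univ) ^ (2 / (2 * (m : ℝ) / ((m : ℝ) - 2)))

end Volume

/-! ### Critical points of a restricted functional -/

/-- A curve `t ↦ γ t` of metrics that is smooth jointly in `t` and the point of `M`. -/
def IsSmoothCurve (γ : ℝ → Met m M) : Prop :=
  ContMDiff (𝓘(ℝ, ℝ).prod (𝓡 m)) ((𝓡 m).prod 𝓘(ℝ, Model m →L[ℝ] Model m →L[ℝ] ℝ)) ∞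
    (fun q : ℝ × M ↦ TotalSpace.mk' (Model m →L[ℝ] Model m →L[ℝ] ℝ)
      (E := fun x : M ↦ TangentSpace (𝓡 m) x →L[ℝ] TangentSpace (𝓡 m) x →L[ℝ] ℝ)
      q.2 ((γ q.1).inner q.2))

/-- `g` is critical for the functional `F` restricted to `S`: the derivative of `F` at `g` vanishes
along every smooth curve of metrics in `S` through `g`. -/
def IsCriticalOn (F : Met m M → ℝ) (S : Set (Met m M)) (g : Met m M) : Prop :=
  g ∈ S ∧ ∀ γ : ℝ → Met m M, IsSmoothCurve γ → γ 0 = g → (∀ t, γ t ∈ S) →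
    HasDerivAt (fun t ↦ F (γ t)) 0 0

/-! ### Decompositions of the tangent bundle -/

/-- A direct sum decomposition `TM = E_1 + ⋯ + E_l` into smooth vector subbundles, `E_i` of fiber
dimension `k i`. -/
structure Decomposition (m : ℕ) (M : Type*) [TopologicalSpace M] [ChartedSpace (Model m) M]
    [IsManifold (𝓡 m) ∞ M] (l : ℕ) (k : Fin l → ℕ) where
  /-- the fiber of `E_i` at `x` -/
  fiber : Fin l → (x : M) → Submodule ℝ (TangentSpace (𝓡 m) x)
  isInternal : ∀ x, DirectSum.IsInternal (fun i ↦ fiber i x)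
  /-- near every point, `E_i` has a smooth frame of `k i` vector fields -/
  exists_frame : ∀ i x, ∃ U ∈ 𝓝 x, ∃ s : Fin (k i) → (y : M) → TangentSpace (𝓡 m) y,
    (∀ a, ContMDiffOn (𝓡 m) ((𝓡 m).prod 𝓘(ℝ, Model m)) ∞
      (fun y ↦ (⟨y, s a y⟩ : TangentBundle (𝓡 m) M)) U) ∧
    ∀ y ∈ U, LinearIndependent ℝ (fun a ↦ s a y) ∧
      Submodule.span ℝ (Set.range fun a ↦ s a y) = fiber i y

variable {l : ℕ} {k : Fin l → ℕ}

theorem Decomposition.bijective (D : Decomposition m M l k) (x : M) :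
    Function.Bijective (DirectSum.coeLinearMap fun j ↦ D.fiber j x) :=
  D.isInternal x

/-- The projection `P_i` of `T_x M` onto the fiber of `E_i` along the other summands. -/
def Decomposition.proj (D : Decomposition m M l k) (i : Fin l) (x : M) :
    TangentSpace (𝓡 m) x →ₗ[ℝ] TangentSpace (𝓡 m) x :=
  (D.fiber i x).subtype ∘ₗ DirectSum.component ℝ (Fin l) (fun j ↦ D.fiber j x) i ∘ₗ
    (LinearEquiv.ofBijective (DirectSum.coeLinearMap fun j ↦ D.fiber j x)
      (D.bijective x)).symm.toLinearMap

/-- `Met_⊥`: the metrics for which `E_i ⊥ E_j` whenever `i ≠ j`. -/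
def compatible (D : Decomposition m M l k) : Set (Met m M) :=
  {g | ∀ i j, i ≠ j → ∀ x, ∀ v ∈ D.fiber i x, ∀ w ∈ D.fiber j x, g.inner x v w = 0}

/-- `[[g]]`: the compatible metrics `g'` with `g'_i = f_i² g_i` on `E_i` for all `i`, with positive
functions `f_1, …, f_l`. -/
def multiconformalClass (D : Decomposition m M l k) (g : Met m M) : Set (Met m M) :=
  {g' | g' ∈ compatible D ∧ ∃ f : Fin l → M → ℝ,
    (∀ i, ContMDiff (𝓡 m) 𝓘(ℝ, ℝ) ∞ (f i)) ∧ (∀ i x, 0 < f i x) ∧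
    ∀ i x, ∀ v ∈ D.fiber i x, ∀ w ∈ D.fiber i x,
      g'.inner x v w = f i x ^ 2 * g.inner x v w}

/-- `g_i`, extended to `TM` by `g_i(X, Y) = g(P_i X, P_i Y)`. -/
def metricPart (D : Decomposition m M l k) (g : Met m M) (i : Fin l) (x : M)
    (v w : TangentSpace (𝓡 m) x) : ℝ :=
  g.inner x (D.proj i x v) (D.proj i x w)

/-- `Ric_i^g(X, Y) = Ric^g(P_i X, P_i Y)`. -/
def ricciPart (D : Decomposition m M l k) (g : Met m M) (i : Fin l) (x : M)
    (v w : TangentSpace (𝓡 m) x) : ℝ :=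
  ricci g x (D.proj i x v) (D.proj i x w)

/-- `R_i^g = tr^g Ric_i^g`. -/
def scalarPart (D : Decomposition m M l k) (g : Met m M) (i : Fin l) (x : M) : ℝ :=
  trace g x (ricciPart D g i x)

end Multiconformal

end

set_option synthInstance.maxHeartbeats 100000
set_option linter.unusedSectionVars false

/-! Along a curve of metrics with velocity h, the total scalar curvature varies by ∫ (R tr h / 2 -
⟨Ric, h⟩) dμ and the volume V by ∫ (tr h / 2) dμ. Since 2 / p_m = (m - 2) / m, the derivative of the
normalized functional is, up to the factor V^(-2/p_m), the integral of λ tr h - ⟨Ric, h⟩, where λ =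
R / 2 - (m - 2) / (2m) · R̄ and R̄ is the mean of R (`IsSmoothCurve.hasDerivAt_einsteinHilbert`,
`multiplier`).

Necessity. The velocities φ g_i are tangent to the multiconformal class, and arbitrary φ forces R_i
= λ m_i. Among the compatible metrics one may also use φ X♭ ⊗ X♭ with X a section of E_i, which
forces Ric(X, X) = λ g(X, X), hence Ric_i = λ g_i by polarization. In both cases the sum of the
traces is R = m λ. Inserted into the definition of λ, with m ≠ 2, this gives λ = R̄ / m, a constant
(`multiplier_eq_of_scalar_eq`). Thus constancy comes from the normalization of the functional, not
from a Bianchi identity.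

Sufficiency. If the equations hold with a constant c, then R = m c and λ = c. The velocity of an
admissible curve is block diagonal, and in the multiconformal case a pointwise combination of the
g_i, so λ tr h - ⟨Ric, h⟩ vanishes at every point (`isCriticalOn_of_velocity`).

Most of the work is the variation formula, obtained from the index formulas in charts. Christoffel
symbols and curvature are defined for a matrix function on any normed space E with chosen directions
e_i. A curve of metrics becomes a matrix function on ℝ × ℝᵐ, time is one more direction τ, and the
exchange of ∂_τ with ∂_i is the symmetry of second derivatives. The Palatini identity
(`palatini_array`, `sum_inv_dd_ric`) turns √det · gⁱʲ ∂_τ R_ij into the coordinate divergence of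
√det · W. To discard it globally, one needs that W is a vector field
(`IsSmoothCurve.velocityField_change`), a partition of unity ρ_a, integration by parts in each
chart, and ∑ dρ_a(W) = 0. Since the curvature at a point is defined through the chart at that point,
the tensor law `CoordChange.ric_law` is needed as well. -/

noncomputable section

namespace Multiconformal

/-! ### Directional derivatives of functions and of matrix functions. -/

section LocalCalculus

variable {m : ℕ} {E : Type*} [NormedAddCommGroup E] [NormedSpace ℝ E]

/-- The derivative of `f` at `x` in the direction `v`. -/
def dd (v : E) (f : E → ℝ) (x : E) : ℝ := fderiv ℝ f x v

theorem contDiffAt_dd {f : E → ℝ} {x : E} (hf : ContDiffAt ℝ ∞ f x) (v : E) :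
    ContDiffAt ℝ ∞ (dd v f) x := by
  have h : ContDiffAt ℝ ∞ (fderiv ℝ f) x := hf.fderiv_right (by simp)
  exact h.clm_apply contDiffAt_const

theorem dd_congr {f g : E → ℝ} {x : E} (h : f =ᶠ[𝓝 x] g) (v : E) : dd v f x = dd v g x := by
  rw [dd, dd, h.fderiv_eq]

theorem dd_const (v : E) (c : ℝ) (x : E) : dd v (fun _ ↦ c) x = 0 := by
  simp [dd]

theorem dd_add {f g : E → ℝ} {x : E} (hf : ContDiffAt ℝ ∞ f x) (hg : ContDiffAt ℝ ∞ g x) (v : E) :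
    dd v (fun z ↦ f z + g z) x = dd v f x + dd v g x := by
  rw [dd, fderiv_fun_add (hf.differentiableAt (by simp)) (hg.differentiableAt (by simp))]; rfl

theorem dd_sub {f g : E → ℝ} {x : E} (hf : ContDiffAt ℝ ∞ f x) (hg : ContDiffAt ℝ ∞ g x) (v : E) :
    dd v (fun z ↦ f z - g z) x = dd v f x - dd v g x := by
  rw [dd, fderiv_fun_sub (hf.differentiableAt (by simp)) (hg.differentiableAt (by simp))]; rfl

theorem dd_mul {f g : E → ℝ} {x : E} (hf : ContDiffAt ℝ ∞ f x) (hg : ContDiffAt ℝ ∞ g x) (v : E) :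
    dd v (fun z ↦ f z * g z) x = dd v f x * g x + f x * dd v g x := by
  rw [dd, fderiv_fun_mul (hf.differentiableAt (by simp)) (hg.differentiableAt (by simp))]
  simp [dd]; ring

theorem dd_sum {ι : Type*} {s : Finset ι} {f : ι → E → ℝ} {x : E}
    (hf : ∀ i, ContDiffAt ℝ ∞ (f i) x) (v : E) :
    dd v (fun z ↦ ∑ i ∈ s, f i z) x = ∑ i ∈ s, dd v (f i) x := by
  rw [dd, fderiv_fun_sum fun i _ ↦ (hf i).differentiableAt (by simp)]
  simp [dd]

theorem dd_const_mul (c : ℝ) {f : E → ℝ} {x : E} (hf : ContDiffAt ℝ ∞ f x) (v : E) :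
    dd v (fun z ↦ c * f z) x = c * dd v f x := by
  rw [dd_mul contDiffAt_const hf, dd_const]; ring

theorem dd_sqrt {f : E → ℝ} {x : E} (hf : ContDiffAt ℝ ∞ f x) (h0 : 0 < f x) (v : E) :
    dd v (fun z ↦ √(f z)) x = √(f x) * (dd v f x / (2 * f x)) := by
  rw [dd, fderiv_sqrt (hf.differentiableAt (by simp)) h0.ne']
  simp only [_root_.smul_apply, smul_eq_mul, dd]
  have h2 : √(f x) ≠ 0 := (Real.sqrt_pos.2 h0).ne'
  have h3 : √(f x) ^ 2 = f x := Real.sq_sqrt h0.le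
  field_simp
  rw [h3, mul_comm]

theorem dd_log {f : E → ℝ} {x : E} (hf : ContDiffAt ℝ ∞ f x) (h0 : 0 < f x) (v : E) :
    dd v (fun z ↦ Real.log (f z)) x = dd v f x / f x := by
  rw [dd, fderiv.log (hf.differentiableAt (by simp)) h0.ne']
  simp only [_root_.smul_apply, smul_eq_mul, dd]
  ring

theorem dd_comm {f : E → ℝ} {x : E} (hf : ContDiffAt ℝ ∞ f x) (v w : E) :
    dd v (dd w f) x = dd w (dd v f) x := by
  have h : DifferentiableAt ℝ (fderiv ℝ f) x :=
    (hf.fderiv_right (m := ∞) (by simp)).differentiableAt (by simp)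
  have key : ∀ a b : E, dd a (dd b f) x = fderiv ℝ (fderiv ℝ f) x a b := by
    intro a b
    have := (h.hasFDerivAt.clm_apply (hasFDerivAt_const b x)).fderiv
    rw [dd, show dd b f = fun z ↦ fderiv ℝ f z b from rfl, this]
    simp
  rw [key, key]
  exact (hf.isSymmSndFDerivAt (by
    rw [minSmoothness_of_isRCLikeNormedField]
    exact WithTop.coe_le_coe.2 (le_top : (2 : ℕ∞) ≤ ⊤))).eq v w

/-- A matrix valued function with smooth entries at `x`. -/
def SmoothMatAt (G : E → Matrix (Fin m) (Fin m) ℝ) (x : E) : Prop :=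
  ∀ i j, ContDiffAt ℝ ∞ (fun z ↦ G z i j) x

/-- The entrywise derivative. -/
def ddMat (v : E) (G : E → Matrix (Fin m) (Fin m) ℝ) (x : E) : Matrix (Fin m) (Fin m) ℝ :=
  Matrix.of fun i j ↦ dd v (fun z ↦ G z i j) x

variable {G : E → Matrix (Fin m) (Fin m) ℝ} {x : E}

theorem SmoothMatAt.det (hG : SmoothMatAt G x) : ContDiffAt ℝ ∞ (fun z ↦ (G z).det) x := by
  simp only [Matrix.det_apply']
  exact ContDiffAt.sum fun σ _ ↦ contDiffAt_const.mul (contDiffAt_prod fun i _ ↦ hG _ _)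

theorem SmoothMatAt.eventually_det (hG : SmoothMatAt G x) (h0 : (G x).det ≠ 0) :
    ∀ᶠ z in 𝓝 x, (G z).det ≠ 0 :=
  hG.det.continuousAt.eventually_ne h0

theorem SmoothMatAt.adjugate (hG : SmoothMatAt G x) :
    SmoothMatAt (fun z ↦ (G z).adjugate) x := by
  intro i j
  simp only [Matrix.adjugate_apply]
  apply SmoothMatAt.det
  intro a b
  by_cases h : a = j
  · subst h; simpa using contDiffAt_const
  · simpa [Matrix.updateRow_ne h] using hG a b

theorem SmoothMatAt.inv (hG : SmoothMatAt G x) (h0 : (G x).det ≠ 0) :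
    SmoothMatAt (fun z ↦ (G z)⁻¹) x := by
  intro i j
  simp only [Matrix.inv_def, Ring.inverse_eq_inv', Matrix.smul_apply, smul_eq_mul]
  exact (hG.det.inv h0).mul (hG.adjugate i j)

theorem ddMat_mul {A B : E → Matrix (Fin m) (Fin m) ℝ} (hA : SmoothMatAt A x)
    (hB : SmoothMatAt B x) (v : E) :
    ddMat v (fun z ↦ A z * B z) x = ddMat v A x * B x + A x * ddMat v B x := by
  ext i j
  simp only [ddMat, Matrix.of_apply, Matrix.mul_apply, Matrix.add_apply]
  rw [dd_sum fun k ↦ (hA i k).mul (hB k j), ← Finset.sum_add_distrib]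
  exact Finset.sum_congr rfl fun k _ ↦ dd_mul (hA i k) (hB k j) v

/-- Differentiate `G * G⁻¹ = 1`, which holds in a neighbourhood of `x` because the determinant stays
nonzero there. -/
theorem ddMat_inv (hG : SmoothMatAt G x) (h0 : (G x).det ≠ 0) (v : E) :
    ddMat v (fun z ↦ (G z)⁻¹) x = -((G x)⁻¹ * ddMat v G x * (G x)⁻¹) := by
  have h1 : ddMat v (fun z ↦ G z * (G z)⁻¹) x = 0 := by
    ext i j
    simp only [ddMat, Matrix.of_apply, Matrix.zero_apply]
    rw [dd_congr (g := fun _ ↦ (1 : Matrix (Fin m) (Fin m) ℝ) i j), dd_const]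
    filter_upwards [hG.eventually_det h0] with z hz
    rw [Matrix.mul_nonsing_inv _ hz.isUnit]
  rw [ddMat_mul hG (hG.inv h0)] at h1
  have h2 : G x * ddMat v (fun z ↦ (G z)⁻¹) x = -(ddMat v G x * (G x)⁻¹) :=
    eq_neg_of_add_eq_zero_right h1
  calc ddMat v (fun z ↦ (G z)⁻¹) x
      = (G x)⁻¹ * (G x * ddMat v (fun z ↦ (G z)⁻¹) x) := by
        rw [← Matrix.mul_assoc, Matrix.nonsing_inv_mul _ h0.isUnit, Matrix.one_mul]
    _ = _ := by rw [h2, Matrix.mul_neg, Matrix.mul_assoc]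

/-- Jacobi's formula. -/
theorem dd_det (hG : SmoothMatAt G x) (h0 : (G x).det ≠ 0) (v : E) :
    dd v (fun z ↦ (G z).det) x = (G x).det * ((G x)⁻¹ * ddMat v G x).trace := by
  have hprod : ∀ σ : Equiv.Perm (Fin m), ContDiffAt ℝ ∞ (fun z ↦ ∏ i, G z (σ i) i) x :=
    fun σ ↦ contDiffAt_prod fun i _ ↦ hG _ _
  have h1 : dd v (fun z ↦ (G z).det) x
      = ∑ i, ((G x).updateCol i (fun a ↦ ddMat v G x a i)).det := by
    simp only [Matrix.det_apply']
    rw [dd_sum fun σ ↦ contDiffAt_const.mul (hprod σ), Finset.sum_comm]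
    refine Finset.sum_congr rfl fun σ _ ↦ ?_
    rw [dd_const_mul _ (hprod σ), ← Finset.mul_sum]
    congr 1
    rw [dd, fderiv_finsetProd (fun i _ ↦ (hG (σ i) i).differentiableAt (by simp))]
    simp only [_root_.sum_apply, _root_.smul_apply, smul_eq_mul]
    refine Finset.sum_congr rfl fun i _ ↦ ?_
    rw [← Finset.prod_erase_mul _ _ (Finset.mem_univ i)]
    congr 1
    · refine Finset.prod_congr rfl fun j hj ↦ ?_
      rw [Matrix.updateCol_ne (Finset.ne_of_mem_erase hj)]
    · rw [Matrix.updateCol_self]; rfl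
  -- By Cramer's rule, replacing a column by a vector and taking the determinant applies the
  -- adjugate to that vector.
  have h2 : ∀ i, ((G x).updateCol i (fun a ↦ ddMat v G x a i)).det
      = ((G x).adjugate * ddMat v G x) i i := by
    intro i
    rw [← Matrix.cramer_apply, Matrix.cramer_eq_adjugate_mulVec]
    rfl
  rw [h1, Finset.sum_congr rfl fun i _ ↦ h2 i, Matrix.inv_def, Ring.inverse_eq_inv',
    Matrix.smul_mul, Matrix.trace_smul, smul_eq_mul, mul_inv_cancel_left₀ h0]
  rfl

theorem dd_sqrt_det (hG : SmoothMatAt G x) (h0 : 0 < (G x).det) (v : E) :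
    dd v (fun z ↦ √(G z).det) x = √(G x).det * (1 / 2 * ((G x)⁻¹ * ddMat v G x).trace) := by
  rw [dd_sqrt hG.det h0, dd_det hG h0.ne']
  congr 1
  field_simp

end LocalCalculus

/-! ### Index algebra of the Palatini identity. -/

section Palatini

variable {n : ℕ}

/-- The algebraic core of the Palatini identity: the trace of the linearized Ricci tensor is the
divergence of the vector `Wⁱ = gʲᵏ Aⁱ_jk - gⁱʲ Aᵏ_jk`. -/
theorem palatini_array (g : Fin n → Fin n → ℝ) (Γ A : Fin n → Fin n → Fin n → ℝ)
    (dA : Fin n → Fin n → Fin n → Fin n → ℝ) (hg : ∀ i j, g i j = g j i)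
    (hΓ : ∀ k i j, Γ k i j = Γ k j i) (hA : ∀ k i j, A k i j = A k j i) :
    ∑ i, ∑ j, g i j * (∑ k, (dA k k i j - dA j k i k)
        + ∑ k, ∑ l, ((A k k l * Γ l i j + Γ k k l * A l i j)
          - (A k j l * Γ l i k + Γ k j l * A l i k)))
      = ∑ i, ((∑ l, Γ l i l) * (∑ j, ∑ k, g j k * A i j k - ∑ j, ∑ k, g i j * A k j k)
        + (∑ j, ∑ k, (-(∑ l, (g j l * Γ k i l + Γ j i l * g l k)) * A i j k + g j k * dA i i j k)
          - ∑ j, ∑ k, (-(∑ l, (g i l * Γ j i l + Γ i i l * g l j)) * A k j k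
            + g i j * dA i k j k))) := by
  have s4 : ∀ F : Fin n → Fin n → Fin n → Fin n → ℝ,
      ∑ a, ∑ b, ∑ c, ∑ d, F a b c d = ∑ p : Fin n × Fin n × Fin n × Fin n,
        F p.1 p.2.1 p.2.2.1 p.2.2.2 := by
    intro F; simp only [Fintype.sum_prod_type]
  -- In the application `A` is the time derivative of `Γ` and `dA` its coordinate derivatives. The
  -- right side is an expanded divergence: `∑ l, Γ l i l` is the logarithmic derivative of √det, and
  -- the brackets `-(g Γ + Γ g)` are the derivatives of the inverse metric. Both sides are flattened
  -- and matched term by term after renaming indices.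
  have L : ∑ i, ∑ j, g i j * (∑ k, (dA k k i j - dA j k i k)
        + ∑ k, ∑ l, ((A k k l * Γ l i j + Γ k k l * A l i j)
          - (A k j l * Γ l i k + Γ k j l * A l i k)))
      = ∑ i, ∑ j, ∑ k, g i j * dA k k i j - ∑ i, ∑ j, ∑ k, g i j * dA j k i k
        + (∑ i, ∑ j, ∑ k, ∑ l, g i j * A k k l * Γ l i j
          + ∑ i, ∑ j, ∑ k, ∑ l, g i j * Γ k k l * A l i j)
        - (∑ i, ∑ j, ∑ k, ∑ l, g i j * A k j l * Γ l i k
          + ∑ i, ∑ j, ∑ k, ∑ l, g i j * Γ k j l * A l i k) := by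
    simp only [← Finset.sum_add_distrib, ← Finset.sum_sub_distrib]
    refine Finset.sum_congr rfl fun i _ ↦ Finset.sum_congr rfl fun j _ ↦ ?_
    rw [Finset.mul_sum]
    refine Finset.sum_congr rfl fun k _ ↦ ?_
    rw [mul_add, Finset.mul_sum, add_sub_assoc, ← Finset.sum_sub_distrib, mul_sub]
    congr 1
    exact Finset.sum_congr rfl fun l _ ↦ by ring
  have R : ∑ i, ((∑ l, Γ l i l) * (∑ j, ∑ k, g j k * A i j k - ∑ j, ∑ k, g i j * A k j k)
        + (∑ j, ∑ k, (-(∑ l, (g j l * Γ k i l + Γ j i l * g l k)) * A i j k + g j k * dA i i j k)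
          - ∑ j, ∑ k, (-(∑ l, (g i l * Γ j i l + Γ i i l * g l j)) * A k j k
            + g i j * dA i k j k)))
      = ∑ i, ∑ j, ∑ k, g j k * dA i i j k - ∑ i, ∑ j, ∑ k, g i j * dA i k j k
        + (∑ i, ∑ j, ∑ k, ∑ l, Γ l i l * g j k * A i j k
          - ∑ i, ∑ j, ∑ k, ∑ l, Γ l i l * g i j * A k j k)
        - (∑ i, ∑ j, ∑ k, ∑ l, g j l * Γ k i l * A i j k
          + ∑ i, ∑ j, ∑ k, ∑ l, Γ j i l * g l k * A i j k)
        + (∑ i, ∑ j, ∑ k, ∑ l, g i l * Γ j i l * A k j k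
          + ∑ i, ∑ j, ∑ k, ∑ l, Γ i i l * g l j * A k j k) := by
    simp only [← Finset.sum_add_distrib, ← Finset.sum_sub_distrib]
    refine Finset.sum_congr rfl fun i _ ↦ ?_
    simp only [Finset.mul_sum]
    simp only [← Finset.sum_add_distrib]
    refine Finset.sum_congr rfl fun j _ ↦ ?_
    refine Finset.sum_congr rfl fun k _ ↦ ?_
    simp only [neg_mul, Finset.sum_mul, Finset.sum_add_distrib,
      Finset.sum_sub_distrib, add_mul, mul_sub, mul_assoc]
    ring
  have e3 : ∑ i, ∑ j, ∑ k, g j k * dA i i j k = ∑ i, ∑ j, ∑ k, g i j * dA k k i j := by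
    rw [Finset.sum_comm]
    exact Finset.sum_congr rfl fun i _ ↦ Finset.sum_comm
  have e4 : ∑ i, ∑ j, ∑ k, g i j * dA i k j k = ∑ i, ∑ j, ∑ k, g i j * dA j k i k := by
    rw [Finset.sum_comm]
    simp only [hg]
  have e5 : ∑ i, ∑ j, ∑ k, ∑ l, Γ l i l * g j k * A i j k
      = ∑ i, ∑ j, ∑ k, ∑ l, g i j * Γ k k l * A l i j := by
    rw [s4, s4]
    refine Fintype.sum_bijective (fun p ↦ (p.2.1, p.2.2.1, p.2.2.2, p.1))
      (Function.bijective_iff_has_inverse.2 ⟨fun p ↦ (p.2.2.2, p.1, p.2.1, p.2.2.1),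
        fun _ ↦ rfl, fun _ ↦ rfl⟩) _ _ fun p ↦ ?_
    simp only [hΓ p.2.2.2 p.1 p.2.2.2]; ring
  -- Both of these sums come from the divergence side, with opposite signs, and cancel each other.
  have e6 : ∑ i, ∑ j, ∑ k, ∑ l, Γ l i l * g i j * A k j k
      = ∑ i, ∑ j, ∑ k, ∑ l, Γ i i l * g l j * A k j k := by
    rw [s4, s4]
    refine Fintype.sum_bijective (fun p ↦ (p.2.2.2, p.2.1, p.2.2.1, p.1))
      (Function.bijective_iff_has_inverse.2 ⟨fun p ↦ (p.2.2.2, p.2.1, p.2.2.1, p.1),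
        fun _ ↦ rfl, fun _ ↦ rfl⟩) _ _ fun p ↦ ?_
    simp only [hΓ p.2.2.2 p.1 p.2.2.2]
  have e7 : ∑ i, ∑ j, ∑ k, ∑ l, g i l * Γ j i l * A k j k
      = ∑ i, ∑ j, ∑ k, ∑ l, g i j * A k k l * Γ l i j := by
    rw [s4, s4]
    refine Fintype.sum_bijective (fun p ↦ (p.1, p.2.2.2, p.2.2.1, p.2.1))
      (Function.bijective_iff_has_inverse.2 ⟨fun p ↦ (p.1, p.2.2.2, p.2.2.1, p.2.1),
        fun _ ↦ rfl, fun _ ↦ rfl⟩) _ _ fun p ↦ ?_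
    simp only [hA p.2.2.1 p.2.1 p.2.2.1]; ring
  have e8 : ∑ i, ∑ j, ∑ k, ∑ l, g j l * Γ k i l * A i j k
      = ∑ i, ∑ j, ∑ k, ∑ l, g i j * Γ k j l * A l i k := by
    rw [s4, s4]
    refine Fintype.sum_bijective (fun p ↦ (p.2.1, p.2.2.2, p.2.2.1, p.1))
      (Function.bijective_iff_has_inverse.2 ⟨fun p ↦ (p.2.2.2, p.1, p.2.2.1, p.2.1),
        fun _ ↦ rfl, fun _ ↦ rfl⟩) _ _ fun p ↦ ?_
    simp only [hΓ p.2.2.1 p.1 p.2.2.2]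
  have e9 : ∑ i, ∑ j, ∑ k, ∑ l, Γ j i l * g l k * A i j k
      = ∑ i, ∑ j, ∑ k, ∑ l, g i j * A k j l * Γ l i k := by
    rw [s4, s4]
    refine Fintype.sum_bijective (fun p ↦ (p.2.2.2, p.2.2.1, p.1, p.2.1))
      (Function.bijective_iff_has_inverse.2 ⟨fun p ↦ (p.2.2.1, p.2.2.2, p.2.1, p.1),
        fun _ ↦ rfl, fun _ ↦ rfl⟩) _ _ fun p ↦ ?_
    simp only [hΓ p.2.1 p.1 p.2.2.2, hA p.1 p.2.1 p.2.2.1]; ring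
  rw [L, R, e3, e4, e5, e6, e7, e8, e9]
  ring

theorem inv_symm {A : Matrix (Fin n) (Fin n) ℝ} (hA : A.IsSymm) (i j : Fin n) :
    A⁻¹ i j = A⁻¹ j i := by
  have : (A⁻¹).IsSymm := by
    rw [Matrix.IsSymm, Matrix.transpose_nonsing_inv, hA.eq]
  exact this.apply j i

end Palatini

/-! ### Christoffel symbols, Ricci tensor and the variation of the scalar curvature density of a
matrix function. -/

section Curvature

variable {m : ℕ} {E : Type*} [NormedAddCommGroup E] [NormedSpace ℝ E] (e : Fin m → E)
  (G : E → Matrix (Fin m) (Fin m) ℝ)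

/-- Christoffel symbols of the matrix function `G` for the derivations along the `e i`. -/
def chr (k i j : Fin m) (x : E) : ℝ :=
  (1 / 2 : ℝ) * ∑ l, (G x)⁻¹ k l *
    (dd (e i) (fun z ↦ G z j l) x + dd (e j) (fun z ↦ G z i l) x
      - dd (e l) (fun z ↦ G z i j) x)

/-- The Ricci tensor of the matrix function `G` for the derivations along the `e i`. -/
def ric (i j : Fin m) (x : E) : ℝ :=
  ∑ k, (dd (e k) (chr e G k i j) x - dd (e j) (chr e G k i k) x)
    + ∑ k, ∑ l, (chr e G k k l x * chr e G l i j x - chr e G k j l x * chr e G l i k x)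

/-- The Ricci tensor as a matrix. -/
def ricMat (x : E) : Matrix (Fin m) (Fin m) ℝ := Matrix.of fun i j ↦ ric e G i j x

theorem ricMat_apply (i j : Fin m) (x : E) : ricMat e G x i j = ric e G i j x := rfl

/-- The scalar curvature. -/
def scal (x : E) : ℝ := ∑ i, ∑ j, (G x)⁻¹ i j * ric e G i j x

/-- Christoffel symbols of the first kind. -/
def chrLow (i j l : Fin m) (x : E) : ℝ :=
  (1 / 2 : ℝ) * (dd (e i) (fun z ↦ G z j l) x + dd (e j) (fun z ↦ G z i l) x
      - dd (e l) (fun z ↦ G z i j) x)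

/-- The vector field whose divergence is the trace of the variation of the Ricci tensor in the
direction `τ`. -/
def palatiniField (τ : E) (i : Fin m) (x : E) : ℝ :=
  ∑ j, ∑ k, (G x)⁻¹ j k * dd τ (chr e G i j k) x
    - ∑ j, ∑ k, (G x)⁻¹ i j * dd τ (chr e G k j k) x

variable {e G} {x : E}

theorem chr_eq_sum (k i j : Fin m) (x : E) :
    chr e G k i j x = ∑ l, (G x)⁻¹ k l * chrLow e G i j l x := by
  rw [chr, Finset.mul_sum]
  exact Finset.sum_congr rfl fun l _ ↦ by rw [chrLow]; ring

theorem chr_symm (hs : ∀ z, (G z).IsSymm) (k i j : Fin m) (x : E) :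
    chr e G k i j x = chr e G k j i x := by
  have h : ∀ a b, (fun z ↦ G z a b) = fun z ↦ G z b a := fun a b ↦ funext fun z ↦ (hs z).apply b a
  simp only [chr, h i j]
  congr 1
  exact Finset.sum_congr rfl fun l _ ↦ by ring

theorem dd_eq_chrLow (hs : ∀ z, (G z).IsSymm) (k i j : Fin m) (x : E) :
    ddMat (e k) G x i j = chrLow e G k i j x + chrLow e G k j i x := by
  have h : ∀ a b, (fun z ↦ G z a b) = fun z ↦ G z b a := fun a b ↦ funext fun z ↦ (hs z).apply b a
  simp only [chrLow, ddMat, Matrix.of_apply, h j i]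
  ring

/-- Lowering the upper index with `G` undoes the factor `(G x)⁻¹` in `chr`; this is the Koszul
formula in components. -/
theorem koszul (h0 : (G x).det ≠ 0) (a i j : Fin m) :
    ∑ k, G x a k * chr e G k i j x = chrLow e G i j a x := by
  have h := congrFun (congrArg (fun A : Matrix (Fin m) (Fin m) ℝ ↦
    A.mulVec (fun l ↦ chrLow e G i j l x)) (Matrix.mul_nonsing_inv (G x) h0.isUnit)) a
  simp only [← Matrix.mulVec_mulVec, Matrix.one_mulVec] at h
  rw [← h, Matrix.mulVec, dotProduct]
  exact Finset.sum_congr rfl fun k _ ↦ by rw [chr_eq_sum]; rfl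

/-- This is ∇g⁻¹ = 0: write the derivative of the inverse as -G⁻¹ (∂G) G⁻¹ and split ∂G into two
Christoffel symbols of the first kind. -/
theorem ddMat_inv_eq_chr (hG : SmoothMatAt G x) (hs : ∀ z, (G z).IsSymm) (h0 : (G x).det ≠ 0)
    (k i j : Fin m) :
    dd (e k) (fun z ↦ (G z)⁻¹ i j) x
      = -(∑ l, ((G x)⁻¹ i l * chr e G j k l x + chr e G i k l x * (G x)⁻¹ l j)) := by
  have h := congrFun (congrFun (ddMat_inv hG h0 (e k)) i) j
  rw [ddMat, Matrix.of_apply] at h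
  rw [h, Matrix.neg_apply]
  congr 1
  simp only [Matrix.mul_apply, Finset.sum_add_distrib, dd_eq_chrLow hs, Finset.sum_mul, mul_add,
    add_mul]
  congr 1
  · rw [Finset.sum_comm]
    refine Finset.sum_congr rfl fun l _ ↦ ?_
    rw [chr_eq_sum, Finset.mul_sum]
    exact Finset.sum_congr rfl fun a _ ↦ by rw [inv_symm (hs x) a j]; ring
  · simp only [chr_eq_sum, Finset.sum_mul]

/-- By Jacobi's formula, wherever the determinant is positive, the left side is the derivative of
log √det. The contracted Christoffel symbols are therefore a gradient, which is used both for the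
symmetry of Ricci and for divergences. -/
theorem half_trace_eq_chr (hs : ∀ z, (G z).IsSymm) (k : Fin m) (x : E) :
    1 / 2 * ((G x)⁻¹ * ddMat (e k) G x).trace = ∑ l, chr e G l k l x := by
  simp only [Matrix.trace, Matrix.diag_apply, Matrix.mul_apply, dd_eq_chrLow hs, mul_add,
    Finset.sum_add_distrib, chr_eq_sum]
  rw [Finset.sum_comm]
  have : ∑ y, ∑ a, (G x)⁻¹ a y * chrLow e G k y a x
      = ∑ a, ∑ y, (G x)⁻¹ a y * chrLow e G k a y x := by
    exact Finset.sum_congr rfl fun a _ ↦ Finset.sum_congr rfl fun y _ ↦ by rw [inv_symm (hs x)]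
  rw [this]; ring

theorem contDiffAt_chr (hG : SmoothMatAt G x) (h0 : (G x).det ≠ 0) (k i j : Fin m) :
    ContDiffAt ℝ ∞ (chr e G k i j) x :=
  contDiffAt_const.mul (ContDiffAt.sum fun l _ ↦ (hG.inv h0 k l).mul
    (((contDiffAt_dd (hG j l) _).add (contDiffAt_dd (hG i l) _)).sub (contDiffAt_dd (hG i j) _)))

theorem contDiffAt_ric (hG : SmoothMatAt G x) (h0 : (G x).det ≠ 0) (i j : Fin m) :
    ContDiffAt ℝ ∞ (ric e G i j) x := by
  have h := fun k i j ↦ contDiffAt_chr (e := e) hG h0 k i j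
  exact (ContDiffAt.sum fun k _ ↦ (contDiffAt_dd (h k i j) _).sub (contDiffAt_dd (h k i k) _)).add
    (ContDiffAt.sum fun k _ ↦ ContDiffAt.sum fun l _ ↦
      ((h k k l).mul (h l i j)).sub ((h k j l).mul (h l i k)))

theorem contDiffAt_scal (hG : SmoothMatAt G x) (h0 : (G x).det ≠ 0) :
    ContDiffAt ℝ ∞ (scal e G) x :=
  ContDiffAt.sum fun i _ ↦ ContDiffAt.sum fun j _ ↦ (hG.inv h0 i j).mul (contDiffAt_ric hG h0 i j)

theorem contDiffAt_palatiniField (hG : SmoothMatAt G x) (h0 : (G x).det ≠ 0) (τ : E) (i : Fin m) :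
    ContDiffAt ℝ ∞ (palatiniField e G τ i) x := by
  have h := fun k i j ↦ contDiffAt_dd (contDiffAt_chr (e := e) hG h0 k i j) τ
  exact (ContDiffAt.sum fun j _ ↦ ContDiffAt.sum fun k _ ↦ (hG.inv h0 j k).mul (h i j k)).sub
    (ContDiffAt.sum fun j _ ↦ ContDiffAt.sum fun k _ ↦ (hG.inv h0 i j).mul (h k j k))

theorem contDiffAt_sqrt_det (hG : SmoothMatAt G x) (h0 : 0 < (G x).det) :
    ContDiffAt ℝ ∞ (fun z ↦ √(G z).det) x :=
  hG.det.sqrt h0.ne'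

/-- The only term of the formula for Ricci that is not visibly symmetric is ∂_j Γᵏ_ik. It is the
Hessian of log √det, so second derivatives commute. The identity for Γᵏ_ik is differentiated once
more, which is why smoothness is required in a neighbourhood. -/
theorem ric_symm (hG' : ∀ᶠ z in 𝓝 x, SmoothMatAt G z) (hs : ∀ z, (G z).IsSymm) (h0 : 0 < (G x).det)
    (i j : Fin m) : ric e G i j x = ric e G j i x := by
  have hG := hG'.self_of_nhds
  have hc := fun k i j ↦ contDiffAt_chr (e := e) hG h0.ne' k i j
  have hlog : ContDiffAt ℝ ∞ (fun z ↦ Real.log (G z).det) x := hG.det.log h0.ne'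
  have hpos : ∀ᶠ z in 𝓝 x, 0 < (G z).det ∧ SmoothMatAt G z :=
    (hG.det.continuousAt.eventually (lt_mem_nhds h0)).and hG'
  have key : ∀ i j, ∑ k, dd (e j) (chr e G k i k) x
      = 1 / 2 * dd (e j) (dd (e i) (fun z ↦ Real.log (G z).det)) x := by
    intro i j
    rw [← dd_sum (fun k ↦ hc k i k), ← dd_const_mul _ (contDiffAt_dd hlog _)]
    refine dd_congr ?_ _
    filter_upwards [hpos] with z hz
    rw [dd_log hz.2.det hz.1, dd_det hz.2 hz.1.ne', ← half_trace_eq_chr hs]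
    field_simp [hz.1.ne']
  have h1 : ∀ k, chr e G k i j = chr e G k j i := fun k ↦ funext fun z ↦ chr_symm hs k i j z
  simp only [ric, Finset.sum_sub_distrib, key, h1, dd_comm hlog (e j) (e i)]
  congr 2
  rw [Finset.sum_comm]
  exact Finset.sum_congr rfl fun k _ ↦ Finset.sum_congr rfl fun l _ ↦ by ring

/-- The derivative of the Ricci tensor in terms of that of the Christoffel symbols. -/
theorem dd_ric (hG : SmoothMatAt G x) (h0 : (G x).det ≠ 0) (τ : E) (i j : Fin m) :
    dd τ (ric e G i j) x
      = ∑ k, (dd (e k) (dd τ (chr e G k i j)) x - dd (e j) (dd τ (chr e G k i k)) x)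
        + ∑ k, ∑ l, ((dd τ (chr e G k k l) x * chr e G l i j x
            + chr e G k k l x * dd τ (chr e G l i j) x)
          - (dd τ (chr e G k j l) x * chr e G l i k x
            + chr e G k j l x * dd τ (chr e G l i k) x)) := by
  have h := fun k i j ↦ contDiffAt_chr (e := e) hG h0 k i j
  have hd := fun k i j v ↦ contDiffAt_dd (h k i j) v
  unfold ric
  rw [dd_add (ContDiffAt.sum fun k _ ↦ (hd k i j _).sub (hd k i k _))
    (ContDiffAt.sum fun k _ ↦ ContDiffAt.sum fun l _ ↦
      ((h k k l).mul (h l i j)).sub ((h k j l).mul (h l i k))),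
    dd_sum fun k ↦ (hd k i j _).sub (hd k i k _),
    dd_sum fun k ↦ ContDiffAt.sum fun l _ ↦
      ((h k k l).mul (h l i j)).sub ((h k j l).mul (h l i k))]
  congr 1
  · refine Finset.sum_congr rfl fun k _ ↦ ?_
    rw [dd_sub (hd k i j _) (hd k i k _), dd_comm (h k i j), dd_comm (h k i k)]
  · refine Finset.sum_congr rfl fun k _ ↦ ?_
    rw [dd_sum fun l ↦ ((h k k l).mul (h l i j)).sub ((h k j l).mul (h l i k))]
    refine Finset.sum_congr rfl fun l _ ↦ ?_
    rw [dd_sub ((h k k l).mul (h l i j)) ((h k j l).mul (h l i k)),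
      dd_mul (h k k l) (h l i j), dd_mul (h k j l) (h l i k)]

/-- Divergence of the Palatini field. -/
theorem sum_inv_dd_ric (hG : SmoothMatAt G x) (hs : ∀ z, (G z).IsSymm) (h0 : 0 < (G x).det)
    (τ : E) :
    √(G x).det * ∑ i, ∑ j, (G x)⁻¹ i j * dd τ (ric e G i j) x
      = ∑ i, dd (e i) (fun z ↦ √(G z).det * palatiniField e G τ i z) x := by
  have h := fun k i j ↦ contDiffAt_dd (contDiffAt_chr (e := e) hG h0.ne' k i j) τ
  have hi := hG.inv h0.ne'
  have hsym : ∀ k i j, chr e G k i j = chr e G k j i :=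
    fun k i j ↦ funext fun z ↦ chr_symm hs k i j z
  simp only [dd_ric hG h0.ne']
  rw [palatini_array (fun i j ↦ (G x)⁻¹ i j) (fun k i j ↦ chr e G k i j x)
    (fun k i j ↦ dd τ (chr e G k i j) x) (fun l k i j ↦ dd (e l) (dd τ (chr e G k i j)) x)
    (fun i j ↦ inv_symm (hs x) i j) (fun k i j ↦ chr_symm hs k i j x)
    (fun k i j ↦ by rw [hsym k i j]), Finset.mul_sum]
  refine Finset.sum_congr rfl fun i _ ↦ ?_
  rw [dd_mul (contDiffAt_sqrt_det hG h0) (contDiffAt_palatiniField hG h0.ne' τ i),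
    dd_sqrt_det hG h0, half_trace_eq_chr hs, mul_assoc, ← mul_add]
  congr 2
  unfold palatiniField
  rw [dd_sub (ContDiffAt.sum fun j _ ↦ ContDiffAt.sum fun k _ ↦ (hi j k).mul (h i j k))
    (ContDiffAt.sum fun j _ ↦ ContDiffAt.sum fun k _ ↦ (hi i j).mul (h k j k)),
    dd_sum fun j ↦ ContDiffAt.sum fun k _ ↦ (hi j k).mul (h i j k),
    dd_sum fun j ↦ ContDiffAt.sum fun k _ ↦ (hi i j).mul (h k j k)]
  congr 1
  · refine Finset.sum_congr rfl fun j _ ↦ ?_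
    rw [dd_sum fun k ↦ (hi j k).mul (h i j k)]
    refine Finset.sum_congr rfl fun k _ ↦ ?_
    rw [dd_mul (hi j k) (h i j k), ddMat_inv_eq_chr hG hs h0.ne']
  · refine Finset.sum_congr rfl fun j _ ↦ ?_
    rw [dd_sum fun k ↦ (hi i j).mul (h k j k)]
    refine Finset.sum_congr rfl fun k _ ↦ ?_
    rw [dd_mul (hi i j) (h k j k), ddMat_inv_eq_chr hG hs h0.ne']

theorem scal_eq_trace (hs : ∀ z, (G z).IsSymm) (x : E) :
    scal e G x = ((G x)⁻¹ * ricMat e G x).trace := by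
  simp only [scal, Matrix.trace, Matrix.diag_apply, Matrix.mul_apply, ricMat, Matrix.of_apply]
  rw [Finset.sum_comm]
  exact Finset.sum_congr rfl fun i _ ↦ Finset.sum_congr rfl fun j _ ↦ by rw [inv_symm (hs x)]

/-- First variation of the scalar curvature density. -/
theorem dd_scal_mul_sqrt_det (hG' : ∀ᶠ z in 𝓝 x, SmoothMatAt G z) (hs : ∀ z, (G z).IsSymm)
    (h0 : 0 < (G x).det) (τ : E) :
    dd τ (fun z ↦ scal e G z * √(G z).det) x
      = √(G x).det * (1 / 2 * ((G x)⁻¹ * ddMat τ G x).trace * scal e G x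
          - ((G x)⁻¹ * ddMat τ G x * (G x)⁻¹ * ricMat e G x).trace)
        + ∑ i, dd (e i) (fun z ↦ √(G z).det * palatiniField e G τ i z) x := by
  have hG := hG'.self_of_nhds
  have hr := fun i j ↦ contDiffAt_ric (e := e) hG h0.ne' i j
  have hi := hG.inv h0.ne'
  rw [dd_mul (contDiffAt_scal hG h0.ne') (contDiffAt_sqrt_det hG h0), dd_sqrt_det hG h0,
    ← sum_inv_dd_ric hG hs h0]
  have h1 : dd τ (scal e G) x
      = -((G x)⁻¹ * ddMat τ G x * (G x)⁻¹ * ricMat e G x).trace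
        + ∑ i, ∑ j, (G x)⁻¹ i j * dd τ (ric e G i j) x := by
    unfold scal
    rw [dd_sum fun i ↦ ContDiffAt.sum fun j _ ↦ (hi i j).mul (hr i j)]
    -- The symmetry of Ricci swaps its indices, so that the double sum becomes the trace of a matrix
    -- product.
    have : ∀ i, dd τ (fun z ↦ ∑ j, (G z)⁻¹ i j * ric e G i j z) x
        = ∑ j, (-((G x)⁻¹ * ddMat τ G x * (G x)⁻¹) i j * ric e G j i x)
          + ∑ j, (G x)⁻¹ i j * dd τ (ric e G i j) x := by
      intro i
      rw [dd_sum fun j ↦ (hi i j).mul (hr i j), ← Finset.sum_add_distrib]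
      refine Finset.sum_congr rfl fun j _ ↦ ?_
      rw [dd_mul (hi i j) (hr i j), ric_symm hG' hs h0 i j, ← Matrix.neg_apply,
        ← ddMat_inv hG h0.ne']
      rfl
    rw [Finset.sum_congr rfl fun i _ ↦ this i, Finset.sum_add_distrib]
    congr 1
    rw [Matrix.trace, ← Finset.sum_neg_distrib]
    refine Finset.sum_congr rfl fun i _ ↦ ?_
    rw [Matrix.diag_apply, Matrix.mul_apply, ← Finset.sum_neg_distrib]
    exact Finset.sum_congr rfl fun j _ ↦ by rw [ricMat, Matrix.of_apply]; ring
  rw [h1]; ring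

end Curvature

/-! ### Transformation laws of connection and curvature under a smooth map, without coordinates. -/

section AbstractCoordinateChange

variable {V W : Type*} [NormedAddCommGroup V] [NormedSpace ℝ V] [NormedAddCommGroup W]
  [NormedSpace ℝ W]

theorem contDiffAt_smul_const {f : V → ℝ} {x : V} (hf : ContDiffAt ℝ ∞ f x) (c : W) :
    ContDiffAt ℝ ∞ (fun z ↦ f z • c) x :=
  hf.smul contDiffAt_const

theorem second_fderiv_symm {f : V → W} {x : V} (hf : ContDiffAt ℝ ∞ f x) (v w : V) :
    fderiv ℝ (fderiv ℝ f) x v w = fderiv ℝ (fderiv ℝ f) x w v :=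
  (hf.isSymmSndFDerivAt (by
    rw [minSmoothness_of_isRCLikeNormedField]
    exact WithTop.coe_le_coe.2 (le_top : (2 : ℕ∞) ≤ ⊤))).eq v w

theorem hasFDerivAt_of_smooth {f : V → W} {x : V} (hf : ContDiffAt ℝ ∞ f x) :
    HasFDerivAt f (fderiv ℝ f x) x :=
  (hf.differentiableAt (by simp)).hasFDerivAt

theorem contDiffAt_fderiv {f : V → W} {x : V} (hf : ContDiffAt ℝ ∞ f x) :
    ContDiffAt ℝ ∞ (fderiv ℝ f) x :=
  hf.fderiv_right (by simp)

theorem fderiv_apply_apply {F : V → V →L[ℝ] V →L[ℝ] W} {x : V} (hF : ContDiffAt ℝ ∞ F x)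
    (u v w : V) : fderiv ℝ (fun z ↦ F z v w) x u = fderiv ℝ F x u v w := by
  have := (((hasFDerivAt_of_smooth hF).clm_apply (hasFDerivAt_const v x)).clm_apply
    (hasFDerivAt_const w x)).fderiv
  rw [this]; simp

theorem contDiffAt_apply_apply {F : V → V →L[ℝ] V →L[ℝ] W} {x : V} (hF : ContDiffAt ℝ ∞ F x)
    (v w : V) : ContDiffAt ℝ ∞ (fun z ↦ F z v w) x :=
  (hF.clm_apply contDiffAt_const).clm_apply contDiffAt_const

/-- Transformation law of the derivative of a field of bilinear forms. -/
theorem fderiv_pullback {B B' : V → V →L[ℝ] V →L[ℝ] ℝ} {ψ : V → V} {y : V}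
    (hB : ContDiffAt ℝ ∞ B y) (hB' : ContDiffAt ℝ ∞ B' (ψ y)) (hψ : ContDiffAt ℝ ∞ ψ y)
    (h : ∀ᶠ z in 𝓝 y, ∀ v w, B z v w = B' (ψ z) (fderiv ℝ ψ z v) (fderiv ℝ ψ z w)) (u v w : V) :
    fderiv ℝ B y u v w
      = fderiv ℝ B' (ψ y) (fderiv ℝ ψ y u) (fderiv ℝ ψ y v) (fderiv ℝ ψ y w)
        + B' (ψ y) (fderiv ℝ (fderiv ℝ ψ) y u v) (fderiv ℝ ψ y w)
        + B' (ψ y) (fderiv ℝ ψ y v) (fderiv ℝ (fderiv ℝ ψ) y u w) := by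
  have hψ1 := hasFDerivAt_of_smooth hψ
  have hψ2 := hasFDerivAt_of_smooth (contDiffAt_fderiv hψ)
  have e2 := (((hasFDerivAt_of_smooth hB').comp y hψ1).clm_apply
    (hψ2.clm_apply (hasFDerivAt_const v y))).clm_apply (hψ2.clm_apply (hasFDerivAt_const w y))
  have e3 := (e2.congr_of_eventuallyEq (f₁ := fun z ↦ B z v w) (by
    filter_upwards [h] with z hz
    exact hz v w)).fderiv
  rw [← fderiv_apply_apply hB, e3]
  simp
  ring

/-- Transformation law of the Levi-Civita connection. -/
theorem connection_law {B B' : V → V →L[ℝ] V →L[ℝ] ℝ} {Γ Γ' : V → V →L[ℝ] V →L[ℝ] V}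
    {ψ : V → V} {y : V}
    (hB : ContDiffAt ℝ ∞ B y) (hB' : ContDiffAt ℝ ∞ B' (ψ y)) (hψ : ContDiffAt ℝ ∞ ψ y)
    (h : ∀ᶠ z in 𝓝 y, ∀ v w, B z v w = B' (ψ z) (fderiv ℝ ψ z v) (fderiv ℝ ψ z w))
    (hΓ : ∀ u v w, 2 * B y (Γ y u v) w
      = fderiv ℝ B y u v w + fderiv ℝ B y v u w - fderiv ℝ B y w u v)
    (hΓ' : ∀ u v w, 2 * B' (ψ y) (Γ' (ψ y) u v) w
      = fderiv ℝ B' (ψ y) u v w + fderiv ℝ B' (ψ y) v u w - fderiv ℝ B' (ψ y) w u v)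
    (sym : ∀ a b, B' (ψ y) a b = B' (ψ y) b a)
    (inj : ∀ a b, (∀ w, B' (ψ y) a w = B' (ψ y) b w) → a = b)
    (surj : Function.Surjective (fderiv ℝ ψ y)) (u v : V) :
    fderiv ℝ ψ y (Γ y u v)
      = Γ' (ψ y) (fderiv ℝ ψ y u) (fderiv ℝ ψ y v) + fderiv ℝ (fderiv ℝ ψ) y u v := by
  -- By nondegeneracy it suffices to pair both sides with an arbitrary vector, which may be taken in
  -- the image of the differential. Pulling back the three derivatives in the Koszul formula
  -- produces six terms with second derivatives of `ψ`; by symmetry four of them cancel and the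
  -- other two are equal.
  refine inj _ _ fun w' ↦ ?_
  obtain ⟨w, rfl⟩ := surj w'
  have e1 := hΓ u v w
  have e2 := hΓ' (fderiv ℝ ψ y u) (fderiv ℝ ψ y v) (fderiv ℝ ψ y w)
  rw [fderiv_pullback hB hB' hψ h, fderiv_pullback hB hB' hψ h, fderiv_pullback hB hB' hψ h,
    h.self_of_nhds] at e1
  rw [map_add, _root_.add_apply]
  rw [second_fderiv_symm hψ v u, second_fderiv_symm hψ w u, second_fderiv_symm hψ w v,
    sym (fderiv ℝ ψ y v) (fderiv ℝ (fderiv ℝ ψ) y u w)] at e1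
  linarith

theorem clm_sum {ι : Type*} [Fintype ι] (L : V →L[ℝ] W) (f : ι → V) :
    L (∑ i, f i) = ∑ i, L (f i) :=
  map_sum L f _

/-- The curvature operator `u ↦ R(u, v) w` of the connection with Christoffel symbols `Γ`. -/
def curvOp (Γ : V → V →L[ℝ] V →L[ℝ] V) (y v w : V) : V →ₗ[ℝ] V where
  toFun u := fderiv ℝ Γ y u v w - fderiv ℝ Γ y v u w + Γ y u (Γ y v w) - Γ y v (Γ y u w)
  map_add' a b := by simp only [ContinuousLinearMap.map_add, _root_.add_apply]; abel
  map_smul' c a := by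
    simp only [ContinuousLinearMap.map_smul, _root_.smul_apply, RingHom.id_apply, smul_sub,
      smul_add]

theorem curvOp_apply (Γ : V → V →L[ℝ] V →L[ℝ] V) (y u v w : V) :
    curvOp Γ y v w u
      = fderiv ℝ Γ y u v w - fderiv ℝ Γ y v u w + Γ y u (Γ y v w) - Γ y v (Γ y u w) := rfl

theorem curvOp_sum {ι : Type*} [Fintype ι] (Γ : V → V →L[ℝ] V →L[ℝ] V) (y : V) (b : ι → V)
    (r s : ι → ℝ) :
    curvOp Γ y (∑ j, s j • b j) (∑ i, r i • b i)
      = ∑ i, ∑ j, (r i * s j) • curvOp Γ y (b j) (b i) := by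
  have hs : ∀ u, curvOp Γ y u (∑ i, r i • b i) = ∑ i, r i • curvOp Γ y u (b i) := by
    intro u
    ext a
    simp only [curvOp_apply, clm_sum, ContinuousLinearMap.map_smul, LinearMap.sum_apply,
      LinearMap.smul_apply, smul_sub, smul_add, Finset.sum_add_distrib, Finset.sum_sub_distrib]
  have hr : ∀ u, curvOp Γ y (∑ j, s j • b j) u = ∑ j, s j • curvOp Γ y (b j) u := by
    intro u
    ext a
    have e := clm_sum (W := V →L[ℝ] V →L[ℝ] V) (fderiv ℝ Γ y) (fun j ↦ s j • b j)
    simp only [curvOp_apply, e, clm_sum, ContinuousLinearMap.map_smul, LinearMap.sum_apply,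
      LinearMap.smul_apply, _root_.sum_apply, _root_.smul_apply, smul_sub, smul_add,
      Finset.sum_add_distrib, Finset.sum_sub_distrib]
  rw [hs]
  refine Finset.sum_congr rfl fun i _ ↦ ?_
  rw [hr, Finset.smul_sum]
  exact Finset.sum_congr rfl fun j _ ↦ by rw [smul_smul]

/-- Transformation law of the curvature. -/
theorem curvOp_law {Γ Γ' : V → V →L[ℝ] V →L[ℝ] V} {ψ : V → V} {y : V}
    (hΓ : ContDiffAt ℝ ∞ Γ y) (hΓ' : ContDiffAt ℝ ∞ Γ' (ψ y)) (hψ : ContDiffAt ℝ ∞ ψ y)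
    (h : ∀ᶠ z in 𝓝 y, ∀ u v, fderiv ℝ ψ z (Γ z u v)
      = Γ' (ψ z) (fderiv ℝ ψ z u) (fderiv ℝ ψ z v) + fderiv ℝ (fderiv ℝ ψ) z u v) (u v w : V) :
    fderiv ℝ ψ y (curvOp Γ y v w u)
      = curvOp Γ' (ψ y) (fderiv ℝ ψ y v) (fderiv ℝ ψ y w) (fderiv ℝ ψ y u) := by
  have hψ1 := hasFDerivAt_of_smooth hψ
  have hψ2 := hasFDerivAt_of_smooth (contDiffAt_fderiv hψ)
  have hψ3 := hasFDerivAt_of_smooth (contDiffAt_fderiv (contDiffAt_fderiv hψ))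
  -- Differentiate the connection law in the direction `a` and solve for the term with the
  -- derivative of `Γ`.
  have key : ∀ a b, fderiv ℝ ψ y (fderiv ℝ Γ y a b w)
      = fderiv ℝ Γ' (ψ y) (fderiv ℝ ψ y a) (fderiv ℝ ψ y b) (fderiv ℝ ψ y w)
        + Γ' (ψ y) (fderiv ℝ (fderiv ℝ ψ) y a b) (fderiv ℝ ψ y w)
        + Γ' (ψ y) (fderiv ℝ ψ y b) (fderiv ℝ (fderiv ℝ ψ) y a w)
        + fderiv ℝ (fderiv ℝ (fderiv ℝ ψ)) y a b w
        - fderiv ℝ (fderiv ℝ ψ) y a (Γ y b w) := by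
    intro a b
    have e1 := hψ2.clm_apply (((hasFDerivAt_of_smooth hΓ).clm_apply
      (hasFDerivAt_const b y)).clm_apply (hasFDerivAt_const w y))
    have e2 := ((((hasFDerivAt_of_smooth hΓ').comp y hψ1).clm_apply
      (hψ2.clm_apply (hasFDerivAt_const b y))).clm_apply
      (hψ2.clm_apply (hasFDerivAt_const w y))).add
      ((hψ3.clm_apply (hasFDerivAt_const b y)).clm_apply (hasFDerivAt_const w y))
    have e3 := e2.congr_of_eventuallyEq (f₁ := fun z ↦ fderiv ℝ ψ z (Γ z b w)) (by
      filter_upwards [h] with z hz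
      exact hz b w)
    have := congrArg (fun L ↦ L a) (e1.unique e3)
    simp at this
    rw [eq_sub_iff_add_eq, this]
    abel
  simp only [curvOp_apply, map_add, map_sub, key, h.self_of_nhds]
  -- After antisymmetrization in `u` and `v`, the third derivatives of `ψ` and the symmetric second
  -- derivatives drop out. The remaining second derivatives cancel against those produced by the
  -- quadratic terms in `Γ`.
  rw [second_fderiv_symm (contDiffAt_fderiv hψ) v u, second_fderiv_symm hψ v u]
  abel

end AbstractCoordinateChange

/-! ### The component formulas as invariant objects, and the tensor law for Ricci. -/

section CoordinateChange

variable {m : ℕ}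

/-- The standard basis vectors of the model space. -/
abbrev stdVec (i : Fin m) : Model m := EuclideanSpace.single i 1

theorem sum_smul_stdVec (v : Model m) : ∑ i, v i • (stdVec i : Model m) = v := by
  ext j
  simp [stdVec, Finset.sum_apply, Pi.single_apply]

theorem dd_eq_sum {f : Model m → ℝ} (v x : Model m) :
    dd v f x = ∑ i, v i * dd (stdVec i) f x := by
  conv_lhs => rw [← sum_smul_stdVec v]
  simp [dd]

/-- The bilinear form of a matrix. -/
def bil (A : Matrix (Fin m) (Fin m) ℝ) : Model m →L[ℝ] Model m →L[ℝ] ℝ :=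
  ∑ i, ∑ j, A i j • (EuclideanSpace.proj i : Model m →L[ℝ] ℝ).smulRight
    (EuclideanSpace.proj j : Model m →L[ℝ] ℝ)

theorem bil_apply (A : Matrix (Fin m) (Fin m) ℝ) (v w : Model m) :
    bil A v w = ∑ i, ∑ j, A i j * (v i * w j) := by
  simp [bil]

theorem bil_single (A : Matrix (Fin m) (Fin m) ℝ) (i j : Fin m) :
    bil A (stdVec i) (stdVec j) = A i j := by
  simp [bil_apply, stdVec]

theorem bil_left_injective {A : Matrix (Fin m) (Fin m) ℝ} (hA : A.det ≠ 0) {v v' : Model m}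
    (h : ∀ w, bil A v w = bil A v' w) : v = v' := by
  have h1 : Matrix.vecMul v A = Matrix.vecMul v' A := by
    ext j
    have := h (stdVec j)
    simp only [bil_apply, stdVec, PiLp.single_apply, mul_ite, mul_one, mul_zero,
      Finset.sum_ite_eq', Finset.mem_univ, if_true] at this
    simpa [Matrix.vecMul, dotProduct, mul_comm] using this
  have h2 := congrArg (fun u ↦ Matrix.vecMul u A⁻¹) h1
  simp only [Matrix.vecMul_vecMul, Matrix.mul_nonsing_inv _ hA.isUnit, Matrix.vecMul_one] at h2
  ext i
  exact congrFun h2 i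

variable {G : Model m → Matrix (Fin m) (Fin m) ℝ} {x : Model m}

theorem contDiffAt_bil (hG : SmoothMatAt G x) : ContDiffAt ℝ ∞ (fun z ↦ bil (G z)) x :=
  ContDiffAt.sum fun i _ ↦ ContDiffAt.sum fun j _ ↦ contDiffAt_smul_const (hG i j) _

theorem fderiv_bil (hG : SmoothMatAt G x) (u v w : Model m) :
    fderiv ℝ (fun z ↦ bil (G z)) x u v w = ∑ i, ∑ j, dd u (fun z ↦ G z i j) x * (v i * w j) := by
  rw [← fderiv_apply_apply (contDiffAt_bil hG)]
  change dd u (fun z ↦ bil (G z) v w) x = _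
  simp only [bil_apply]
  rw [dd_sum fun i ↦ ContDiffAt.sum fun j _ ↦ (hG i j).mul contDiffAt_const]
  refine Finset.sum_congr rfl fun i _ ↦ ?_
  rw [dd_sum fun j ↦ (hG i j).mul contDiffAt_const]
  refine Finset.sum_congr rfl fun j _ ↦ ?_
  rw [dd_mul (hG i j) contDiffAt_const, dd_const]; ring

/-- The Christoffel symbols as a bilinear map. -/
def gam (G : Model m → Matrix (Fin m) (Fin m) ℝ) (y : Model m) :
    Model m →L[ℝ] Model m →L[ℝ] Model m :=
  ∑ i, ∑ j, ∑ k, chr stdVec G k i j y • (EuclideanSpace.proj i : Model m →L[ℝ] ℝ).smulRight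
    ((EuclideanSpace.proj j : Model m →L[ℝ] ℝ).smulRight (stdVec k))

theorem gam_apply (y v w : Model m) (k : Fin m) :
    gam G y v w k = ∑ i, ∑ j, chr stdVec G k i j y * (v i * w j) := by
  simp [gam, Finset.sum_apply, Pi.single_apply]

theorem gam_stdVec (y : Model m) (i j k : Fin m) :
    gam G y (stdVec i) (stdVec j) k = chr stdVec G k i j y := by
  simp [gam_apply, stdVec]

theorem contDiffAt_gam (hG : SmoothMatAt G x) (h0 : (G x).det ≠ 0) : ContDiffAt ℝ ∞ (gam G) x :=
  ContDiffAt.sum fun i _ ↦ ContDiffAt.sum fun j _ ↦ ContDiffAt.sum fun k _ ↦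
    contDiffAt_smul_const (contDiffAt_chr hG h0 k i j) _

theorem fderiv_gam (hG : SmoothMatAt G x) (h0 : (G x).det ≠ 0) (i j k l : Fin m) :
    fderiv ℝ (gam G) x (stdVec l) (stdVec i) (stdVec j) k
      = dd (stdVec l) (chr stdVec G k i j) x := by
  rw [← fderiv_apply_apply (contDiffAt_gam hG h0), dd]
  have h3 : chr stdVec G k i j = fun z ↦ (EuclideanSpace.proj k : Model m →L[ℝ] ℝ)
      (gam G z (stdVec i) (stdVec j)) := by
    funext z; simp [gam_stdVec]
  rw [h3]
  exact (congrArg (fun L ↦ L (stdVec l))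
    ((EuclideanSpace.proj k : Model m →L[ℝ] ℝ).hasFDerivAt.comp x (hasFDerivAt_of_smooth
      (contDiffAt_apply_apply (contDiffAt_gam hG h0) (stdVec i) (stdVec j)))).fderiv).symm

/-- The component Koszul formula, contracted with three vectors, becomes the form of the Levi-Civita
condition that `connection_law` takes as hypothesis. -/
theorem bil_gam (hG : SmoothMatAt G x) (hs : ∀ z, (G z).IsSymm) (h0 : (G x).det ≠ 0)
    (u v w : Model m) :
    2 * bil (G x) (gam G x u v) w = fderiv ℝ (fun z ↦ bil (G z)) x u v w
      + fderiv ℝ (fun z ↦ bil (G z)) x v u w - fderiv ℝ (fun z ↦ bil (G z)) x w u v := by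
  have h1 : bil (G x) (gam G x u v) w
      = ∑ i, ∑ j, ∑ l, chrLow stdVec G i j l x * (u i * v j * w l) := by
    have : ∀ a b, G x a b = G x b a := fun a b ↦ (hs x).apply b a
    calc bil (G x) (gam G x u v) w
        = ∑ k, ∑ l, ∑ i, ∑ j, G x l k * chr stdVec G k i j x * (u i * v j * w l) := by
          rw [bil_apply]
          refine Finset.sum_congr rfl fun k _ ↦ Finset.sum_congr rfl fun l _ ↦ ?_
          rw [gam_apply, Finset.sum_mul, Finset.mul_sum]
          refine Finset.sum_congr rfl fun i _ ↦ ?_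
          rw [Finset.sum_mul, Finset.mul_sum]
          exact Finset.sum_congr rfl fun j _ ↦ by rw [this k l]; ring
      _ = ∑ l, ∑ k, ∑ i, ∑ j, G x l k * chr stdVec G k i j x * (u i * v j * w l) :=
          Finset.sum_comm
      _ = ∑ l, ∑ i, ∑ k, ∑ j, G x l k * chr stdVec G k i j x * (u i * v j * w l) :=
          Finset.sum_congr rfl fun l _ ↦ Finset.sum_comm
      _ = ∑ l, ∑ i, ∑ j, ∑ k, G x l k * chr stdVec G k i j x * (u i * v j * w l) :=
          Finset.sum_congr rfl fun l _ ↦ Finset.sum_congr rfl fun i _ ↦ Finset.sum_comm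
      _ = ∑ l, ∑ i, ∑ j, chrLow stdVec G i j l x * (u i * v j * w l) := by
          refine Finset.sum_congr rfl fun l _ ↦ Finset.sum_congr rfl fun i _ ↦
            Finset.sum_congr rfl fun j _ ↦ ?_
          rw [← Finset.sum_mul, koszul h0]
      _ = ∑ i, ∑ l, ∑ j, chrLow stdVec G i j l x * (u i * v j * w l) := Finset.sum_comm
      _ = _ := Finset.sum_congr rfl fun i _ ↦ Finset.sum_comm
  have h2 : fderiv ℝ (fun z ↦ bil (G z)) x u v w
      = ∑ i, ∑ j, ∑ l, dd (stdVec i) (fun z ↦ G z j l) x * (u i * v j * w l) := by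
    rw [fderiv_bil hG]
    simp only [dd_eq_sum u, Finset.sum_mul]
    calc _ = ∑ j, ∑ i, ∑ l, u i * dd (stdVec i) (fun z ↦ G z j l) x * (v j * w l) :=
          Finset.sum_congr rfl fun j _ ↦ Finset.sum_comm
      _ = ∑ i, ∑ j, ∑ l, u i * dd (stdVec i) (fun z ↦ G z j l) x * (v j * w l) := Finset.sum_comm
      _ = _ := Finset.sum_congr rfl fun i _ ↦ Finset.sum_congr rfl fun j _ ↦
          Finset.sum_congr rfl fun l _ ↦ by ring
  have h3 : fderiv ℝ (fun z ↦ bil (G z)) x v u w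
      = ∑ i, ∑ j, ∑ l, dd (stdVec j) (fun z ↦ G z i l) x * (u i * v j * w l) := by
    rw [fderiv_bil hG]
    simp only [dd_eq_sum v, Finset.sum_mul]
    refine Finset.sum_congr rfl fun i _ ↦ ?_
    rw [Finset.sum_comm]
    exact Finset.sum_congr rfl fun j _ ↦ Finset.sum_congr rfl fun l _ ↦ by ring
  have h4 : fderiv ℝ (fun z ↦ bil (G z)) x w u v
      = ∑ i, ∑ j, ∑ l, dd (stdVec l) (fun z ↦ G z i j) x * (u i * v j * w l) := by
    rw [fderiv_bil hG]
    simp only [dd_eq_sum w, Finset.sum_mul]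
    exact Finset.sum_congr rfl fun i _ ↦ Finset.sum_congr rfl fun j _ ↦
      Finset.sum_congr rfl fun l _ ↦ by ring
  rw [h1, h2, h3, h4]
  simp only [Finset.mul_sum, ← Finset.sum_add_distrib, ← Finset.sum_sub_distrib]
  exact Finset.sum_congr rfl fun i _ ↦ Finset.sum_congr rfl fun j _ ↦
    Finset.sum_congr rfl fun l _ ↦ by rw [chrLow]; ring

theorem trace_eq_sum_stdVec (L : Model m →ₗ[ℝ] Model m) :
    LinearMap.trace ℝ (Model m) L = ∑ k, L (stdVec k) k := by
  rw [LinearMap.trace_eq_matrix_trace ℝ (EuclideanSpace.basisFun (Fin m) ℝ).toBasis]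
  simp [Matrix.trace, LinearMap.toMatrix_apply]

/-- This identifies the index formula for Ricci with the trace of the curvature operator, an object
whose behaviour under linear conjugation is evident. -/
theorem trace_curv (hG : SmoothMatAt G x) (hs : ∀ z, (G z).IsSymm) (h0 : (G x).det ≠ 0)
    (i j : Fin m) :
    LinearMap.trace ℝ _ (curvOp (gam G) x (stdVec j) (stdVec i)) = ric stdVec G i j x := by
  have hsym : ∀ k i j, chr stdVec G k i j = chr stdVec G k j i :=
    fun k i j ↦ funext fun z ↦ chr_symm hs k i j z
  have hsm : ∀ (y : Model m) (v : Model m) (l k : Fin m), gam G y (stdVec l) v k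
      = ∑ a, chr stdVec G k l a y * v a := by
    intro y v l k
    simp [gam_apply, stdVec]
  rw [trace_eq_sum_stdVec, ric, ← Finset.sum_add_distrib]
  refine Finset.sum_congr rfl fun k _ ↦ ?_
  simp only [curvOp_apply, PiLp.add_apply, PiLp.sub_apply,
    fderiv_gam hG h0, hsm, Finset.sum_sub_distrib]
  simp only [stdVec, PiLp.single_apply, mul_ite, mul_one, mul_zero, Finset.sum_ite_eq',
    Finset.mem_univ, if_true, hsym _ j i, hsym _ k i]
  ring

variable {G' : Model m → Matrix (Fin m) (Fin m) ℝ} {ψ : Model m → Model m} {U : Set (Model m)}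

/-- The matrix functions `G` and `G'` are related by the coordinate change `ψ` on the open
set `U`. -/
structure CoordChange (G G' : Model m → Matrix (Fin m) (Fin m) ℝ) (ψ : Model m → Model m)
    (U : Set (Model m)) : Prop where
  isOpen : IsOpen U
  smooth : ∀ y ∈ U, SmoothMatAt G y
  smooth' : ∀ y ∈ U, SmoothMatAt G' (ψ y)
  symm : ∀ z, (G z).IsSymm
  symm' : ∀ z, (G' z).IsSymm
  det_ne : ∀ y ∈ U, (G y).det ≠ 0
  det_ne' : ∀ y ∈ U, (G' (ψ y)).det ≠ 0
  contDiffAt : ∀ y ∈ U, ContDiffAt ℝ ∞ ψ y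
  pullback : ∀ y ∈ U, ∀ v w, bil (G y) v w = bil (G' (ψ y)) (fderiv ℝ ψ y v) (fderiv ℝ ψ y w)

/-- A vector in the kernel of the differential would pair to zero with everything under the
pulled-back form, which is nondegenerate. In finite dimension the differential is then invertible,
so no inverse of `ψ` has to be supplied. -/
theorem CoordChange.injective (h : CoordChange G G' ψ U) {y : Model m} (hy : y ∈ U) :
    Function.Injective (fderiv ℝ ψ y) := by
  intro v v' hv
  refine bil_left_injective (h.det_ne y hy) fun w ↦ ?_
  rw [h.pullback y hy, h.pullback y hy, hv]

/-- The differential of the coordinate change as a linear equivalence. -/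
def CoordChange.equiv (h : CoordChange G G' ψ U) {y : Model m} (hy : y ∈ U) :
    Model m ≃ₗ[ℝ] Model m :=
  LinearEquiv.ofInjectiveEndo (fderiv ℝ ψ y : Model m →ₗ[ℝ] Model m) (h.injective hy)

theorem CoordChange.surjective (h : CoordChange G G' ψ U) {y : Model m} (hy : y ∈ U) :
    Function.Surjective (fderiv ℝ ψ y) :=
  (h.equiv hy).surjective

/-- Transformation law of the Christoffel symbols. -/
theorem CoordChange.gam_law (h : CoordChange G G' ψ U) {y : Model m} (hy : y ∈ U)
    (u v : Model m) :
    fderiv ℝ ψ y (gam G y u v)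
      = gam G' (ψ y) (fderiv ℝ ψ y u) (fderiv ℝ ψ y v) + fderiv ℝ (fderiv ℝ ψ) y u v := by
  refine connection_law (contDiffAt_bil (h.smooth y hy)) (contDiffAt_bil (h.smooth' y hy))
    (h.contDiffAt y hy) ?_ (bil_gam (h.smooth y hy) h.symm (h.det_ne y hy))
    (bil_gam (h.smooth' y hy) h.symm' (h.det_ne' y hy)) (fun a b ↦ ?_)
    (fun a b ↦ bil_left_injective (h.det_ne' y hy)) (h.surjective hy) u v
  · filter_upwards [h.isOpen.mem_nhds hy] with z hz
    exact h.pullback z hz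
  · rw [bil_apply, bil_apply, Finset.sum_comm]
    exact Finset.sum_congr rfl fun i _ ↦ Finset.sum_congr rfl fun j _ ↦ by
      rw [(h.symm' (ψ y)).apply i j, mul_comm (a j)]

/-- By `curvOp_law` the two curvature operators are conjugate through the differential of `ψ`, and
conjugate endomorphisms have equal traces. -/
theorem CoordChange.trace_curv (h : CoordChange G G' ψ U) {y : Model m} (hy : y ∈ U)
    (v w : Model m) :
    LinearMap.trace ℝ _ (curvOp (gam G) y v w)
      = LinearMap.trace ℝ _ (curvOp (gam G') (ψ y) (fderiv ℝ ψ y v) (fderiv ℝ ψ y w)) := by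
  have : curvOp (gam G') (ψ y) (fderiv ℝ ψ y v) (fderiv ℝ ψ y w)
      = (h.equiv hy).conj (curvOp (gam G) y v w) := by
    ext1 u'
    obtain ⟨u, rfl⟩ := (h.equiv hy).surjective u'
    rw [LinearEquiv.conj_apply_apply, LinearEquiv.symm_apply_apply]
    exact (curvOp_law (contDiffAt_gam (h.smooth y hy) (h.det_ne y hy))
      (contDiffAt_gam (h.smooth' y hy) (h.det_ne' y hy)) (h.contDiffAt y hy)
      (by filter_upwards [h.isOpen.mem_nhds hy] with z hz; exact h.gam_law hz) u v w).symm
  rw [this, LinearMap.trace_conj']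

/-- The Jacobian matrix of `ψ`. -/
def jac (ψ : Model m → Model m) (y : Model m) : Matrix (Fin m) (Fin m) ℝ :=
  Matrix.of fun c i ↦ fderiv ℝ ψ y (stdVec i) c

theorem bil_transform (A B J : Matrix (Fin m) (Fin m) ℝ) (L : Model m →ₗ[ℝ] Model m)
    (hJ : ∀ i c, J c i = L (stdVec i) c) :
    (∀ v w, bil A v w = bil B (L v) (L w)) ↔ A = J.transpose * B * J := by
  have hL : ∀ v c, L v c = ∑ i, J c i * v i := by
    intro v c
    conv_lhs => rw [← sum_smul_stdVec v]
    simp [hJ, mul_comm]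
  have key : ∀ v w, bil B (L v) (L w) = bil (J.transpose * B * J) v w := by
    intro v w
    have e1 : ∀ (C : Matrix (Fin m) (Fin m) ℝ) (a b : Model m),
        bil C a b = (a : Fin m → ℝ) ⬝ᵥ C.mulVec b := by
      intro C a b
      simp only [bil_apply, dotProduct, Matrix.mulVec, Finset.mul_sum]
      exact Finset.sum_congr rfl fun i _ ↦ Finset.sum_congr rfl fun j _ ↦ by ring
    have e2 : ∀ v, (L v : Fin m → ℝ) = J.mulVec v := fun v ↦ funext fun c ↦ hL v c
    rw [e1, e1, e2, e2, ← Matrix.mulVec_mulVec, ← Matrix.mulVec_mulVec,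
      Matrix.dotProduct_mulVec (v : Fin m → ℝ) J.transpose, Matrix.vecMul_transpose]
  constructor
  · intro h
    ext i j
    rw [← bil_single A, ← bil_single (J.transpose * B * J), h, key]
  · rintro rfl v w
    rw [key]

/-- Ricci is the bilinear form `v, w ↦ tr (u ↦ R(u, w) v)`; invariance of this trace under the
coordinate change is the congruence of the matrices. -/
theorem CoordChange.ric_law (h : CoordChange G G' ψ U) {y : Model m} (hy : y ∈ U) :
    ricMat stdVec G y = (jac ψ y).transpose * ricMat stdVec G' (ψ y) * jac ψ y := by
  have hbil : ∀ (F : Model m → Matrix (Fin m) (Fin m) ℝ) (z : Model m), SmoothMatAt F z →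
      (∀ z, (F z).IsSymm) → (F z).det ≠ 0 → ∀ v w, LinearMap.trace ℝ _ (curvOp (gam F) z w v)
        = bil (ricMat stdVec F z) v w := by
    intro F z hF hs h0 v w
    conv_lhs => rw [← sum_smul_stdVec v, ← sum_smul_stdVec w, curvOp_sum]
    rw [bil_apply]
    simp only [map_sum, map_smul, Multiconformal.trace_curv hF hs h0, smul_eq_mul, ricMat,
      Matrix.of_apply]
    exact Finset.sum_congr rfl fun i _ ↦ Finset.sum_congr rfl fun j _ ↦ by ring
  refine (bil_transform _ _ _ (fderiv ℝ ψ y : Model m →ₗ[ℝ] Model m) fun _ _ ↦ rfl).1 fun v w ↦ ?_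
  rw [← hbil G y (h.smooth y hy) h.symm (h.det_ne y hy), h.trace_curv hy,
    hbil G' (ψ y) (h.smooth' y hy) h.symm' (h.det_ne' y hy)]
  rfl

/-- Transformation law of the Christoffel symbols, in components. -/
theorem CoordChange.chr_law (h : CoordChange G G' ψ U) {y : Model m} (hy : y ∈ U)
    (c i j : Fin m) :
    ∑ k, jac ψ y c k * chr stdVec G k i j y
      = ∑ a, ∑ b, chr stdVec G' c a b (ψ y) * (jac ψ y a i * jac ψ y b j)
        + fderiv ℝ (fderiv ℝ ψ) y (stdVec i) (stdVec j) c := by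
  have := congrArg (fun v : Model m ↦ v c) (h.gam_law hy (stdVec i) (stdVec j))
  rw [PiLp.add_apply, gam_apply] at this
  rw [show (∑ a, ∑ b, chr stdVec G' c a b (ψ y) * (jac ψ y a i * jac ψ y b j))
    = ∑ a, ∑ b, chr stdVec G' c a b (ψ y)
      * (fderiv ℝ ψ y (stdVec i) a * fderiv ℝ ψ y (stdVec j) b) from rfl, ← this]
  conv_rhs => rw [← sum_smul_stdVec (gam G y (stdVec i) (stdVec j))]
  simp only [map_sum, map_smul, gam_stdVec]
  simp [jac, mul_comm]

end CoordinateChange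

/-! ### Contractions are invariant under congruence of matrices. -/

section Congruence

open Matrix

variable {n : ℕ} {G G' J : Matrix (Fin n) (Fin n) ℝ}

theorem isUnit_of_congr (hG : G.det ≠ 0) (h : G = Jᵀ * G' * J) : G'.det ≠ 0 ∧ J.det ≠ 0 := by
  rw [h, det_mul, det_mul] at hG
  exact ⟨fun h0 ↦ hG (by rw [h0]; ring), fun h0 ↦ hG (by rw [h0]; ring)⟩

theorem inv_congr (hG : G.det ≠ 0) (h : G = Jᵀ * G' * J) : J * G⁻¹ * Jᵀ = G'⁻¹ := by
  obtain ⟨h', hJ⟩ := isUnit_of_congr hG h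
  have hJt : Jᵀ.det ≠ 0 := by rwa [det_transpose]
  rw [h, Matrix.mul_inv_rev, Matrix.mul_inv_rev]
  rw [Matrix.mul_assoc, Matrix.mul_assoc, Matrix.mul_assoc, Matrix.nonsing_inv_mul _ hJt.isUnit,
    Matrix.mul_one, ← Matrix.mul_assoc, Matrix.mul_nonsing_inv _ hJ.isUnit, Matrix.one_mul]

/-- The inverse metric transforms by `inv_congr`, and cyclicity of the trace moves the Jacobians
next to it. -/
theorem trace_inv_mul_congr (hG : G.det ≠ 0) (h : G = Jᵀ * G' * J)
    (R : Matrix (Fin n) (Fin n) ℝ) :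
    (G⁻¹ * (Jᵀ * R * J)).trace = (G'⁻¹ * R).trace := by
  rw [← inv_congr hG h, ← Matrix.mul_assoc, Matrix.trace_mul_comm]
  simp only [Matrix.mul_assoc]

theorem trace_inv_mul_inv_mul_congr (hG : G.det ≠ 0) (h : G = Jᵀ * G' * J)
    (R H : Matrix (Fin n) (Fin n) ℝ) :
    (G⁻¹ * (Jᵀ * H * J) * G⁻¹ * (Jᵀ * R * J)).trace = (G'⁻¹ * H * G'⁻¹ * R).trace := by
  rw [← inv_congr hG h, ← Matrix.mul_assoc, Matrix.trace_mul_comm]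
  simp only [Matrix.mul_assoc]

/-- The vector `gʲᵏ Aⁱ_jk - gⁱʲ Aᵏ_jk` depends tensorially on `A`. -/
theorem palatini_vector_congr (hG : G.det ≠ 0) (h : G = Jᵀ * G' * J)
    (A A' : Fin n → Fin n → Fin n → ℝ)
    (hA : ∀ c i j, ∑ k, J c k * A k i j = ∑ a, ∑ b, A' c a b * (J a i * J b j)) (c : Fin n) :
    ∑ i, J c i * (∑ j, ∑ k, G⁻¹ j k * A i j k - ∑ j, ∑ k, G⁻¹ i j * A k j k)
      = ∑ j, ∑ k, G'⁻¹ j k * A' c j k - ∑ j, ∑ k, G'⁻¹ c j * A' k j k := by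
  obtain ⟨h', hJ⟩ := isUnit_of_congr hG h
  have hinv : ∀ a b, G'⁻¹ a b = ∑ j, (∑ i, J a i * G⁻¹ i j) * J b j := by
    intro a b
    rw [← inv_congr hG h]
    simp [Matrix.mul_apply]
  have t1 : ∑ i, J c i * ∑ j, ∑ k, G⁻¹ j k * A i j k = ∑ j, ∑ k, G'⁻¹ j k * A' c j k := by
    calc ∑ i, J c i * ∑ j, ∑ k, G⁻¹ j k * A i j k
        = ∑ j, ∑ k, G⁻¹ j k * ∑ i, J c i * A i j k := by
          simp only [Finset.mul_sum]
          rw [Finset.sum_comm]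
          refine Finset.sum_congr rfl fun j _ ↦ ?_
          rw [Finset.sum_comm]
          exact Finset.sum_congr rfl fun k _ ↦ Finset.sum_congr rfl fun i _ ↦ by ring
      _ = ∑ j, ∑ k, ∑ a, ∑ b, A' c a b * (J a j * G⁻¹ j k * J b k) := by
          refine Finset.sum_congr rfl fun j _ ↦ Finset.sum_congr rfl fun k _ ↦ ?_
          rw [hA, Finset.mul_sum]
          refine Finset.sum_congr rfl fun a _ ↦ ?_
          rw [Finset.mul_sum]
          exact Finset.sum_congr rfl fun b _ ↦ by ring
      _ = ∑ a, ∑ b, ∑ k, ∑ j, A' c a b * (J a j * G⁻¹ j k * J b k) := by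
          rw [Finset.sum_comm]
          have : ∀ k, ∑ j, ∑ a, ∑ b, A' c a b * (J a j * G⁻¹ j k * J b k)
              = ∑ a, ∑ b, ∑ j, A' c a b * (J a j * G⁻¹ j k * J b k) := by
            intro k
            rw [Finset.sum_comm]
            exact Finset.sum_congr rfl fun a _ ↦ Finset.sum_comm
          rw [Finset.sum_congr rfl fun k _ ↦ this k, Finset.sum_comm]
          exact Finset.sum_congr rfl fun a _ ↦ Finset.sum_comm
      _ = _ := by
          refine Finset.sum_congr rfl fun a _ ↦ Finset.sum_congr rfl fun b _ ↦ ?_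
          rw [hinv, Finset.sum_mul]
          refine Finset.sum_congr rfl fun k _ ↦ ?_
          rw [Finset.sum_mul, Finset.sum_mul]
          exact Finset.sum_congr rfl fun j _ ↦ by ring
  -- For fixed `j`, the contraction is the trace of a matrix similar, through `J`, to a combination
  -- of the matrices of `A'`.
  have t2 : ∀ j, ∑ k, A k j k = ∑ a, J a j * ∑ k, A' k a k := by
    intro j
    have hm : J * (Matrix.of fun k k' ↦ A k j k')
        = (∑ a, J a j • Matrix.of fun c b ↦ A' c a b) * J := by
      ext c i
      rw [Matrix.mul_apply]
      simp only [Matrix.of_apply]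
      rw [hA, Matrix.mul_apply, Finset.sum_comm]
      refine Finset.sum_congr rfl fun b _ ↦ ?_
      simp only [Matrix.sum_apply, Matrix.smul_apply, Matrix.of_apply, smul_eq_mul, Finset.sum_mul]
      exact Finset.sum_congr rfl fun a _ ↦ by ring
    have h3 : (Matrix.of fun k k' ↦ A k j k')
        = J⁻¹ * ((∑ a, J a j • Matrix.of fun c b ↦ A' c a b) * J) := by
      rw [← hm, ← Matrix.mul_assoc, Matrix.nonsing_inv_mul _ hJ.isUnit, Matrix.one_mul]
    have h4 := congrArg Matrix.trace h3
    rw [Matrix.trace_mul_comm, Matrix.mul_assoc, Matrix.mul_nonsing_inv _ hJ.isUnit,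
      Matrix.mul_one, Matrix.trace_sum] at h4
    simp only [Matrix.trace_smul, smul_eq_mul] at h4
    exact h4
  have t3 : ∑ i, J c i * ∑ j, ∑ k, G⁻¹ i j * A k j k = ∑ j, ∑ k, G'⁻¹ c j * A' k j k := by
    calc ∑ i, J c i * ∑ j, ∑ k, G⁻¹ i j * A k j k
        = ∑ i, ∑ j, ∑ b, J c i * (G⁻¹ i j * (J b j * ∑ k, A' k b k)) := by
          refine Finset.sum_congr rfl fun i _ ↦ ?_
          rw [Finset.mul_sum]
          refine Finset.sum_congr rfl fun j _ ↦ ?_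
          rw [← Finset.mul_sum, t2, Finset.mul_sum, Finset.mul_sum]
      _ = ∑ b, ∑ j, ∑ i, J c i * (G⁻¹ i j * (J b j * ∑ k, A' k b k)) := by
          rw [Finset.sum_congr rfl fun i _ ↦ Finset.sum_comm, Finset.sum_comm]
          exact Finset.sum_congr rfl fun b _ ↦ Finset.sum_comm
      _ = _ := by
          refine Finset.sum_congr rfl fun b _ ↦ ?_
          rw [← Finset.mul_sum, hinv, Finset.sum_mul]
          refine Finset.sum_congr rfl fun j _ ↦ ?_
          rw [Finset.sum_mul, Finset.sum_mul]
          exact Finset.sum_congr rfl fun i _ ↦ by ring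
  simp only [mul_sub, Finset.sum_sub_distrib, t1, t3]

end Congruence

/-! ### Metrics in charts, and chart independence of the curvature. -/

section Manifold

variable {m : ℕ} {M : Type*} [TopologicalSpace M] [ChartedSpace (Model m) M]
  [IsManifold (𝓡 m) ∞ M]

theorem ricciComp_eq_ric (g : Met m M) (x₀ : M) :
    ricciComp g x₀ = ric stdVec (gram g x₀) := rfl

theorem gram_isSymm (g : Met m M) (x₀ : M) (y : Model m) : (gram g x₀ y).IsSymm := by
  ext i j
  simp only [gram, Matrix.transpose_apply, Matrix.of_apply]
  exact g.symm _ _ _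

/-- In the trivialization at `x₀` the coordinate field is the constant vector `stdVec i`. -/
theorem contMDiffAt_coordVec (x₀ p : M) (hp : p ∈ (chartAt (Model m) x₀).source) (i : Fin m) :
    ContMDiffAt (𝓡 m) ((𝓡 m).prod 𝓘(ℝ, Model m)) ∞
      (fun q : M ↦ TotalSpace.mk' (Model m) (E := fun x : M ↦ TangentSpace (𝓡 m) x)
        q (coordVec x₀ q i)) p := by
  have hb : p ∈ (trivializationAt (Model m) (TangentSpace (𝓡 m) : M → Type _) x₀).baseSet := hp
  rw [(trivializationAt (Model m) (TangentSpace (𝓡 m) : M → Type _) x₀).contMDiffAt_section_iff hb]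
  refine (contMDiffAt_const (c := (stdVec i : Model m))).congr_of_eventuallyEq ?_
  filter_upwards [(trivializationAt (Model m) (TangentSpace (𝓡 m) : M → Type _)
    x₀).open_baseSet.mem_nhds hb] with q hq
  rw [coordVec, Trivialization.symmL_apply _ hq, Trivialization.apply_mk_symm _ hq]

/-- Smoothness of the components of a family of bilinear forms along a smooth base map. -/
theorem contDiffAt_bilin_coordVec {F : Type*} [NormedAddCommGroup F] [NormedSpace ℝ F]
    {b : F → M} {B : (q : F) → TangentSpace (𝓡 m) (b q) →L[ℝ] TangentSpace (𝓡 m) (b q) →L[ℝ] ℝ}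
    {q₀ : F} (x₀ : M) (hb : b q₀ ∈ (chartAt (Model m) x₀).source)
    (hB : ContMDiffAt 𝓘(ℝ, F) ((𝓡 m).prod 𝓘(ℝ, Model m →L[ℝ] Model m →L[ℝ] ℝ)) ∞
      (fun q : F ↦ TotalSpace.mk' (Model m →L[ℝ] Model m →L[ℝ] ℝ)
        (E := fun x : M ↦ TangentSpace (𝓡 m) x →L[ℝ] TangentSpace (𝓡 m) x →L[ℝ] ℝ)
        (b q) (B q)) q₀) (i j : Fin m) :
    ContDiffAt ℝ ∞ (fun q ↦ B q (coordVec x₀ (b q) i) (coordVec x₀ (b q) j)) q₀ := by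
  have hbs : ContMDiffAt 𝓘(ℝ, F) (𝓡 m) ∞ b q₀ := (contMDiffAt_totalSpace.1 hB).1
  have hv : ∀ i, ContMDiffAt 𝓘(ℝ, F) ((𝓡 m).prod 𝓘(ℝ, Model m)) ∞
      (fun q : F ↦ TotalSpace.mk' (Model m) (E := fun x : M ↦ TangentSpace (𝓡 m) x)
        (b q) (coordVec x₀ (b q) i)) q₀ := fun i ↦
    (contMDiffAt_coordVec x₀ (b q₀) hb i).comp q₀ hbs
  have h := ContMDiffAt.clm_bundle_apply₂ (E₃ := Bundle.Trivial M ℝ) (F₃ := ℝ) hB (hv i) (hv j)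
  exact (contMDiffAt_totalSpace.1 h).2.contDiffAt

theorem extChartAt_symm_mem_source {x₀ : M} {y : Model m} (hy : y ∈ (extChartAt (𝓡 m) x₀).target) :
    (extChartAt (𝓡 m) x₀).symm y ∈ (chartAt (Model m) x₀).source := by
  rw [← extChartAt_source (𝓡 m)]
  exact (extChartAt (𝓡 m) x₀).map_target hy

theorem isOpen_target (x₀ : M) : IsOpen (extChartAt (𝓡 m) x₀).target :=
  isOpen_extChartAt_target x₀

theorem contMDiffAt_symm {x₀ : M} {y : Model m} (hy : y ∈ (extChartAt (𝓡 m) x₀).target) :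
    ContMDiffAt 𝓘(ℝ, Model m) (𝓡 m) ∞ (extChartAt (𝓡 m) x₀).symm y :=
  (contMDiffOn_extChartAt_symm x₀).contMDiffAt ((isOpen_target x₀).mem_nhds hy)

/-- The Gram matrices of a curve of metrics, as a function of time and of the chart
coordinates. -/
def curveGram (γ : ℝ → Met m M) (x₀ : M) (q : ℝ × Model m) : Matrix (Fin m) (Fin m) ℝ :=
  gram (γ q.1) x₀ q.2

theorem IsSmoothCurve.smoothMatAt {γ : ℝ → Met m M} (hγ : IsSmoothCurve γ) {x₀ : M} (t : ℝ)
    {y : Model m} (hy : y ∈ (extChartAt (𝓡 m) x₀).target) :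
    SmoothMatAt (curveGram γ x₀) (t, y) := by
  intro i j
  have h1 : ContMDiffAt 𝓘(ℝ, ℝ × Model m) (𝓘(ℝ, ℝ).prod (𝓡 m)) ∞
      (fun q : ℝ × Model m ↦ (q.1, (extChartAt (𝓡 m) x₀).symm q.2)) (t, y) :=
    (contDiffAt_fst.contMDiffAt).prodMk
      (ContMDiffAt.comp (t, y) (g := (extChartAt (𝓡 m) x₀).symm) (f := Prod.snd)
        (contMDiffAt_symm hy) contDiffAt_snd.contMDiffAt)
  exact contDiffAt_bilin_coordVec (b := fun q : ℝ × Model m ↦ (extChartAt (𝓡 m) x₀).symm q.2)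
    (B := fun q : ℝ × Model m ↦ (γ q.1).inner ((extChartAt (𝓡 m) x₀).symm q.2)) x₀
    (extChartAt_symm_mem_source hy) ((hγ _).comp (t, y) h1) i j

theorem isSmoothCurve_const (g : Met m M) : IsSmoothCurve (fun _ ↦ g) :=
  g.contMDiff.comp contMDiff_snd

theorem smoothMatAt_gram (g : Met m M) {x₀ : M} {y : Model m}
    (hy : y ∈ (extChartAt (𝓡 m) x₀).target) : SmoothMatAt (gram g x₀) y := fun i j ↦
  ((isSmoothCurve_const g).smoothMatAt 0 hy i j).comp y
    (f := fun z : Model m ↦ ((0 : ℝ), z)) (contDiffAt_const.prodMk contDiffAt_id)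

theorem coordVec_expand {x₀ p : M} (hp : p ∈ (chartAt (Model m) x₀).source)
    (v : TangentSpace (𝓡 m) p) : ∑ i, coord x₀ p v i • coordVec x₀ p i = v := by
  have hb : p ∈ (trivializationAt (Model m) (TangentSpace (𝓡 m) : M → Type _) x₀).baseSet := hp
  simp only [coord, coordVec]
  rw [← Trivialization.symmL_continuousLinearMapAt (R := ℝ)
    (e := trivializationAt (Model m) (TangentSpace (𝓡 m) : M → Type _) x₀) hb v]
  conv_rhs => rw [← sum_smul_stdVec (Trivialization.continuousLinearMapAt ℝ
    (trivializationAt (Model m) (TangentSpace (𝓡 m) : M → Type _) x₀) p v)]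
  rw [map_sum]
  simp only [map_smul]
  rw [Trivialization.symmL_continuousLinearMapAt _ hb]

theorem coord_coordVec {x₀ p : M} (hp : p ∈ (chartAt (Model m) x₀).source) (i j : Fin m) :
    coord x₀ p (coordVec x₀ p i) j = if j = i then 1 else 0 := by
  have hb : p ∈ (trivializationAt (Model m) (TangentSpace (𝓡 m) : M → Type _) x₀).baseSet := hp
  rw [coord, coordVec, Trivialization.continuousLinearMapAt_symmL _ hb]
  simp

theorem coord_sum_smul {ι : Type*} [Fintype ι] (x₀ p : M) (r : ι → ℝ)
    (u : ι → TangentSpace (𝓡 m) p) (j : Fin m) :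
    coord x₀ p (∑ i, r i • u i) j = ∑ i, r i * coord x₀ p (u i) j := by
  have hc : ∀ u, coord x₀ p u j = ((EuclideanSpace.proj j : Model m →L[ℝ] ℝ).comp
      ((trivializationAt (Model m) (TangentSpace (𝓡 m) : M → Type _) x₀).continuousLinearMapAt
        ℝ p)) u := fun u ↦ rfl
  simp only [hc, map_sum, map_smul, smul_eq_mul]

theorem coord_zero (x₀ p : M) (j : Fin m) : coord x₀ p (0 : TangentSpace (𝓡 m) p) j = 0 := by
  rw [coord, map_zero]; rfl

/-- A bilinear form is determined by its components. -/
theorem bilin_expand {x₀ p : M} (hp : p ∈ (chartAt (Model m) x₀).source)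
    (B : TangentSpace (𝓡 m) p →L[ℝ] TangentSpace (𝓡 m) p →L[ℝ] ℝ) (v w : TangentSpace (𝓡 m) p) :
    B v w = ∑ i, ∑ j, B (coordVec x₀ p i) (coordVec x₀ p j)
      * (coord x₀ p v i * coord x₀ p w j) := by
  conv_lhs => rw [← coordVec_expand hp v, ← coordVec_expand hp w]
  simp only [map_sum, map_smul, _root_.sum_apply, _root_.smul_apply, smul_eq_mul, Finset.mul_sum]
  rw [Finset.sum_comm]
  exact Finset.sum_congr rfl fun i _ ↦ Finset.sum_congr rfl fun j _ ↦ by ring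

theorem gram_posDef (g : Met m M) {x₀ : M} {y : Model m}
    (hy : y ∈ (extChartAt (𝓡 m) x₀).target) : (gram g x₀ y).PosDef := by
  have hp := extChartAt_symm_mem_source hy
  refine Matrix.PosDef.of_dotProduct_mulVec_pos ?_ ?_
  · rw [Matrix.IsHermitian, Matrix.conjTranspose_eq_transpose_of_trivial]
    exact gram_isSymm g x₀ y
  · intro v hv
    have hne : ∑ i, v i • coordVec x₀ ((extChartAt (𝓡 m) x₀).symm y) i ≠ 0 := by
      intro h0
      apply hv
      ext j
      have := congrArg (fun u ↦ coord x₀ ((extChartAt (𝓡 m) x₀).symm y) u j) h0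
      simp only [coord_sum_smul, coord_zero, coord_coordVec hp] at this
      simpa using this
    have := g.pos _ _ hne
    simp only [map_sum, map_smul, _root_.sum_apply, _root_.smul_apply, smul_eq_mul] at this
    simp only [dotProduct, Matrix.mulVec, gram, Matrix.of_apply, star_trivial]
    refine this.trans_eq ?_
    refine Finset.sum_congr rfl fun i _ ↦ ?_
    congr 1
    exact Finset.sum_congr rfl fun j _ ↦ by rw [g.symm]; ring

theorem gram_det_pos (g : Met m M) {x₀ : M} {y : Model m}
    (hy : y ∈ (extChartAt (𝓡 m) x₀).target) : 0 < (gram g x₀ y).det :=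
  (gram_posDef g hy).det_pos

/-- The transition map between the charts at `x₀` and at `x₁`. -/
def transition (x₀ x₁ : M) : Model m → Model m :=
  extChartAt (𝓡 m) x₁ ∘ (extChartAt (𝓡 m) x₀).symm

/-- The domain of the transition map. -/
def overlap (x₀ x₁ : M) : Set (Model m) :=
  (extChartAt (𝓡 m) x₀).target ∩ (extChartAt (𝓡 m) x₀).symm ⁻¹' (chartAt (Model m) x₁).source

theorem isOpen_overlap (x₀ x₁ : M) : IsOpen (overlap (m := m) x₀ x₁) :=
  (continuousOn_extChartAt_symm x₀).isOpen_inter_preimage (isOpen_target x₀)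
    (chartAt (Model m) x₁).open_source

theorem transition_mem_target {x₀ x₁ : M} {y : Model m} (hy : y ∈ overlap x₀ x₁) :
    transition x₀ x₁ y ∈ (extChartAt (𝓡 m) x₁).target :=
  (extChartAt (𝓡 m) x₁).map_source (by rw [extChartAt_source]; exact hy.2)

theorem symm_transition {x₀ x₁ : M} {y : Model m} (hy : y ∈ overlap x₀ x₁) :
    (extChartAt (𝓡 m) x₁).symm (transition x₀ x₁ y) = (extChartAt (𝓡 m) x₀).symm y :=
  (extChartAt (𝓡 m) x₁).left_inv (by rw [extChartAt_source]; exact hy.2)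

theorem contDiffAt_transition {x₀ x₁ : M} {y : Model m} (hy : y ∈ overlap x₀ x₁) :
    ContDiffAt ℝ ∞ (transition x₀ x₁) y :=
  ((contMDiffAt_extChartAt' (n := ∞) hy.2).comp y (contMDiffAt_symm hy.1)).contDiffAt

/-- The change of trivialization of the tangent bundle is the derivative of the transition map, so
its matrix is the Jacobian. -/
theorem coordVec_change {x₀ x₁ : M} {y : Model m} (hy : y ∈ overlap x₀ x₁) (i : Fin m) :
    coordVec x₀ ((extChartAt (𝓡 m) x₀).symm y) i
      = ∑ c, jac (transition x₀ x₁) y c i • coordVec x₁ ((extChartAt (𝓡 m) x₀).symm y) c := by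
  set p := (extChartAt (𝓡 m) x₀).symm y with hpdef
  have hp0 : p ∈ (chartAt (Model m) x₀).source := extChartAt_symm_mem_source hy.1
  have hp1 : p ∈ (chartAt (Model m) x₁).source := hy.2
  conv_lhs => rw [← coordVec_expand hp1 (coordVec x₀ p i)]
  refine Finset.sum_congr rfl fun c _ ↦ ?_
  congr 1
  have hyp : extChartAt (𝓡 m) x₀ p = y := (extChartAt (𝓡 m) x₀).right_inv hy.1
  have hs : p ∈ (extChartAt (𝓡 m) x₀).source ∩ (extChartAt (𝓡 m) p).source
      ∩ (extChartAt (𝓡 m) x₁).source := by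
    simp only [extChartAt_source]
    exact ⟨⟨hp0, mem_chart_source _ p⟩, hp1⟩
  rw [coord, coordVec, TangentBundle.continuousLinearMapAt_trivializationAt_eq_core hp1,
    TangentBundle.symmL_trivializationAt_eq_core hp0]
  -- The fibre over `p` is identified with the model space through the preferred chart at `p`, so
  -- the change from `x₀` to `x₁` factors through that chart.
  have h2 := tangentCoordChange_comp (I := 𝓡 m) (v := (stdVec i : Model m)) hs
  rw [jac, Matrix.of_apply]
  have h3 : tangentCoordChange (𝓡 m) x₀ x₁ p = fderiv ℝ (transition x₀ x₁) y := by
    rw [tangentCoordChange_def, hyp]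
    simp only [transition]
    rw [show Set.range (𝓡 m) = Set.univ from ModelWithCorners.Boundaryless.range_eq_univ,
      fderivWithin_univ]
  rw [← h3, ← h2]
  rfl

/-- Change of the matrix of a bilinear form under a coordinate change. -/
theorem bilin_matrix_change {x₀ x₁ : M} {y : Model m} (hy : y ∈ overlap x₀ x₁)
    (B : TangentSpace (𝓡 m) ((extChartAt (𝓡 m) x₀).symm y) →L[ℝ]
      TangentSpace (𝓡 m) ((extChartAt (𝓡 m) x₀).symm y) →L[ℝ] ℝ) :
    (Matrix.of fun i j ↦ B (coordVec x₀ _ i) (coordVec x₀ _ j))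
      = (jac (transition x₀ x₁) y).transpose
        * (Matrix.of fun i j ↦ B (coordVec x₁ _ i) (coordVec x₁ _ j))
        * jac (transition x₀ x₁) y := by
  ext i j
  simp only [Matrix.of_apply, coordVec_change hy, Matrix.mul_apply, Matrix.transpose_apply,
    map_sum, map_smul, _root_.sum_apply, _root_.smul_apply, smul_eq_mul, Finset.sum_mul,
    Finset.mul_sum]
  exact Finset.sum_congr rfl fun i _ ↦ Finset.sum_congr rfl fun j _ ↦ by ring

theorem gram_change (g : Met m M) {x₀ x₁ : M} {y : Model m} (hy : y ∈ overlap x₀ x₁) :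
    gram g x₀ y = (jac (transition x₀ x₁) y).transpose * gram g x₁ (transition x₀ x₁ y)
      * jac (transition x₀ x₁) y := by
  have h := bilin_matrix_change hy (g.inner _)
  have h2 : gram g x₁ (transition x₀ x₁ y)
      = Matrix.of fun i j ↦ g.inner ((extChartAt (𝓡 m) x₀).symm y)
        (coordVec x₁ ((extChartAt (𝓡 m) x₀).symm y) i)
        (coordVec x₁ ((extChartAt (𝓡 m) x₀).symm y) j) := by
    rw [gram, symm_transition hy]
  rw [h2]
  exact h

theorem coordChange_gram (g : Met m M) (x₀ x₁ : M) :
    CoordChange (gram g x₀) (gram g x₁) (transition x₀ x₁) (overlap x₀ x₁) where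
  isOpen := isOpen_overlap x₀ x₁
  smooth _ hy := smoothMatAt_gram g hy.1
  smooth' _ hy := smoothMatAt_gram g (transition_mem_target hy)
  symm := gram_isSymm g x₀
  symm' := gram_isSymm g x₁
  det_ne _ hy := (gram_det_pos g hy.1).ne'
  det_ne' _ hy := (gram_det_pos g (transition_mem_target hy)).ne'
  contDiffAt _ hy := contDiffAt_transition hy
  pullback y hy := (bil_transform _ _ _ (fderiv ℝ (transition x₀ x₁) y : Model m →ₗ[ℝ] Model m)
    fun _ _ ↦ rfl).2 (gram_change g hy)

/-- The matrix of the Ricci tensor in the chart at `x₀`. -/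
abbrev ricciMat (g : Met m M) (x₀ : M) (y : Model m) : Matrix (Fin m) (Fin m) ℝ :=
  ricMat stdVec (gram g x₀) y

theorem mem_overlap {x₀ x₁ p : M} (h0 : p ∈ (chartAt (Model m) x₀).source)
    (h1 : p ∈ (chartAt (Model m) x₁).source) : extChartAt (𝓡 m) x₀ p ∈ overlap x₀ x₁ := by
  rw [← extChartAt_source (𝓡 m)] at h0
  refine ⟨(extChartAt (𝓡 m) x₀).map_source h0, ?_⟩
  rw [Set.mem_preimage, (extChartAt (𝓡 m) x₀).left_inv h0]
  exact h1

theorem extChartAt_left_inv {x₀ p : M} (h0 : p ∈ (chartAt (Model m) x₀).source) :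
    (extChartAt (𝓡 m) x₀).symm (extChartAt (𝓡 m) x₀ p) = p :=
  (extChartAt (𝓡 m) x₀).left_inv (by rwa [extChartAt_source])

theorem transition_extChartAt {x₀ x₁ p : M} (h0 : p ∈ (chartAt (Model m) x₀).source) :
    transition x₀ x₁ (extChartAt (𝓡 m) x₀ p) = extChartAt (𝓡 m) x₁ p := by
  rw [transition, Function.comp_apply, extChartAt_left_inv h0]

theorem scalar_eq_scal_self (g : Met m M) (p : M) :
    scalar g p = scal stdVec (gram g p) (extChartAt (𝓡 m) p p) := by
  have hp := mem_chart_source (Model m) p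
  rw [scalar, trace, scal]
  refine Finset.sum_congr rfl fun i _ ↦ Finset.sum_congr rfl fun j _ ↦ ?_
  congr 1
  rw [ricci]
  simp [coord_coordVec hp, ricciComp_eq_ric]

/-- The definition of `scalar` uses a different chart at every point. Continuity and integration
need an expression valid throughout one fixed chart, and this invariance supplies it. -/
theorem scal_change (g : Met m M) {x₀ x₁ : M} {y : Model m} (hy : y ∈ overlap x₀ x₁) :
    scal stdVec (gram g x₀) y = scal stdVec (gram g x₁) (transition x₀ x₁ y) := by
  rw [scal_eq_trace (gram_isSymm g x₀), scal_eq_trace (gram_isSymm g x₁),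
    (coordChange_gram g x₀ x₁).ric_law hy,
    trace_inv_mul_congr (gram_det_pos g hy.1).ne' (gram_change g hy)]

/-- The scalar curvature can be computed in any chart. -/
theorem scalar_eq_scal (g : Met m M) {x₀ p : M} (hp : p ∈ (chartAt (Model m) x₀).source) :
    scalar g p = scal stdVec (gram g x₀) (extChartAt (𝓡 m) x₀ p) := by
  have h := mem_chart_source (Model m) p
  rw [scalar_eq_scal_self, scal_change g (mem_overlap h hp), transition_extChartAt h]

/-- The Ricci tensor can be computed in any chart. -/
theorem ricci_eq (g : Met m M) {x₀ p : M} (hp : p ∈ (chartAt (Model m) x₀).source)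
    (v w : TangentSpace (𝓡 m) p) :
    ricci g p v w = ∑ i, ∑ j, ricciMat g x₀ (extChartAt (𝓡 m) x₀ p) i j
      * (coord x₀ p v i * coord x₀ p w j) := by
  have h := mem_chart_source (Model m) p
  have hy := mem_overlap h hp
  have hr := (coordChange_gram g p x₀).ric_law hy
  rw [transition_extChartAt h] at hr
  set J := jac (transition p x₀) (extChartAt (𝓡 m) p p) with hJ
  have hc : ∀ (u : TangentSpace (𝓡 m) p) c, coord x₀ p u c = ∑ i, J c i * coord p p u i := by
    intro u c
    have e := coordVec_change hy
    rw [extChartAt_left_inv h] at e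
    conv_lhs => rw [← coordVec_expand h u]
    rw [coord_sum_smul]
    refine Finset.sum_congr rfl fun i _ ↦ ?_
    rw [e i, coord_sum_smul]
    simp only [coord_coordVec hp]
    simp [hJ, mul_comm]
  have hl : ricci g p v w = ∑ i, ∑ j, ricciMat g p (extChartAt (𝓡 m) p p) i j
      * (coord p p v i * coord p p w j) := by
    rw [ricci]
    exact Finset.sum_congr rfl fun i _ ↦ Finset.sum_congr rfl fun j _ ↦ by
      rw [ricciMat, ricMat_apply, ricciComp_eq_ric]; ring
  rw [hl]
  have hv : ∀ (u : TangentSpace (𝓡 m) p), coord x₀ p u = J.mulVec (coord p p u) :=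
    fun u ↦ funext fun c ↦ hc u c
  have hd : ∀ (C : Matrix (Fin m) (Fin m) ℝ) (a b : Fin m → ℝ),
      ∑ i, ∑ j, C i j * (a i * b j) = a ⬝ᵥ C.mulVec b := by
    intro C a b
    simp only [dotProduct, Matrix.mulVec, Finset.mul_sum]
    exact Finset.sum_congr rfl fun i _ ↦ Finset.sum_congr rfl fun j _ ↦ by ring
  rw [hd _ (coord p p v), hd _ (coord x₀ p v), hv v, hv w, ricciMat, hr,
    ← Matrix.mulVec_mulVec, ← Matrix.mulVec_mulVec,
    Matrix.dotProduct_mulVec _ J.transpose, Matrix.vecMul_transpose]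

end Manifold

/-! ### The Riemannian measure: gluing of the chart measures, finiteness, positivity on open sets.
-/

section RiemannianMeasure

variable {m : ℕ} {M : Type*} [TopologicalSpace M] [ChartedSpace (Model m) M]
  [IsManifold (𝓡 m) ∞ M] [MeasurableSpace M] [BorelSpace M]

/-- The density of the Riemannian measure in the chart at `x₀`. -/
def density (g : Met m M) (x₀ : M) (y : Model m) : ℝ := √(gram g x₀ y).det

theorem density_pos (g : Met m M) {x₀ : M} {y : Model m}
    (hy : y ∈ (extChartAt (𝓡 m) x₀).target) : 0 < density g x₀ y :=
  Real.sqrt_pos.2 (gram_det_pos g hy)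

theorem contDiffAt_density (g : Met m M) {x₀ : M} {y : Model m}
    (hy : y ∈ (extChartAt (𝓡 m) x₀).target) : ContDiffAt ℝ ∞ (density g x₀) y :=
  contDiffAt_sqrt_det (smoothMatAt_gram g hy) (gram_det_pos g hy)

theorem continuousOn_density (g : Met m M) (x₀ : M) :
    ContinuousOn (density g x₀) (extChartAt (𝓡 m) x₀).target := fun _ hy ↦
  (contDiffAt_density g hy).continuousAt.continuousWithinAt

theorem aemeasurable_density (g : Met m M) (x₀ : M) :
    AEMeasurable (fun y ↦ ENNReal.ofReal (density g x₀ y))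
      (volume.restrict (extChartAt (𝓡 m) x₀).target) :=
  ((continuousOn_density g x₀).aemeasurable (isOpen_target x₀).measurableSet).ennreal_ofReal

theorem aemeasurable_symm (x₀ : M) :
    AEMeasurable (extChartAt (𝓡 m) x₀).symm (volume.restrict (extChartAt (𝓡 m) x₀).target) :=
  (continuousOn_extChartAt_symm x₀).aemeasurable (isOpen_target x₀).measurableSet

/-- The inverse chart is only controlled on its target, so it is first extended by a constant to a
globally measurable map. -/
theorem measurableSet_target_inter_preimage (x₀ : M) {A : Set M} (hA : MeasurableSet A) :
    MeasurableSet ((extChartAt (𝓡 m) x₀).target ∩ (extChartAt (𝓡 m) x₀).symm ⁻¹' A) := by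
  classical
  have h : Measurable ((extChartAt (𝓡 m) x₀).target.piecewise (extChartAt (𝓡 m) x₀).symm
      fun _ ↦ x₀) :=
    (continuousOn_extChartAt_symm x₀).measurable_piecewise continuousOn_const
      (isOpen_target x₀).measurableSet
  have h2 : (extChartAt (𝓡 m) x₀).target ∩ (extChartAt (𝓡 m) x₀).symm ⁻¹' A
      = (extChartAt (𝓡 m) x₀).target ∩ ((extChartAt (𝓡 m) x₀).target.piecewise
        (extChartAt (𝓡 m) x₀).symm fun _ ↦ x₀) ⁻¹' A := by
    ext y
    refine and_congr_right fun hy ↦ ?_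
    rw [Set.mem_preimage, Set.mem_preimage, Set.piecewise_eq_of_mem _ _ _ hy]
  rw [h2]
  exact (isOpen_target x₀).measurableSet.inter (h hA)

theorem chartVolume_eq_map (g : Met m M) (x₀ : M) :
    chartVolume g x₀ = ((volume.restrict (extChartAt (𝓡 m) x₀).target).withDensity
      fun y ↦ ENNReal.ofReal (density g x₀ y)).map (extChartAt (𝓡 m) x₀).symm := rfl

theorem chartVolume_apply (g : Met m M) (x₀ : M) {A : Set M} (hA : MeasurableSet A) :
    chartVolume g x₀ A = ∫⁻ y in (extChartAt (𝓡 m) x₀).target ∩ (extChartAt (𝓡 m) x₀).symm ⁻¹' A,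
      ENNReal.ofReal (density g x₀ y) := by
  rw [chartVolume_eq_map, Measure.map_apply_of_aemeasurable
    ((aemeasurable_symm x₀).mono_ac (withDensity_absolutelyContinuous _ _)) hA,
    withDensity_apply', Measure.restrict_restrict' (isOpen_target x₀).measurableSet,
    Set.inter_comm]

theorem det_fderiv_eq (f : Model m → Model m) (y : Model m) :
    (fderiv ℝ f y).det = (jac f y).det := by
  rw [ContinuousLinearMap.det, ← LinearMap.det_toMatrix (EuclideanSpace.basisFun (Fin m) ℝ).toBasis]
  congr 1

/-- The determinant of a congruence picks up the square of the Jacobian determinant, whose root is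
the factor in the change of variables formula. -/
theorem density_change (g : Met m M) {x₀ x₁ : M} {y : Model m} (hy : y ∈ overlap x₀ x₁) :
    density g x₀ y = |(jac (transition x₀ x₁) y).det| * density g x₁ (transition x₀ x₁ y) := by
  rw [density, gram_change g hy, Matrix.det_mul, Matrix.det_mul, Matrix.det_transpose, density,
    show ∀ a b : ℝ, a * b * a = a ^ 2 * b by intros; ring, Real.sqrt_mul (sq_nonneg _),
    Real.sqrt_sq_eq_abs]

/-- The chart measures agree on the overlaps of the charts. -/
theorem chartVolume_eq (g : Met m M) (x₀ x₁ : M) {A : Set M} (hA : MeasurableSet A)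
    (h0 : A ⊆ (chartAt (Model m) x₀).source) (h1 : A ⊆ (chartAt (Model m) x₁).source) :
    chartVolume g x₀ A = chartVolume g x₁ A := by
  rw [chartVolume_apply g x₀ hA, chartVolume_apply g x₁ hA]
  set S := (extChartAt (𝓡 m) x₀).target ∩ (extChartAt (𝓡 m) x₀).symm ⁻¹' A with hS
  have hSo : ∀ y ∈ S, y ∈ overlap x₀ x₁ := fun y hy ↦ ⟨hy.1, h1 hy.2⟩
  have himg : (extChartAt (𝓡 m) x₁).target ∩ (extChartAt (𝓡 m) x₁).symm ⁻¹' A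
      = transition x₀ x₁ '' S := by
    ext z
    constructor
    · rintro ⟨hz, hzA⟩
      have hp : (extChartAt (𝓡 m) x₁).symm z ∈ (chartAt (Model m) x₀).source := h0 hzA
      refine ⟨extChartAt (𝓡 m) x₀ ((extChartAt (𝓡 m) x₁).symm z), ⟨?_, ?_⟩, ?_⟩
      · exact (extChartAt (𝓡 m) x₀).map_source (by rwa [extChartAt_source])
      · rw [Set.mem_preimage, extChartAt_left_inv hp]; exact hzA
      · rw [transition_extChartAt hp, (extChartAt (𝓡 m) x₁).right_inv hz]
    · rintro ⟨y, hy, rfl⟩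
      refine ⟨transition_mem_target (hSo y hy), ?_⟩
      rw [Set.mem_preimage, symm_transition (hSo y hy)]
      exact hy.2
  have hinj : Set.InjOn (transition x₀ x₁) S := by
    intro y hy y' hy' h
    have := congrArg (extChartAt (𝓡 m) x₁).symm h
    rw [symm_transition (hSo y hy), symm_transition (hSo y' hy')] at this
    exact (extChartAt (𝓡 m) x₀).symm.injOn hy.1 hy'.1 this
  have hSm : MeasurableSet S := measurableSet_target_inter_preimage x₀ hA
  rw [himg, lintegral_image_eq_lintegral_abs_det_fderiv_mul volume hSm
    (fun y hy ↦ (hasFDerivAt_of_smooth (contDiffAt_transition (hSo y hy))).hasFDerivWithinAt) hinj]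
  refine setLIntegral_congr_fun hSm fun y hy ↦ ?_
  rw [density_change g (hSo y hy), ENNReal.ofReal_mul (abs_nonneg _), det_fderiv_eq]

theorem measurableSet_source (x₀ : M) : MeasurableSet (chartAt (Model m) x₀).source :=
  (chartAt (Model m) x₀).open_source.measurableSet

theorem chartVolume_compl_source (g : Met m M) (x₀ : M) :
    chartVolume g x₀ (chartAt (Model m) x₀).sourceᶜ = 0 := by
  rw [chartVolume_apply g x₀ (measurableSet_source x₀).compl]
  have : (extChartAt (𝓡 m) x₀).target
      ∩ (extChartAt (𝓡 m) x₀).symm ⁻¹' (chartAt (Model m) x₀).sourceᶜ = ∅ := by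
    ext y
    simp only [Set.mem_inter_iff, Set.mem_preimage, Set.mem_compl_iff, Set.mem_empty_iff_false,
      iff_false, not_and, not_not]
    exact fun hy ↦ extChartAt_symm_mem_source hy
  rw [this]; simp

theorem chartVolume_inter_source (g : Met m M) (x₀ : M) (A : Set M) :
    chartVolume g x₀ (A ∩ (chartAt (Model m) x₀).source) = chartVolume g x₀ A :=
  measure_inter_conull (chartVolume_compl_source g x₀)

theorem exists_seq_charts [CompactSpace M] [Nonempty M] :
    ∃ x : ℕ → M, ⋃ n, (chartAt (Model m) (x n)).source = Set.univ := by
  obtain ⟨t, -, ht⟩ := (isCompact_univ (X := M)).elim_nhds_subcover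
    (fun x ↦ (chartAt (Model m) x).source) fun x _ ↦ chart_source_mem_nhds _ x
  have hne : (t : Set M).Nonempty := by
    by_contra h
    rw [Set.not_nonempty_iff_eq_empty, Finset.coe_eq_empty] at h
    subst h
    obtain ⟨p⟩ := ‹Nonempty M›
    simpa using ht (Set.mem_univ p)
  obtain ⟨f, hf⟩ := t.finite_toSet.countable.exists_eq_range hne
  refine ⟨f, Set.eq_univ_of_univ_subset fun p hp ↦ ?_⟩
  obtain ⟨x, hx, hpx⟩ := Set.mem_iUnion₂.1 (ht hp)
  have : x ∈ Set.range f := hf ▸ hx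
  obtain ⟨n, rfl⟩ := this
  exact Set.mem_iUnion.2 ⟨n, hpx⟩

/-- The Riemannian measure restricts to the chart measures. -/
theorem riemVolume_apply [CompactSpace M] (g : Met m M) (x₀ : M) {A : Set M}
    (hA : MeasurableSet A) (h0 : A ⊆ (chartAt (Model m) x₀).source) :
    riemVolume g A = chartVolume g x₀ A := by
  have : Nonempty M := ⟨x₀⟩
  refine le_antisymm ?_ (le_iSup (fun x ↦ chartVolume g x) x₀ A)
  obtain ⟨x, hx⟩ := exists_seq_charts (m := m) (M := M)
  set D := disjointed fun n ↦ (chartAt (Model m) (x n)).source with hD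
  have hDm : ∀ n, MeasurableSet (D n) := MeasurableSet.disjointed fun n ↦ measurableSet_source _
  have hDs : ∀ n, D n ⊆ (chartAt (Model m) (x n)).source :=
    disjointed_subset fun n ↦ (chartAt (Model m) (x n)).source
  have hDU : ⋃ n, D n = Set.univ := by rw [hD, iUnion_disjointed, hx]
  have hsplit : ∀ (ν : Measure M) (B : Set M), MeasurableSet B → ν B = ∑' n, ν (B ∩ D n) := by
    intro ν B hB
    rw [← measure_iUnion _ fun n ↦ hB.inter (hDm n), ← Set.inter_iUnion, hDU, Set.inter_univ]
    intro i j hij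
    exact ((disjoint_disjointed fun n ↦ (chartAt (Model m) (x n)).source) hij).mono
      Set.inter_subset_right Set.inter_subset_right
  -- Chart measures glued over a countable disjoint family of sets, each inside a chart domain.
  -- Since chart measures agree on overlaps, `ν` dominates all of them, hence their supremum, and it
  -- equals the measure of the chart at `x₀` on `A`. This bypasses the fact that a supremum of
  -- measures is not computed set by set.
  let ν : Measure M := Measure.sum fun n ↦ (chartVolume g (x n)).restrict (D n)
  have hν : ∀ B, MeasurableSet B → ν B = ∑' n, chartVolume g (x n) (B ∩ D n) := by
    intro B hB
    rw [Measure.sum_apply _ hB]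
    exact tsum_congr fun n ↦ Measure.restrict_apply hB
  have hle : riemVolume g ≤ ν := by
    refine iSup_le fun x₁ ↦ Measure.le_iff.2 fun B hB ↦ ?_
    rw [hν B hB, hsplit _ B hB]
    refine ENNReal.tsum_le_tsum fun n ↦ ?_
    rw [← chartVolume_inter_source g x₁, chartVolume_eq g x₁ (x n)
      ((hB.inter (hDm n)).inter (measurableSet_source x₁)) Set.inter_subset_right
      (Set.inter_subset_left.trans (Set.inter_subset_right.trans (hDs n)))]
    exact measure_mono Set.inter_subset_left
  refine (hle A).trans_eq ?_
  rw [hν A hA, hsplit _ A hA]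
  exact tsum_congr fun n ↦ (chartVolume_eq g x₀ (x n) (hA.inter (hDm n))
    (Set.inter_subset_left.trans h0) (Set.inter_subset_right.trans (hDs n))).symm

theorem riemVolume_restrict [CompactSpace M] (g : Met m M) (x₀ : M) :
    (riemVolume g).restrict (chartAt (Model m) x₀).source = chartVolume g x₀ := by
  ext A hA
  rw [Measure.restrict_apply hA, riemVolume_apply g x₀ (hA.inter (measurableSet_source x₀))
    Set.inter_subset_right, chartVolume_inter_source]

/-- Near a point the measure is a chart measure, and its continuous density is integrable over a
compact ball inside the chart. -/
instance riemVolume_isLocallyFinite [CompactSpace M] (g : Met m M) :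
    IsLocallyFiniteMeasure (riemVolume g) := by
  refine ⟨fun p ↦ ?_⟩
  obtain ⟨r, hr, hball⟩ := Metric.nhds_basis_closedBall.mem_iff.1
    ((isOpen_target p).mem_nhds (mem_extChartAt_target (I := 𝓡 m) p))
  refine ⟨(extChartAt (𝓡 m) p).source ∩ extChartAt (𝓡 m) p ⁻¹'
    Metric.ball (extChartAt (𝓡 m) p p) r, ?_, ?_⟩
  · exact Filter.inter_mem (extChartAt_source_mem_nhds p)
      ((continuousAt_extChartAt p).preimage_mem_nhds (Metric.ball_mem_nhds _ hr))
  · have hopen : IsOpen ((extChartAt (𝓡 m) p).source ∩ extChartAt (𝓡 m) p ⁻¹'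
        Metric.ball (extChartAt (𝓡 m) p p) r) :=
      (continuousOn_extChartAt p).isOpen_inter_preimage (isOpen_extChartAt_source p)
        Metric.isOpen_ball
    rw [riemVolume_apply g p hopen.measurableSet (by
      rw [extChartAt_source]; exact Set.inter_subset_left), chartVolume_apply g p
      hopen.measurableSet]
    have hc : IsCompact (Metric.closedBall (extChartAt (𝓡 m) p p) r) := isCompact_closedBall _ _
    have hi : IntegrableOn (density g p) (Metric.closedBall (extChartAt (𝓡 m) p p) r) :=
      ((continuousOn_density g p).mono hball).integrableOn_compact hc
    refine lt_of_le_of_lt (lintegral_mono_set ?_) hi.lintegral_lt_top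
    rintro y ⟨hy, -, hy2⟩
    rw [Set.mem_preimage, (extChartAt (𝓡 m) p).right_inv hy] at hy2
    exact Metric.ball_subset_closedBall hy2

instance riemVolume_isFinite [CompactSpace M] (g : Met m M) : IsFiniteMeasure (riemVolume g) :=
  CompactSpace.isFiniteMeasure

/-- A nonempty open set meets a chart in an open set of positive Lebesgue measure, where the density
is strictly positive. This later upgrades almost everywhere identities of continuous functions to
pointwise ones. -/
instance riemVolume_isOpenPos [CompactSpace M] (g : Met m M) :
    (riemVolume g).IsOpenPosMeasure := by
  refine ⟨fun U hU hne h0 ↦ ?_⟩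
  obtain ⟨p, hp⟩ := hne
  have h1 : chartVolume g p U = 0 :=
    le_antisymm ((le_iSup (fun x ↦ chartVolume g x) p U).trans_eq h0) bot_le
  rw [chartVolume_apply g p hU.measurableSet] at h1
  set O := (extChartAt (𝓡 m) p).target ∩ (extChartAt (𝓡 m) p).symm ⁻¹' U with hO
  have hOo : IsOpen O := (continuousOn_extChartAt_symm p).isOpen_inter_preimage (isOpen_target p) hU
  have hOne : O.Nonempty := ⟨extChartAt (𝓡 m) p p, mem_extChartAt_target p, by
    rw [Set.mem_preimage, extChartAt_to_inv]; exact hp⟩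
  rw [lintegral_eq_zero_iff' ((aemeasurable_density g p).mono_measure
    (Measure.restrict_mono Set.inter_subset_left le_rfl))] at h1
  have h2 := (ae_restrict_iff' hOo.measurableSet).1 h1
  apply (hOo.measure_pos volume hOne).ne'
  rw [← nonpos_iff_eq_zero, ← ae_iff.1 h2]
  refine measure_mono fun y hy h ↦ ?_
  have h3 := h hy
  rw [Pi.zero_apply, ENNReal.ofReal_eq_zero] at h3
  exact absurd (density_pos g hy.1) h3.not_gt

theorem integrable_of_continuous [CompactSpace M] (g : Met m M) {f : M → ℝ} (hf : Continuous f) :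
    Integrable f (riemVolume g) :=
  hf.integrable_of_hasCompactSupport (HasCompactSupport.of_compactSpace f)

/-- Integrals of functions supported in a chart domain. -/
theorem integral_riemVolume [CompactSpace M] (g : Met m M) (x₀ : M) {f : M → ℝ}
    (hf : Continuous f) (h0 : ∀ p ∉ (chartAt (Model m) x₀).source, f p = 0) :
    ∫ p, f p ∂(riemVolume g) = ∫ y in (extChartAt (𝓡 m) x₀).target,
      f ((extChartAt (𝓡 m) x₀).symm y) * density g x₀ y := by
  rw [← setIntegral_eq_integral_of_forall_compl_eq_zero h0, riemVolume_restrict,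
    chartVolume_eq_map,
    integral_map ((aemeasurable_symm x₀).mono_ac (withDensity_absolutelyContinuous _ _))
      hf.aestronglyMeasurable,
    integral_withDensity_eq_integral_toReal_smul₀ (aemeasurable_density g x₀)
      (Filter.Eventually.of_forall fun _ ↦ ENNReal.ofReal_lt_top)]
  refine integral_congr_ae (Filter.Eventually.of_forall fun y ↦ ?_)
  simp only [smul_eq_mul]
  rw [ENNReal.toReal_ofReal (show 0 ≤ density g x₀ y from Real.sqrt_nonneg _), mul_comm]

theorem riemVolume_univ_pos [CompactSpace M] [Nonempty M] (g : Met m M) :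
    0 < (riemVolume g).real Set.univ :=
  ENNReal.toReal_pos (isOpen_univ.measure_pos _ Set.univ_nonempty).ne' (measure_ne_top _ _)

end RiemannianMeasure

/-! ### Space and time slices of functions on ℝ × V, and differentiation under the integral sign. -/

section Slices

variable {V : Type*} [NormedAddCommGroup V] [NormedSpace ℝ V]

theorem dd_space_slice {F : ℝ × V → ℝ} {t : ℝ} {y : V} (hF : ContDiffAt ℝ ∞ F (t, y)) (v : V) :
    dd ((0 : ℝ), v) F (t, y) = dd v (fun z ↦ F (t, z)) y := by
  have h := (hasFDerivAt_of_smooth hF).comp y (f := fun z : V ↦ (t, z))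
    (hasFDerivAt_prodMk_right t y)
  rw [dd, dd, show (fun z ↦ F (t, z)) = F ∘ fun z ↦ (t, z) from rfl, h.fderiv]
  rfl

theorem hasDerivAt_time_slice {F : ℝ × V → ℝ} {t : ℝ} {y : V} (hF : ContDiffAt ℝ ∞ F (t, y)) :
    HasDerivAt (fun s ↦ F (s, y)) (dd ((1 : ℝ), (0 : V)) F (t, y)) t :=
  ((hasFDerivAt_of_smooth hF).comp t (f := fun s : ℝ ↦ (s, y))
    (hasFDerivAt_prodMk_left t y)).hasDerivAt

/-- Differentiation under the integral sign for integrands supported in a fixed compact set. -/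
theorem hasDerivAt_integral_of_compact [FiniteDimensional ℝ V] [MeasurableSpace V] [BorelSpace V]
    (μ : Measure V) [IsFiniteMeasureOnCompacts μ] {O K : Set V} (hO : MeasurableSet O)
    (hK : IsCompact K) (hKO : K ⊆ O) {r : V → ℝ} (hr : ContinuousOn r K)
    (hr0 : ∀ y ∈ O, y ∉ K → r y = 0) {Φ : ℝ × V → ℝ}
    (hΦ : ∀ t, ∀ y ∈ K, ContDiffAt ℝ ∞ Φ (t, y)) :
    HasDerivAt (fun t ↦ ∫ y in O, r y * Φ (t, y) ∂μ)
      (∫ y in O, r y * dd ((1 : ℝ), (0 : V)) Φ (0, y) ∂μ) 0 := by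
  have hOK : ∀ F : V → ℝ, ∫ y in O, r y * F y ∂μ = ∫ y in K, r y * F y ∂μ := by
    intro F
    refine (setIntegral_eq_of_subset_of_forall_sdiff_eq_zero hO hKO fun y hy ↦ ?_)
    rw [hr0 y hy.1 hy.2, zero_mul]
  simp only [hOK]
  have hcd : ContinuousOn (fun q : ℝ × V ↦ r q.2 * dd ((1 : ℝ), (0 : V)) Φ q)
      (Set.Icc (-1) 1 ×ˢ K) := by
    refine (hr.comp continuousOn_snd fun q hq ↦ hq.2).mul fun q hq ↦ ?_
    exact (contDiffAt_dd (hΦ q.1 q.2 hq.2) _).continuousAt.continuousWithinAt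
  have hcΦ : ∀ t, ContinuousOn (fun y ↦ r y * Φ (t, y)) K := fun t ↦ hr.mul fun y hy ↦
    ((hΦ t y hy).continuousAt.comp (f := fun z : V ↦ (t, z))
      (by fun_prop)).continuousWithinAt
  have hcd0 : ContinuousOn (fun y ↦ r y * dd ((1 : ℝ), (0 : V)) Φ (0, y)) K := fun y hy ↦
    (hr y hy).mul ((contDiffAt_dd (hΦ 0 y hy) _).continuousAt.comp
      (f := fun z : V ↦ ((0 : ℝ), z)) (by fun_prop)).continuousWithinAt
  -- The dominating function is a constant: the time derivative is continuous on the compact set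
  -- [-1, 1] × K.
  obtain ⟨C, hC⟩ := (isCompact_Icc.prod hK).exists_bound_of_continuousOn hcd
  have := hasDerivAt_integral_of_dominated_loc_of_deriv_le (μ := μ.restrict K) (𝕜 := ℝ)
    (F := fun t y ↦ r y * Φ (t, y)) (F' := fun t y ↦ r y * dd ((1 : ℝ), (0 : V)) Φ (t, y))
    (x₀ := 0) (s := Metric.ball 0 1) (bound := fun _ ↦ C) (Metric.ball_mem_nhds 0 one_pos)
    (Filter.Eventually.of_forall fun t ↦ (hcΦ t).aestronglyMeasurable hK.measurableSet)
    ((hcΦ 0).integrableOn_compact hK) (hcd0.aestronglyMeasurable hK.measurableSet)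
    (by
      filter_upwards [ae_restrict_mem hK.measurableSet] with y hy t ht
      refine hC (t, y) ⟨?_, hy⟩
      rw [Metric.mem_ball, Real.dist_0_eq_abs, abs_lt] at ht
      exact ⟨ht.1.le, ht.2.le⟩)
    (integrableOn_const hK.measure_lt_top.ne)
    (by
      filter_upwards [ae_restrict_mem hK.measurableSet] with y hy t ht
      exact (hasDerivAt_time_slice (hΦ t y hy)).const_mul (r y))
  exact this.2

end Slices

/-! ### A curve of metrics as a matrix function on space-time; its velocity and the field W. -/

section CurveSlices

variable {m : ℕ} {M : Type*} [TopologicalSpace M] [ChartedSpace (Model m) M]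
  [IsManifold (𝓡 m) ∞ M]

/-- The coordinate directions in space-time. -/
abbrev spaceVec (i : Fin m) : ℝ × Model m := (0, stdVec i)

/-- The time direction in space-time. -/
abbrev timeVec (m : ℕ) : ℝ × Model m := (1, 0)

theorem curveGram_isSymm (γ : ℝ → Met m M) (x₀ : M) (q : ℝ × Model m) :
    (curveGram γ x₀ q).IsSymm := gram_isSymm _ _ _

theorem curveGram_det_pos (γ : ℝ → Met m M) {x₀ : M} (t : ℝ) {y : Model m}
    (hy : y ∈ (extChartAt (𝓡 m) x₀).target) : 0 < (curveGram γ x₀ (t, y)).det :=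
  gram_det_pos _ hy

theorem eventually_mem_target {x₀ : M} (t : ℝ) {y : Model m}
    (hy : y ∈ (extChartAt (𝓡 m) x₀).target) :
    ∀ᶠ q in 𝓝 (t, y), q.2 ∈ (extChartAt (𝓡 m) x₀).target :=
  continuousAt_snd.eventually ((isOpen_target x₀).mem_nhds hy)

variable {γ : ℝ → Met m M} {x₀ : M} {y : Model m}

/-- The symbols involve derivatives in the space directions only, so the space-time expression at
time `t` is the one of the metric `γ t`. -/
theorem IsSmoothCurve.chr_slice (hγ : IsSmoothCurve γ) (t : ℝ)
    (hy : y ∈ (extChartAt (𝓡 m) x₀).target) (k i j : Fin m) :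
    chr spaceVec (curveGram γ x₀) k i j (t, y) = chr stdVec (gram (γ t) x₀) k i j y := by
  have h := hγ.smoothMatAt t hy
  rw [chr, chr]
  congr 1
  refine Finset.sum_congr rfl fun l _ ↦ ?_
  rw [dd_space_slice (h j l), dd_space_slice (h i l), dd_space_slice (h i j)]
  rfl

theorem dd_slice (t : ℝ) (hy : y ∈ (extChartAt (𝓡 m) x₀).target)
    {F : ℝ × Model m → ℝ} {f : Model m → ℝ} (hF : ContDiffAt ℝ ∞ F (t, y))
    (hFf : ∀ z ∈ (extChartAt (𝓡 m) x₀).target, F (t, z) = f z) (i : Fin m) :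
    dd (spaceVec i) F (t, y) = dd (stdVec i) f y := by
  rw [dd_space_slice hF]
  refine dd_congr ?_ _
  filter_upwards [(isOpen_target x₀).mem_nhds hy] with z hz
  exact hFf z hz

theorem IsSmoothCurve.ric_slice (hγ : IsSmoothCurve γ) (t : ℝ)
    (hy : y ∈ (extChartAt (𝓡 m) x₀).target) (i j : Fin m) :
    ric spaceVec (curveGram γ x₀) i j (t, y) = ric stdVec (gram (γ t) x₀) i j y := by
  have hc := fun k i j ↦ contDiffAt_chr (e := spaceVec) (hγ.smoothMatAt (x₀ := x₀) t hy)
    (curveGram_det_pos γ t hy).ne' k i j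
  have hs : ∀ l k i j, dd (spaceVec l) (chr spaceVec (curveGram γ x₀) k i j) (t, y)
      = dd (stdVec l) (chr stdVec (gram (γ t) x₀) k i j) y := fun l k i j ↦
    dd_slice t hy (hc k i j) (fun z hz ↦ hγ.chr_slice t hz k i j) l
  simp only [ric, hs, hγ.chr_slice t hy]

theorem IsSmoothCurve.ricMat_slice (hγ : IsSmoothCurve γ) (t : ℝ)
    (hy : y ∈ (extChartAt (𝓡 m) x₀).target) :
    ricMat spaceVec (curveGram γ x₀) (t, y) = ricciMat (γ t) x₀ y := by
  ext i j
  exact hγ.ric_slice t hy i j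

theorem IsSmoothCurve.scal_slice (hγ : IsSmoothCurve γ) (t : ℝ)
    (hy : y ∈ (extChartAt (𝓡 m) x₀).target) :
    scal spaceVec (curveGram γ x₀) (t, y) = scal stdVec (gram (γ t) x₀) y := by
  simp only [scal, hγ.ric_slice t hy]
  rfl

/-- The matrix of the initial velocity of a curve of metrics in the chart at `x₀`. -/
def velocityMat (γ : ℝ → Met m M) (x₀ : M) (y : Model m) : Matrix (Fin m) (Fin m) ℝ :=
  ddMat (timeVec m) (curveGram γ x₀) (0, y)

/-- The vector field `W` of the first variation of the scalar curvature. -/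
def velocityField (γ : ℝ → Met m M) (x₀ : M) (i : Fin m) (y : Model m) : ℝ :=
  palatiniField spaceVec (curveGram γ x₀) (timeVec m) i (0, y)

theorem IsSmoothCurve.hasDerivAt_gram (hγ : IsSmoothCurve γ)
    (hy : y ∈ (extChartAt (𝓡 m) x₀).target) (i j : Fin m) :
    HasDerivAt (fun t ↦ gram (γ t) x₀ y i j) (velocityMat γ x₀ y i j) 0 :=
  hasDerivAt_time_slice (hγ.smoothMatAt 0 hy i j)

theorem smooth_time_slice {F : ℝ × Model m → ℝ} (hF : ContDiffAt ℝ ∞ F (0, y)) :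
    ContDiffAt ℝ ∞ (fun z ↦ F (0, z)) y :=
  hF.comp y (f := fun z : Model m ↦ ((0 : ℝ), z)) (contDiffAt_const.prodMk contDiffAt_id)

theorem IsSmoothCurve.smooth_velocityMat (hγ : IsSmoothCurve γ)
    (hy : y ∈ (extChartAt (𝓡 m) x₀).target) : SmoothMatAt (velocityMat γ x₀) y := fun i j ↦
  smooth_time_slice (contDiffAt_dd (hγ.smoothMatAt 0 hy i j) (timeVec m))

theorem IsSmoothCurve.smooth_velocityField (hγ : IsSmoothCurve γ)
    (hy : y ∈ (extChartAt (𝓡 m) x₀).target) (i : Fin m) :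
    ContDiffAt ℝ ∞ (velocityField γ x₀ i) y :=
  smooth_time_slice (contDiffAt_palatiniField (hγ.smoothMatAt 0 hy)
    (curveGram_det_pos γ 0 hy).ne' (timeVec m) i)

theorem IsSmoothCurve.eventually_smoothMatAt (hγ : IsSmoothCurve γ) (t : ℝ)
    (hy : y ∈ (extChartAt (𝓡 m) x₀).target) :
    ∀ᶠ q in 𝓝 (t, y), SmoothMatAt (curveGram γ x₀) q := by
  filter_upwards [eventually_mem_target t hy] with q hq
  exact hγ.smoothMatAt q.1 hq

/-- First variation of the Riemannian density in a chart. -/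
theorem IsSmoothCurve.dd_density (hγ : IsSmoothCurve γ)
    (hy : y ∈ (extChartAt (𝓡 m) x₀).target) :
    dd (timeVec m) (fun q ↦ √(curveGram γ x₀ q).det) (0, y)
      = density (γ 0) x₀ y * (1 / 2 * ((gram (γ 0) x₀ y)⁻¹ * velocityMat γ x₀ y).trace) :=
  dd_sqrt_det (hγ.smoothMatAt 0 hy) (curveGram_det_pos γ 0 hy) (timeVec m)

/-- First variation of the scalar curvature density in a chart. -/
theorem IsSmoothCurve.dd_scal_density (hγ : IsSmoothCurve γ)
    (hy : y ∈ (extChartAt (𝓡 m) x₀).target) :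
    dd (timeVec m) (fun q ↦ scal spaceVec (curveGram γ x₀) q * √(curveGram γ x₀ q).det) (0, y)
      = density (γ 0) x₀ y *
          (1 / 2 * ((gram (γ 0) x₀ y)⁻¹ * velocityMat γ x₀ y).trace * scal stdVec (gram (γ 0) x₀) y
          - ((gram (γ 0) x₀ y)⁻¹ * velocityMat γ x₀ y * (gram (γ 0) x₀ y)⁻¹
            * ricciMat (γ 0) x₀ y).trace)
        + ∑ i, dd (stdVec i) (fun z ↦ density (γ 0) x₀ z * velocityField γ x₀ i z) y := by
  rw [dd_scal_mul_sqrt_det (hγ.eventually_smoothMatAt 0 hy) (curveGram_isSymm γ x₀)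
    (curveGram_det_pos γ 0 hy), hγ.scal_slice 0 hy, hγ.ricMat_slice 0 hy]
  congr 1
  refine Finset.sum_congr rfl fun i _ ↦ ?_
  exact dd_slice 0 hy ((contDiffAt_sqrt_det (hγ.smoothMatAt 0 hy)
    (curveGram_det_pos γ 0 hy)).mul (contDiffAt_palatiniField (hγ.smoothMatAt 0 hy)
    (curveGram_det_pos γ 0 hy).ne' (timeVec m) i)) (fun z _ ↦ rfl) i

/-- The velocity of a curve of metrics is a tensor. -/
theorem IsSmoothCurve.velocityMat_change (hγ : IsSmoothCurve γ) {x₁ : M}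
    (hy : y ∈ overlap x₀ x₁) :
    velocityMat γ x₀ y = (jac (transition x₀ x₁) y).transpose
      * velocityMat γ x₁ (transition x₀ x₁ y) * jac (transition x₀ x₁) y := by
  ext i j
  refine (hγ.hasDerivAt_gram hy.1 i j).unique ?_
  simp only [fun t ↦ gram_change (γ t) hy, Matrix.mul_apply]
  exact HasDerivAt.fun_sum fun b _ ↦ (HasDerivAt.fun_sum fun a _ ↦
    (hγ.hasDerivAt_gram (transition_mem_target hy) a b).const_mul _).mul_const _

/-- The vector field `W` is a vector field. -/
theorem IsSmoothCurve.velocityField_change (hγ : IsSmoothCurve γ) {x₁ : M}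
    (hy : y ∈ overlap x₀ x₁) (c : Fin m) :
    ∑ i, jac (transition x₀ x₁) y c i * velocityField γ x₀ i y
      = velocityField γ x₁ c (transition x₀ x₁ y) := by
  refine palatini_vector_congr (gram_det_pos (γ 0) hy.1).ne' (gram_change (γ 0) hy)
    (fun k i j ↦ dd (timeVec m) (chr spaceVec (curveGram γ x₀) k i j) (0, y))
    (fun k i j ↦ dd (timeVec m) (chr spaceVec (curveGram γ x₁) k i j) (0, transition x₀ x₁ y))
    (fun c i j ↦ ?_) c
  have h0 : ∀ (z : M) (w : Model m), w ∈ (extChartAt (𝓡 m) z).target → ∀ k i j,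
      HasDerivAt (fun t ↦ chr stdVec (gram (γ t) z) k i j w)
        (dd (timeVec m) (chr spaceVec (curveGram γ z) k i j) (0, w)) 0 := by
    intro z w hw k i j
    have := hasDerivAt_time_slice (contDiffAt_chr (e := spaceVec) (hγ.smoothMatAt (x₀ := z) 0 hw)
      (curveGram_det_pos γ 0 hw).ne' k i j)
    simpa only [hγ.chr_slice _ hw] using this
  have h1 : HasDerivAt (fun t ↦ ∑ k, jac (transition x₀ x₁) y c k
      * chr stdVec (gram (γ t) x₀) k i j y)
      (∑ k, jac (transition x₀ x₁) y c k
        * dd (timeVec m) (chr spaceVec (curveGram γ x₀) k i j) (0, y)) 0 :=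
    HasDerivAt.fun_sum fun k _ ↦ (h0 x₀ y hy.1 k i j).const_mul _
  refine h1.unique ?_
  -- The inhomogeneous term of the Christoffel law, the second derivative of the transition map,
  -- does not depend on `t` and disappears upon differentiation: the variation of a connection is a
  -- tensor.
  simp only [fun t ↦ (coordChange_gram (γ t) x₀ x₁).chr_law hy c i j]
  refine HasDerivAt.add_const _ ?_
  exact HasDerivAt.fun_sum fun a _ ↦ HasDerivAt.fun_sum fun b _ ↦
    (h0 x₁ _ (transition_mem_target hy) c a b).mul_const _

end CurveSlices

/-! ### Partition of unity, and integration by parts in a chart. -/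

section Charts

variable {m : ℕ} {M : Type*} [TopologicalSpace M] [ChartedSpace (Model m) M]

/-- A function given by continuous expressions in all charts is continuous. -/
theorem continuous_of_charts {F : M → ℝ} {f : M → Model m → ℝ}
    (hF : ∀ x₀ p, p ∈ (chartAt (Model m) x₀).source → F p = f x₀ (extChartAt (𝓡 m) x₀ p))
    (hf : ∀ x₀, ∀ y ∈ (extChartAt (𝓡 m) x₀).target, ContinuousAt (f x₀) y) : Continuous F := by
  refine continuous_iff_continuousAt.2 fun p ↦ ?_
  have h := ContinuousAt.comp (hf p _ (mem_extChartAt_target p))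
    (continuousAt_extChartAt (I := 𝓡 m) p)
  refine h.congr ?_
  filter_upwards [(chartAt (Model m) p).open_source.mem_nhds (mem_chart_source _ p)] with q hq
  exact (hF p q hq).symm

variable [IsManifold (𝓡 m) ∞ M]

/-- A finite smooth partition of unity subordinate to the chart domains. -/
theorem exists_finite_partition (m : ℕ) (M : Type*) [TopologicalSpace M]
    [ChartedSpace (Model m) M] [IsManifold (𝓡 m) ∞ M] [T2Space M] [CompactSpace M] :
    ∃ (S : Finset M) (ρ : M → M → ℝ), (∀ a, ContMDiff (𝓡 m) 𝓘(ℝ, ℝ) ∞ (ρ a))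
      ∧ (∀ a, tsupport (ρ a) ⊆ (chartAt (Model m) a).source) ∧ ∀ p, ∑ a ∈ S, ρ a p = 1 := by
  obtain ⟨f, hf⟩ := SmoothPartitionOfUnity.exists_isSubordinate_chartAt_source (𝓡 m) M
  have hfin := f.locallyFinite.finite_nonempty_of_compact
  refine ⟨hfin.toFinset, fun a ↦ f a, fun a ↦ (f a).contMDiff, hf, fun p ↦ ?_⟩
  rw [← f.sum_eq_one (Set.mem_univ p), finsum_eq_sum_of_support_subset]
  intro a ha
  simp only [Set.Finite.coe_toFinset, Set.mem_ofPred_eq]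
  exact ⟨p, ha⟩

theorem contDiffAt_comp_symm {ρ : M → ℝ} (hρ : ContMDiff (𝓡 m) 𝓘(ℝ, ℝ) ∞ ρ) {x₀ : M} {y : Model m}
    (hy : y ∈ (extChartAt (𝓡 m) x₀).target) :
    ContDiffAt ℝ ∞ (fun z ↦ ρ ((extChartAt (𝓡 m) x₀).symm z)) y :=
  (ContMDiffAt.comp y (hρ _) (contMDiffAt_symm hy)).contDiffAt

/-- The image in the chart at `x₀` of the support of a function. -/
def chartSupport (x₀ : M) (ρ : M → ℝ) : Set (Model m) := extChartAt (𝓡 m) x₀ '' tsupport ρ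

variable [CompactSpace M] {ρ : M → ℝ} {x₀ : M}

theorem isCompact_chartSupport (hs : tsupport ρ ⊆ (chartAt (Model m) x₀).source) :
    IsCompact (chartSupport (m := m) x₀ ρ) :=
  (isClosed_tsupport ρ).isCompact.image_of_continuousOn
    ((continuousOn_extChartAt x₀).mono (by rwa [extChartAt_source]))

theorem chartSupport_subset (hs : tsupport ρ ⊆ (chartAt (Model m) x₀).source) :
    chartSupport (m := m) x₀ ρ ⊆ (extChartAt (𝓡 m) x₀).target := by
  rintro _ ⟨p, hp, rfl⟩
  exact (extChartAt (𝓡 m) x₀).map_source (by rw [extChartAt_source]; exact hs hp)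

theorem symm_notMem_of_notMem_chartSupport {y : Model m} (hy : y ∈ (extChartAt (𝓡 m) x₀).target)
    (hyK : y ∉ chartSupport x₀ ρ) : (extChartAt (𝓡 m) x₀).symm y ∉ tsupport ρ := fun h ↦
  hyK ⟨_, h, (extChartAt (𝓡 m) x₀).right_inv hy⟩

theorem eq_zero_of_notMem_chartSupport {y : Model m} (hy : y ∈ (extChartAt (𝓡 m) x₀).target)
    (hyK : y ∉ chartSupport x₀ ρ) : ρ ((extChartAt (𝓡 m) x₀).symm y) = 0 :=
  image_eq_zero_of_notMem_tsupport (symm_notMem_of_notMem_chartSupport hy hyK)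

/-- Integration by parts in a chart against a function supported in the chart domain. -/
theorem integral_chart_by_parts (hρ : ContMDiff (𝓡 m) 𝓘(ℝ, ℝ) ∞ ρ)
    (hs : tsupport ρ ⊆ (chartAt (Model m) x₀).source) {f : Model m → ℝ}
    (hf : ∀ y ∈ (extChartAt (𝓡 m) x₀).target, ContDiffAt ℝ ∞ f y) (v : Model m) :
    ∫ y in (extChartAt (𝓡 m) x₀).target, ρ ((extChartAt (𝓡 m) x₀).symm y) * dd v f y
      = -∫ y in (extChartAt (𝓡 m) x₀).target,
          dd v (fun z ↦ ρ ((extChartAt (𝓡 m) x₀).symm z)) y * f y := by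
  classical
  set T := (extChartAt (𝓡 m) x₀).target with hT
  have hTo : IsOpen T := isOpen_target x₀
  set K := chartSupport (m := m) x₀ ρ with hK
  have hKc : IsCompact K := isCompact_chartSupport hs
  have hKT : K ⊆ T := chartSupport_subset hs
  -- Extended by zero, the cut-off is smooth on the whole model space: near `K` it is the smooth
  -- chart expression, and off `K` it vanishes locally. The other factor is only needed near the
  -- support of `r`.
  set r : Model m → ℝ := T.indicator fun z ↦ ρ ((extChartAt (𝓡 m) x₀).symm z) with hr
  have hrT : ∀ y ∈ T, r =ᶠ[𝓝 y] fun z ↦ ρ ((extChartAt (𝓡 m) x₀).symm z) := by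
    intro y hy
    filter_upwards [hTo.mem_nhds hy] with z hz
    rw [hr, Set.indicator_of_mem hz]
  have hr0 : ∀ y ∉ K, r =ᶠ[𝓝 y] fun _ ↦ 0 := by
    intro y hy
    filter_upwards [hKc.isClosed.isOpen_compl.mem_nhds hy] with z hz
    by_cases hzT : z ∈ T
    · rw [hr, Set.indicator_of_mem hzT]
      exact eq_zero_of_notMem_chartSupport hzT hz
    · rw [hr, Set.indicator_of_notMem hzT]
  have hrs : ∀ y, ContDiffAt ℝ ∞ r y := by
    intro y
    by_cases hy : y ∈ K
    · exact (contDiffAt_comp_symm hρ (hKT hy)).congr_of_eventuallyEq (hrT y (hKT hy))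
    · exact contDiffAt_const.congr_of_eventuallyEq (hr0 y hy)
  have hsupp : tsupport r ⊆ K := by
    refine closure_minimal (fun y hy ↦ ?_) hKc.isClosed
    by_contra h
    exact hy (hr0 y h).self_of_nhds
  have hdr0 : ∀ y ∉ K, dd v r y = 0 := fun y hy ↦ by rw [dd_congr (hr0 y hy), dd_const]
  have hint : ∀ a b : Model m → ℝ, (∀ y ∉ K, a y = 0) → ContinuousOn a K → ContinuousOn b K →
      Integrable (fun y ↦ a y * b y) := by
    intro a b ha0 ha hb
    have h1 : IntegrableOn (fun y ↦ a y * b y) K := (ha.mul hb).integrableOn_compact hKc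
    rw [← integrableOn_univ]
    refine h1.of_forall_sdiff_eq_zero MeasurableSet.univ fun y hy ↦ ?_
    rw [ha0 y hy.2, zero_mul]
  have cr : ContinuousOn r K := fun y _ ↦ (hrs y).continuousAt.continuousWithinAt
  have cdr : ContinuousOn (dd v r) K := fun y _ ↦
    (contDiffAt_dd (hrs y) v).continuousAt.continuousWithinAt
  have cf : ContinuousOn f K := fun y hy ↦ (hf y (hKT hy)).continuousAt.continuousWithinAt
  have cdf : ContinuousOn (dd v f) K := fun y hy ↦
    (contDiffAt_dd (hf y (hKT hy)) v).continuousAt.continuousWithinAt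
  have hrK : ∀ y ∉ K, r y = 0 := fun y hy ↦ (hr0 y hy).self_of_nhds
  have key := integral_mul_fderiv_eq_neg_fderiv_mul_of_integrable
    (μ := (volume : Measure (Model m)))
    (f := r) (g := f) (v := v) (hint (dd v r) f hdr0 cdr cf) (hint r (dd v f) hrK cr cdf)
    (hint r f hrK cr cf) (fun y _ ↦ (hrs y).differentiableAt (by simp))
    (fun y hy ↦ (hf y (hKT (hsupp hy))).differentiableAt (by simp))
  have e1 : ∫ y in T, ρ ((extChartAt (𝓡 m) x₀).symm y) * dd v f y = ∫ y, r y * dd v f y := by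
    rw [← setIntegral_eq_integral_of_forall_compl_eq_zero (s := T) (f := fun y ↦ r y * dd v f y)
      fun y hy ↦ by rw [hrK y fun h ↦ hy (hKT h), zero_mul]]
    refine setIntegral_congr_fun hTo.measurableSet fun y hy ↦ ?_
    rw [(hrT y hy).self_of_nhds]
  have e2 : ∫ y in T, dd v (fun z ↦ ρ ((extChartAt (𝓡 m) x₀).symm z)) y * f y
      = ∫ y, dd v r y * f y := by
    rw [← setIntegral_eq_integral_of_forall_compl_eq_zero (s := T) (f := fun y ↦ dd v r y * f y)
      fun y hy ↦ by rw [hdr0 y fun h ↦ hy (hKT h), zero_mul]]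
    refine setIntegral_congr_fun hTo.measurableSet fun y hy ↦ ?_
    rw [dd_congr (hrT y hy)]
  rw [e1, e2]
  exact key

end Charts

/-! ### First variation of the volume, the total scalar curvature and the normalized functional. -/

section FirstVariation

variable {m : ℕ} {M : Type*} [TopologicalSpace M] [ChartedSpace (Model m) M]
  [IsManifold (𝓡 m) ∞ M]

/-- The trace `⟨g, h⟩` of the velocity `h` of a curve of metrics through `g`. -/
def velocityTrace (γ : ℝ → Met m M) (p : M) : ℝ :=
  ((gram (γ 0) p (extChartAt (𝓡 m) p p))⁻¹ * velocityMat γ p (extChartAt (𝓡 m) p p)).trace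

/-- The pairing `⟨Ric, h⟩` with the velocity `h` of a curve of metrics. -/
def velocityRic (γ : ℝ → Met m M) (p : M) : ℝ :=
  ((gram (γ 0) p (extChartAt (𝓡 m) p p))⁻¹ * velocityMat γ p (extChartAt (𝓡 m) p p)
    * (gram (γ 0) p (extChartAt (𝓡 m) p p))⁻¹ * ricciMat (γ 0) p (extChartAt (𝓡 m) p p)).trace

variable {γ : ℝ → Met m M} {x₀ p : M}

theorem IsSmoothCurve.velocityTrace_eq (hγ : IsSmoothCurve γ)
    (hp : p ∈ (chartAt (Model m) x₀).source) :
    velocityTrace γ p = ((gram (γ 0) x₀ (extChartAt (𝓡 m) x₀ p))⁻¹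
      * velocityMat γ x₀ (extChartAt (𝓡 m) x₀ p)).trace := by
  have h := mem_chart_source (Model m) p
  have hy := mem_overlap h hp
  rw [velocityTrace, hγ.velocityMat_change hy,
    trace_inv_mul_congr (gram_det_pos (γ 0) hy.1).ne' (gram_change (γ 0) hy),
    transition_extChartAt h]

theorem IsSmoothCurve.velocityRic_eq (hγ : IsSmoothCurve γ)
    (hp : p ∈ (chartAt (Model m) x₀).source) :
    velocityRic γ p = ((gram (γ 0) x₀ (extChartAt (𝓡 m) x₀ p))⁻¹
      * velocityMat γ x₀ (extChartAt (𝓡 m) x₀ p) * (gram (γ 0) x₀ (extChartAt (𝓡 m) x₀ p))⁻¹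
      * ricciMat (γ 0) x₀ (extChartAt (𝓡 m) x₀ p)).trace := by
  have h := mem_chart_source (Model m) p
  have hy := mem_overlap h hp
  rw [velocityRic, hγ.velocityMat_change hy, ricciMat, (coordChange_gram (γ 0) p x₀).ric_law hy,
    trace_inv_mul_inv_mul_congr (gram_det_pos (γ 0) hy.1).ne' (gram_change (γ 0) hy),
    transition_extChartAt h]

theorem SmoothMatAt.mul {E : Type*} [NormedAddCommGroup E] [NormedSpace ℝ E]
    {A B : E → Matrix (Fin m) (Fin m) ℝ} {x : E} (hA : SmoothMatAt A x) (hB : SmoothMatAt B x) :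
    SmoothMatAt (fun z ↦ A z * B z) x := fun i j ↦ by
  simp only [Matrix.mul_apply]
  exact ContDiffAt.sum fun k _ ↦ (hA i k).mul (hB k j)

theorem SmoothMatAt.trace {E : Type*} [NormedAddCommGroup E] [NormedSpace ℝ E]
    {A : E → Matrix (Fin m) (Fin m) ℝ} {x : E} (hA : SmoothMatAt A x) :
    ContDiffAt ℝ ∞ (fun z ↦ (A z).trace) x :=
  ContDiffAt.sum fun i _ ↦ hA i i

theorem smoothMatAt_gram_inv (g : Met m M) {y : Model m}
    (hy : y ∈ (extChartAt (𝓡 m) x₀).target) : SmoothMatAt (fun z ↦ (gram g x₀ z)⁻¹) y :=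
  (smoothMatAt_gram g hy).inv (gram_det_pos g hy).ne'

theorem smoothMatAt_ricciMat (g : Met m M) {y : Model m}
    (hy : y ∈ (extChartAt (𝓡 m) x₀).target) : SmoothMatAt (ricciMat g x₀) y := fun i j ↦
  contDiffAt_ric (smoothMatAt_gram g hy) (gram_det_pos g hy).ne' i j

theorem continuous_scalar (g : Met m M) : Continuous (scalar g) :=
  continuous_of_charts (f := fun x₀ ↦ scal stdVec (gram g x₀)) (fun _ _ hp ↦ scalar_eq_scal g hp)
    fun _ _ hy ↦ (contDiffAt_scal (smoothMatAt_gram g hy) (gram_det_pos g hy).ne').continuousAt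

theorem IsSmoothCurve.continuous_velocityTrace (hγ : IsSmoothCurve γ) :
    Continuous (velocityTrace γ) :=
  continuous_of_charts
    (f := fun x₀ y ↦ ((gram (γ 0) x₀ y)⁻¹ * velocityMat γ x₀ y).trace)
    (fun _ _ hp ↦ hγ.velocityTrace_eq hp)
    fun _ _ hy ↦ ((smoothMatAt_gram_inv (γ 0) hy).mul (hγ.smooth_velocityMat hy)).trace.continuousAt

theorem IsSmoothCurve.continuous_velocityRic (hγ : IsSmoothCurve γ) :
    Continuous (velocityRic γ) :=
  continuous_of_charts
    (f := fun x₀ y ↦ ((gram (γ 0) x₀ y)⁻¹ * velocityMat γ x₀ y * (gram (γ 0) x₀ y)⁻¹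
      * ricciMat (γ 0) x₀ y).trace)
    (fun _ _ hp ↦ hγ.velocityRic_eq hp)
    fun _ _ hy ↦ ((((smoothMatAt_gram_inv (γ 0) hy).mul (hγ.smooth_velocityMat hy)).mul
      (smoothMatAt_gram_inv (γ 0) hy)).mul (smoothMatAt_ricciMat (γ 0) hy)).trace.continuousAt

/-- The derivative of a function along the vector field `W`. -/
def fieldDeriv (γ : ℝ → Met m M) (ρ : M → ℝ) (x₀ : M) (y : Model m) : ℝ :=
  ∑ i, dd (stdVec i) (fun z ↦ ρ ((extChartAt (𝓡 m) x₀).symm z)) y * velocityField γ x₀ i y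

/-- The differential of `ρ` changes by the chain rule, with the same Jacobian that transforms W
contravariantly, so the pairing dρ(W) does not depend on the chart. It can then be integrated as a
function on `M`. -/
theorem IsSmoothCurve.fieldDeriv_change (hγ : IsSmoothCurve γ) {ρ : M → ℝ}
    (hρ : ContMDiff (𝓡 m) 𝓘(ℝ, ℝ) ∞ ρ) {x₁ : M} {y : Model m} (hy : y ∈ overlap x₀ x₁) :
    fieldDeriv γ ρ x₀ y = fieldDeriv γ ρ x₁ (transition x₀ x₁ y) := by
  have h1 : ∀ i, dd (stdVec i) (fun z ↦ ρ ((extChartAt (𝓡 m) x₀).symm z)) y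
      = ∑ c, jac (transition x₀ x₁) y c i
        * dd (stdVec c) (fun z ↦ ρ ((extChartAt (𝓡 m) x₁).symm z)) (transition x₀ x₁ y) := by
    intro i
    have e : (fun z ↦ ρ ((extChartAt (𝓡 m) x₀).symm z)) =ᶠ[𝓝 y]
        (fun z ↦ ρ ((extChartAt (𝓡 m) x₁).symm z)) ∘ transition x₀ x₁ := by
      filter_upwards [(isOpen_overlap x₀ x₁).mem_nhds hy] with z hz
      rw [Function.comp_apply, symm_transition hz]
    have hc := (hasFDerivAt_of_smooth
      (contDiffAt_comp_symm hρ (transition_mem_target hy))).comp y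
      (hasFDerivAt_of_smooth (contDiffAt_transition hy))
    rw [dd_congr e, dd, hc.fderiv, ContinuousLinearMap.comp_apply]
    exact dd_eq_sum (f := fun z ↦ ρ ((extChartAt (𝓡 m) x₁).symm z)) _ _
  rw [fieldDeriv, fieldDeriv]
  simp only [h1, ← hγ.velocityField_change hy, Finset.sum_mul, Finset.mul_sum]
  rw [Finset.sum_comm]
  exact Finset.sum_congr rfl fun c _ ↦ Finset.sum_congr rfl fun i _ ↦ by ring

theorem IsSmoothCurve.fieldDeriv_self_eq (hγ : IsSmoothCurve γ) {ρ : M → ℝ}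
    (hρ : ContMDiff (𝓡 m) 𝓘(ℝ, ℝ) ∞ ρ) (hp : p ∈ (chartAt (Model m) x₀).source) :
    fieldDeriv γ ρ p (extChartAt (𝓡 m) p p) = fieldDeriv γ ρ x₀ (extChartAt (𝓡 m) x₀ p) := by
  have h := mem_chart_source (Model m) p
  rw [hγ.fieldDeriv_change hρ (mem_overlap h hp), transition_extChartAt h]

theorem IsSmoothCurve.continuous_fieldDeriv (hγ : IsSmoothCurve γ) {ρ : M → ℝ}
    (hρ : ContMDiff (𝓡 m) 𝓘(ℝ, ℝ) ∞ ρ) :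
    Continuous (fun p ↦ fieldDeriv γ ρ p (extChartAt (𝓡 m) p p)) :=
  continuous_of_charts (f := fun x₀ ↦ fieldDeriv γ ρ x₀)
    (fun _ _ hp ↦ hγ.fieldDeriv_self_eq hρ hp)
    fun _ _ hy ↦ (ContDiffAt.sum fun i _ ↦ (contDiffAt_dd (contDiffAt_comp_symm hρ hy) _).mul
      (hγ.smooth_velocityField hy i)).continuousAt

variable [T2Space M] [CompactSpace M] [MeasurableSpace M] [BorelSpace M]

/-- The integral of a continuous function in terms of a partition of unity. -/
theorem integral_eq_sum_charts (g : Met m M) {S : Finset M} {ρ : M → M → ℝ}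
    (hρ : ∀ a, ContMDiff (𝓡 m) 𝓘(ℝ, ℝ) ∞ (ρ a))
    (hs : ∀ a, tsupport (ρ a) ⊆ (chartAt (Model m) a).source) (h1 : ∀ p, ∑ a ∈ S, ρ a p = 1)
    {F : M → ℝ} (hF : Continuous F) :
    ∫ p, F p ∂(riemVolume g) = ∑ a ∈ S, ∫ y in (extChartAt (𝓡 m) a).target,
      ρ a ((extChartAt (𝓡 m) a).symm y) * (F ((extChartAt (𝓡 m) a).symm y) * density g a y) := by
  have e : ∀ p, F p = ∑ a ∈ S, ρ a p * F p := fun p ↦ by rw [← Finset.sum_mul, h1, one_mul]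
  have hc : ∀ a, Continuous fun p ↦ ρ a p * F p := fun a ↦ (hρ a).continuous.mul hF
  rw [integral_congr_ae (Filter.Eventually.of_forall e),
    integral_finsetSum _ fun a _ ↦ integrable_of_continuous g (hc a)]
  refine Finset.sum_congr rfl fun a _ ↦ ?_
  rw [integral_riemVolume g a (hc a) fun p hp ↦ by
    rw [image_eq_zero_of_notMem_tsupport fun h ↦ hp (hs a h), zero_mul]]
  simp only [mul_assoc]

/-- Differentiation of an integral with respect to a curve of metrics. -/
theorem IsSmoothCurve.hasDerivAt_integral (hγ : IsSmoothCurve γ) {S : Finset M} {ρ : M → M → ℝ}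
    (hρ : ∀ a, ContMDiff (𝓡 m) 𝓘(ℝ, ℝ) ∞ (ρ a))
    (hs : ∀ a, tsupport (ρ a) ⊆ (chartAt (Model m) a).source) (h1 : ∀ p, ∑ a ∈ S, ρ a p = 1)
    {F : ℝ → M → ℝ} (hF : ∀ t, Continuous (F t)) {Φ : M → ℝ × Model m → ℝ}
    (hΦ : ∀ a t, ∀ y ∈ (extChartAt (𝓡 m) a).target, ContDiffAt ℝ ∞ (Φ a) (t, y))
    (hFΦ : ∀ a t, ∀ y ∈ (extChartAt (𝓡 m) a).target,
      F t ((extChartAt (𝓡 m) a).symm y) = Φ a (t, y)) :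
    HasDerivAt (fun t ↦ ∫ p, F t p ∂(riemVolume (γ t)))
      (∑ a ∈ S, ∫ y in (extChartAt (𝓡 m) a).target, ρ a ((extChartAt (𝓡 m) a).symm y)
        * dd (timeVec m) (fun q ↦ Φ a q * √(curveGram γ a q).det) (0, y)) 0 := by
  have e : (fun t ↦ ∫ p, F t p ∂(riemVolume (γ t))) = fun t ↦ ∑ a ∈ S,
      ∫ y in (extChartAt (𝓡 m) a).target, ρ a ((extChartAt (𝓡 m) a).symm y)
        * (fun q ↦ Φ a q * √(curveGram γ a q).det) (t, y) := by
    funext t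
    rw [integral_eq_sum_charts (γ t) hρ hs h1 (hF t)]
    refine Finset.sum_congr rfl fun a _ ↦ ?_
    refine setIntegral_congr_fun (isOpen_target a).measurableSet fun y hy ↦ ?_
    simp only [hFΦ a t y hy]
    rfl
  rw [e]
  refine HasDerivAt.fun_sum fun a _ ↦ ?_
  refine hasDerivAt_integral_of_compact (r := fun y ↦ ρ a ((extChartAt (𝓡 m) a).symm y))
    (Φ := fun q ↦ Φ a q * √(curveGram γ a q).det) volume (isOpen_target a).measurableSet
    (isCompact_chartSupport (hs a)) (chartSupport_subset (hs a)) ?_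
    (fun y hy hyK ↦ eq_zero_of_notMem_chartSupport hy hyK) fun t y hy ↦ ?_
  · exact fun y hy ↦ (contDiffAt_comp_symm (hρ a)
      (chartSupport_subset (hs a) hy)).continuousAt.continuousWithinAt
  · have hyT := chartSupport_subset (hs a) hy
    exact (hΦ a t y hyT).mul (contDiffAt_sqrt_det (hγ.smoothMatAt t hyT)
      (curveGram_det_pos γ t hyT))

/-- First variation of the volume. -/
theorem IsSmoothCurve.hasDerivAt_volume (hγ : IsSmoothCurve γ) :
    HasDerivAt (fun t ↦ (riemVolume (γ t)).real Set.univ)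
      (∫ p, 1 / 2 * velocityTrace γ p ∂(riemVolume (γ 0))) 0 := by
  obtain ⟨S, ρ, hρ, hs, h1⟩ := exists_finite_partition m M
  have h := hγ.hasDerivAt_integral hρ hs h1 (F := fun _ _ ↦ 1) (fun _ ↦ continuous_const)
    (Φ := fun _ _ ↦ 1) (fun _ _ _ _ ↦ contDiffAt_const) fun _ _ _ _ ↦ rfl
  simp only [integral_const, smul_eq_mul, mul_one, one_mul] at h
  convert h using 1
  rw [integral_eq_sum_charts (γ 0) hρ hs h1 (hγ.continuous_velocityTrace.const_mul (1 / 2))]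
  refine Finset.sum_congr rfl fun a _ ↦ ?_
  refine setIntegral_congr_fun (isOpen_target a).measurableSet fun y hy ↦ ?_
  rw [hγ.dd_density hy, hγ.velocityTrace_eq (extChartAt_symm_mem_source hy),
    (extChartAt (𝓡 m) a).right_inv hy]
  ring

/-- The divergence of the vector field `W` integrates to zero. -/
theorem IsSmoothCurve.sum_integral_divergence (hγ : IsSmoothCurve γ) {S : Finset M}
    {ρ : M → M → ℝ} (hρ : ∀ a, ContMDiff (𝓡 m) 𝓘(ℝ, ℝ) ∞ (ρ a))
    (hs : ∀ a, tsupport (ρ a) ⊆ (chartAt (Model m) a).source) (h1 : ∀ p, ∑ a ∈ S, ρ a p = 1) :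
    ∑ a ∈ S, ∫ y in (extChartAt (𝓡 m) a).target, ρ a ((extChartAt (𝓡 m) a).symm y)
      * ∑ i, dd (stdVec i) (fun z ↦ density (γ 0) a z * velocityField γ a i z) y = 0 := by
  have hsm : ∀ a i, ∀ y ∈ (extChartAt (𝓡 m) a).target,
      ContDiffAt ℝ ∞ (fun z ↦ density (γ 0) a z * velocityField γ a i z) y := fun a i y hy ↦
    (contDiffAt_density (γ 0) hy).mul (hγ.smooth_velocityField hy i)
  have hint : ∀ a, ∀ f : Model m → ℝ, ContinuousOn f (extChartAt (𝓡 m) a).target →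
      (∀ y ∈ (extChartAt (𝓡 m) a).target, y ∉ chartSupport a (ρ a) → f y = 0) →
      IntegrableOn f (extChartAt (𝓡 m) a).target := by
    intro a f hf hf0
    have h : IntegrableOn f (chartSupport a (ρ a)) :=
      (hf.mono (chartSupport_subset (hs a))).integrableOn_compact (isCompact_chartSupport (hs a))
    exact h.of_forall_sdiff_eq_zero (isOpen_target a).measurableSet fun y hy ↦ hf0 y hy.1 hy.2
  have hdz : ∀ a, ∀ y ∈ (extChartAt (𝓡 m) a).target, y ∉ chartSupport a (ρ a) → ∀ i,
      dd (stdVec i) (fun z ↦ ρ a ((extChartAt (𝓡 m) a).symm z)) y = 0 := by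
    intro a y hy hyK i
    rw [dd_congr (g := fun _ ↦ 0), dd_const]
    filter_upwards [(isOpen_target a).mem_nhds hy,
      (isCompact_chartSupport (hs a)).isClosed.isOpen_compl.mem_nhds hyK] with z hz hzK
    exact eq_zero_of_notMem_chartSupport hz hzK
  -- Integration by parts moves the derivative to the cut-off; the result -∫ dρ_a(W) dμ no longer
  -- refers to a chart.
  have e1 : ∀ a, ∫ y in (extChartAt (𝓡 m) a).target, ρ a ((extChartAt (𝓡 m) a).symm y)
      * ∑ i, dd (stdVec i) (fun z ↦ density (γ 0) a z * velocityField γ a i z) y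
      = -∫ p, fieldDeriv γ (ρ a) p (extChartAt (𝓡 m) p p) ∂(riemVolume (γ 0)) := by
    intro a
    have hz : ∀ p ∉ (chartAt (Model m) a).source,
        fieldDeriv γ (ρ a) p (extChartAt (𝓡 m) p p) = 0 := by
      intro p hp
      refine Finset.sum_eq_zero fun i _ ↦ ?_
      rw [dd_congr (g := fun _ ↦ 0), dd_const, zero_mul]
      have hp' : p ∈ (tsupport (ρ a))ᶜ := fun h ↦ hp (hs a h)
      have hcont : ContinuousAt (extChartAt (𝓡 m) p).symm (extChartAt (𝓡 m) p p) :=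
        continuousAt_extChartAt_symm p
      have hnb : (tsupport (ρ a))ᶜ ∈ 𝓝 ((extChartAt (𝓡 m) p).symm (extChartAt (𝓡 m) p p)) := by
        rw [extChartAt_to_inv]
        exact (isClosed_tsupport _).isOpen_compl.mem_nhds hp'
      filter_upwards [hcont.preimage_mem_nhds hnb] with z hz
      exact image_eq_zero_of_notMem_tsupport hz
    rw [integral_riemVolume (γ 0) a (hγ.continuous_fieldDeriv (hρ a)) hz]
    have hl : ∀ i, IntegrableOn (fun y ↦ ρ a ((extChartAt (𝓡 m) a).symm y)
        * dd (stdVec i) (fun z ↦ density (γ 0) a z * velocityField γ a i z) y)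
        (extChartAt (𝓡 m) a).target := by
      intro i
      refine hint a _ (fun y hy ↦ ((contDiffAt_comp_symm (hρ a) hy).mul
        (contDiffAt_dd (hsm a i y hy) _)).continuousAt.continuousWithinAt) fun y hy hyK ↦ ?_
      rw [eq_zero_of_notMem_chartSupport hy hyK, zero_mul]
    have hr : ∀ i, IntegrableOn (fun y ↦ dd (stdVec i)
        (fun z ↦ ρ a ((extChartAt (𝓡 m) a).symm z)) y
        * (density (γ 0) a y * velocityField γ a i y)) (extChartAt (𝓡 m) a).target := by
      intro i
      refine hint a _ (fun y hy ↦ ((contDiffAt_dd (contDiffAt_comp_symm (hρ a) hy) _).mul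
        (hsm a i y hy)).continuousAt.continuousWithinAt) fun y hy hyK ↦ ?_
      rw [hdz a y hy hyK, zero_mul]
    simp only [Finset.mul_sum]
    rw [integral_finsetSum _ fun i _ ↦ hl i]
    have e2 : ∫ y in (extChartAt (𝓡 m) a).target,
        fieldDeriv γ (ρ a) ((extChartAt (𝓡 m) a).symm y) (extChartAt (𝓡 m)
          ((extChartAt (𝓡 m) a).symm y) ((extChartAt (𝓡 m) a).symm y)) * density (γ 0) a y
        = ∫ y in (extChartAt (𝓡 m) a).target, ∑ i, dd (stdVec i)
          (fun z ↦ ρ a ((extChartAt (𝓡 m) a).symm z)) y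
          * (density (γ 0) a y * velocityField γ a i y) := by
      refine setIntegral_congr_fun (isOpen_target a).measurableSet fun y hy ↦ ?_
      rw [hγ.fieldDeriv_self_eq (hρ a) (extChartAt_symm_mem_source hy),
        (extChartAt (𝓡 m) a).right_inv hy, fieldDeriv, Finset.sum_mul]
      exact Finset.sum_congr rfl fun i _ ↦ by ring
    rw [e2, integral_finsetSum _ fun i _ ↦ hr i, ← Finset.sum_neg_distrib]
    exact Finset.sum_congr rfl fun i _ ↦ integral_chart_by_parts (hρ a) (hs a) (hsm a i) _
  rw [Finset.sum_congr rfl fun a _ ↦ e1 a, Finset.sum_neg_distrib, neg_eq_zero,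
    ← integral_finsetSum _ fun a _ ↦
      integrable_of_continuous (γ 0) (hγ.continuous_fieldDeriv (hρ a))]
  -- Summed over `a`, the integrand is the derivative along W of ∑ ρ_a, which is the constant 1.
  refine integral_eq_zero_of_ae (Filter.Eventually.of_forall fun p ↦ ?_)
  simp only [fieldDeriv, Pi.zero_apply]
  rw [Finset.sum_comm]
  refine Finset.sum_eq_zero fun i _ ↦ ?_
  rw [← Finset.sum_mul, ← dd_sum fun a ↦ contDiffAt_comp_symm (hρ a) (mem_extChartAt_target p)]
  simp only [h1, dd_const, zero_mul]

/-- First variation of the total scalar curvature. -/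
theorem IsSmoothCurve.hasDerivAt_totalScalar (hγ : IsSmoothCurve γ) :
    HasDerivAt (fun t ↦ ∫ p, scalar (γ t) p ∂(riemVolume (γ t)))
      (∫ p, (1 / 2 * velocityTrace γ p * scalar (γ 0) p - velocityRic γ p)
        ∂(riemVolume (γ 0))) 0 := by
  obtain ⟨S, ρ, hρ, hs, h1⟩ := exists_finite_partition m M
  have h := hγ.hasDerivAt_integral hρ hs h1 (F := fun t ↦ scalar (γ t))
    (fun t ↦ continuous_scalar (γ t)) (Φ := fun a ↦ scal spaceVec (curveGram γ a))
    (fun a t y hy ↦ contDiffAt_scal (hγ.smoothMatAt t hy) (curveGram_det_pos γ t hy).ne')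
    fun a t y hy ↦ by
      rw [hγ.scal_slice t hy, scalar_eq_scal (γ t) (extChartAt_symm_mem_source hy),
        (extChartAt (𝓡 m) a).right_inv hy]
  convert h using 1
  have hcont : Continuous fun p ↦
      1 / 2 * velocityTrace γ p * scalar (γ 0) p - velocityRic γ p :=
    ((hγ.continuous_velocityTrace.const_mul _).mul (continuous_scalar _)).sub
      hγ.continuous_velocityRic
  rw [integral_eq_sum_charts (γ 0) hρ hs h1 hcont]
  -- The zero total divergence is added to the claimed integral, so that the two sides agree chart
  -- by chart with `IsSmoothCurve.dd_scal_density`.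
  refine (add_zero _).symm.trans
    ((congrArg (_ + ·) (hγ.sum_integral_divergence hρ hs h1).symm).trans ?_)
  rw [← Finset.sum_add_distrib]
  refine Finset.sum_congr rfl fun a _ ↦ ?_
  have hint : ∀ f : Model m → ℝ, (∀ y ∈ (extChartAt (𝓡 m) a).target, ContinuousAt f y) →
      IntegrableOn (fun y ↦ ρ a ((extChartAt (𝓡 m) a).symm y) * f y)
        (extChartAt (𝓡 m) a).target := by
    intro f hf
    have hK : ContinuousOn (fun y ↦ ρ a ((extChartAt (𝓡 m) a).symm y) * f y)
        (chartSupport a (ρ a)) := fun y hy ↦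
      ((contDiffAt_comp_symm (hρ a) (chartSupport_subset (hs a) hy)).continuousAt.mul
        (hf y (chartSupport_subset (hs a) hy))).continuousWithinAt
    refine (hK.integrableOn_compact (isCompact_chartSupport (hs a))).of_forall_sdiff_eq_zero
      (isOpen_target a).measurableSet fun y hy ↦ ?_
    rw [eq_zero_of_notMem_chartSupport hy.1 hy.2, zero_mul]
  have e : ∫ y in (extChartAt (𝓡 m) a).target, ρ a ((extChartAt (𝓡 m) a).symm y)
        * dd (timeVec m) (fun q ↦ scal spaceVec (curveGram γ a) q * √(curveGram γ a q).det) (0, y)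
      = ∫ y in (extChartAt (𝓡 m) a).target, (ρ a ((extChartAt (𝓡 m) a).symm y)
          * ((1 / 2 * velocityTrace γ ((extChartAt (𝓡 m) a).symm y)
            * scalar (γ 0) ((extChartAt (𝓡 m) a).symm y)
            - velocityRic γ ((extChartAt (𝓡 m) a).symm y)) * density (γ 0) a y)
        + ρ a ((extChartAt (𝓡 m) a).symm y)
          * ∑ i, dd (stdVec i) (fun z ↦ density (γ 0) a z * velocityField γ a i z) y) := by
    refine setIntegral_congr_fun (isOpen_target a).measurableSet fun y hy ↦ ?_
    have hp := extChartAt_symm_mem_source hy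
    rw [hγ.dd_scal_density hy, hγ.velocityTrace_eq hp, hγ.velocityRic_eq hp,
      scalar_eq_scal (γ 0) hp, (extChartAt (𝓡 m) a).right_inv hy]
    ring
  exact ((e.trans (integral_add (hint (fun y ↦ (1 / 2 * velocityTrace γ
      ((extChartAt (𝓡 m) a).symm y) * scalar (γ 0) ((extChartAt (𝓡 m) a).symm y)
        - velocityRic γ ((extChartAt (𝓡 m) a).symm y)) * density (γ 0) a y) fun y hy ↦
      (hcont.continuousAt.comp (contMDiffAt_symm hy).continuousAt).mul
        (contDiffAt_density (γ 0) hy).continuousAt)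
    (hint (fun y ↦ ∑ i, dd (stdVec i) (fun z ↦ density (γ 0) a z * velocityField γ a i z) y)
      fun y hy ↦ (ContDiffAt.sum fun i _ ↦ contDiffAt_dd
        ((contDiffAt_density (γ 0) hy).mul (hγ.smooth_velocityField hy i)) _).continuousAt)))).symm

/-- First variation of the normalized Einstein-Hilbert functional. -/
theorem IsSmoothCurve.hasDerivAt_einsteinHilbert [Nonempty M] (hγ : IsSmoothCurve γ)
    (hm : 3 ≤ m) :
    HasDerivAt (fun t ↦ einsteinHilbert (γ t))
      ((∫ p, ((scalar (γ 0) p / 2 - ((m : ℝ) - 2) / (2 * m)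
          * ((∫ x, scalar (γ 0) x ∂(riemVolume (γ 0))) / (riemVolume (γ 0)).real Set.univ))
          * velocityTrace γ p - velocityRic γ p) ∂(riemVolume (γ 0)))
        / (riemVolume (γ 0)).real Set.univ ^ (2 / (2 * (m : ℝ) / ((m : ℝ) - 2)))) 0 := by
  set V := (riemVolume (γ 0)).real Set.univ with hV
  set A := ∫ x, scalar (γ 0) x ∂(riemVolume (γ 0)) with hA
  set q : ℝ := 2 / (2 * (m : ℝ) / ((m : ℝ) - 2)) with hq
  have hVpos : 0 < V := riemVolume_univ_pos (γ 0)
  have hVq : 0 < V ^ q := Real.rpow_pos_of_pos hVpos q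
  have hm' : (3 : ℝ) ≤ m := by exact_mod_cast hm
  -- The exponent `q` equals (m - 2) / m; half of it appears because the volume varies by half the
  -- trace.
  have hq' : ((m : ℝ) - 2) / (2 * m) = q / 2 := by
    rw [hq]
    have : (m : ℝ) - 2 ≠ 0 := by linarith
    have : (m : ℝ) ≠ 0 := by linarith
    field_simp
  have h := hγ.hasDerivAt_totalScalar.div (hγ.hasDerivAt_volume.rpow_const (p := q)
    (Or.inl hVpos.ne')) hVq.ne'
  have hi1 : Integrable (fun p ↦ 1 / 2 * velocityTrace γ p * scalar (γ 0) p - velocityRic γ p)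
      (riemVolume (γ 0)) := integrable_of_continuous _
    (((hγ.continuous_velocityTrace.const_mul _).mul (continuous_scalar _)).sub
      hγ.continuous_velocityRic)
  have hi2 : Integrable (fun p ↦ 1 / 2 * velocityTrace γ p) (riemVolume (γ 0)) :=
    integrable_of_continuous _ (hγ.continuous_velocityTrace.const_mul _)
  have e : ∫ p, ((scalar (γ 0) p / 2 - ((m : ℝ) - 2) / (2 * m) * (A / V)) * velocityTrace γ p
      - velocityRic γ p) ∂(riemVolume (γ 0))
      = (∫ p, (1 / 2 * velocityTrace γ p * scalar (γ 0) p - velocityRic γ p) ∂(riemVolume (γ 0)))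
        - q * (A / V) * ∫ p, 1 / 2 * velocityTrace γ p ∂(riemVolume (γ 0)) := by
    rw [← integral_const_mul, ← integral_sub hi1 (hi2.const_mul _)]
    refine integral_congr_ae (Filter.Eventually.of_forall fun p ↦ ?_)
    simp only [hq']
    ring
  rw [e]
  refine HasDerivAt.congr_deriv (f := fun t ↦ einsteinHilbert (γ t)) h ?_
  rw [← hV, ← hA, Real.rpow_sub_one hVpos.ne']
  field_simp

end FirstVariation

/-! ### Smoothness of fields of bilinear forms, tested on components. -/

section SmoothForms

variable {m : ℕ} {M : Type*} [TopologicalSpace M] [ChartedSpace (Model m) M]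
  [IsManifold (𝓡 m) ∞ M]
  {EN : Type*} [NormedAddCommGroup EN] [NormedSpace ℝ EN] {HN : Type*} [TopologicalSpace HN]
  {IN : ModelWithCorners ℝ EN HN} {N : Type*} [TopologicalSpace N] [ChartedSpace HN N]

/-- A family of bilinear maps on `Model m` is smooth if its components are. -/
theorem contMDiffAt_bilin_of_components {L : N → Model m →L[ℝ] Model m →L[ℝ] ℝ} {q₀ : N}
    (h : ∀ i j, ContMDiffAt IN 𝓘(ℝ, ℝ) ∞ (fun q ↦ L q (stdVec i) (stdVec j)) q₀) :
    ContMDiffAt IN 𝓘(ℝ, Model m →L[ℝ] Model m →L[ℝ] ℝ) ∞ L q₀ := by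
  have e : L = fun q ↦ ∑ i, ∑ j, L q (stdVec i) (stdVec j) •
      (EuclideanSpace.proj i : Model m →L[ℝ] ℝ).smulRight
        (EuclideanSpace.proj j : Model m →L[ℝ] ℝ) := by
    funext q
    ext v w
    conv_lhs => rw [← sum_smul_stdVec v, ← sum_smul_stdVec w]
    simp only [map_sum, map_smul, _root_.sum_apply, _root_.smul_apply, smul_eq_mul, Finset.mul_sum,
      ContinuousLinearMap.smulRight_apply, EuclideanSpace.proj, PiLp.proj_apply]
    rw [Finset.sum_comm]
    exact Finset.sum_congr rfl fun i _ ↦ Finset.sum_congr rfl fun j _ ↦ by ring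
  rw [e]
  exact ContMDiffAt.sum fun i _ ↦ ContMDiffAt.sum fun j _ ↦ (h i j).smul contMDiffAt_const

/-- A family of bilinear forms on tangent spaces is smooth if its components are. -/
theorem contMDiffAt_of_components {b : N → M}
    {B : (q : N) → TangentSpace (𝓡 m) (b q) →L[ℝ] TangentSpace (𝓡 m) (b q) →L[ℝ] ℝ} {q₀ : N}
    (hb : ContMDiffAt IN (𝓡 m) ∞ b q₀)
    (h : ∀ i j, ContMDiffAt IN 𝓘(ℝ, ℝ) ∞
      (fun q ↦ B q (coordVec (b q₀) (b q) i) (coordVec (b q₀) (b q) j)) q₀) :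
    ContMDiffAt IN ((𝓡 m).prod 𝓘(ℝ, Model m →L[ℝ] Model m →L[ℝ] ℝ)) ∞
      (fun q ↦ TotalSpace.mk' (Model m →L[ℝ] Model m →L[ℝ] ℝ)
        (E := fun x : M ↦ TangentSpace (𝓡 m) x →L[ℝ] TangentSpace (𝓡 m) x →L[ℝ] ℝ)
        (b q) (B q)) q₀ := by
  refine (contMDiffAt_hom_bundle (F₁ := Model m) (E₁ := fun x : M ↦ TangentSpace (𝓡 m) x)
    (F₂ := Model m →L[ℝ] ℝ) (E₂ := fun x : M ↦ TangentSpace (𝓡 m) x →L[ℝ] ℝ)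
    (fun q ↦ TotalSpace.mk' (Model m →L[ℝ] Model m →L[ℝ] ℝ)
      (E := fun x : M ↦ TangentSpace (𝓡 m) x →L[ℝ] TangentSpace (𝓡 m) x →L[ℝ] ℝ)
        (b q) (B q))).2 ⟨hb, contMDiffAt_bilin_of_components fun i j ↦
          (h i j).congr_of_eventuallyEq ?_⟩
  have hq : ∀ᶠ q in 𝓝 q₀, b q ∈ (chartAt (Model m) (b q₀)).source :=
    hb.continuousAt.eventually
      ((chartAt (Model m) (b q₀)).open_source.mem_nhds (mem_chart_source _ _))
  filter_upwards [hq] with q hq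
  have hq' : b q ∈ (trivializationAt (Model m) (TangentSpace (𝓡 m) : M → Type _)
    (b q₀)).baseSet := hq
  refine (inCoordinates_apply_eq₂ (F₃ := ℝ) (E₃ := Bundle.Trivial M ℝ) hq' hq'
    (Set.mem_univ _)).trans ?_
  rw [coordVec, coordVec, Trivialization.symmL_apply _ hq', Trivialization.symmL_apply _ hq']
  simp

/-- The value of a smooth bilinear form on smooth vector fields is smooth. -/
theorem contMDiffAt_form_apply {b : N → M}
    {B : (q : N) → TangentSpace (𝓡 m) (b q) →L[ℝ] TangentSpace (𝓡 m) (b q) →L[ℝ] ℝ}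
    {v w : (q : N) → TangentSpace (𝓡 m) (b q)} {q₀ : N}
    (hB : ContMDiffAt IN ((𝓡 m).prod 𝓘(ℝ, Model m →L[ℝ] Model m →L[ℝ] ℝ)) ∞
      (fun q ↦ TotalSpace.mk' (Model m →L[ℝ] Model m →L[ℝ] ℝ)
        (E := fun x : M ↦ TangentSpace (𝓡 m) x →L[ℝ] TangentSpace (𝓡 m) x →L[ℝ] ℝ)
        (b q) (B q)) q₀)
    (hv : ContMDiffAt IN ((𝓡 m).prod 𝓘(ℝ, Model m)) ∞
      (fun q ↦ TotalSpace.mk' (Model m) (E := fun x : M ↦ TangentSpace (𝓡 m) x) (b q) (v q)) q₀)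
    (hw : ContMDiffAt IN ((𝓡 m).prod 𝓘(ℝ, Model m)) ∞
      (fun q ↦ TotalSpace.mk' (Model m) (E := fun x : M ↦ TangentSpace (𝓡 m) x) (b q) (w q)) q₀) :
    ContMDiffAt IN 𝓘(ℝ, ℝ) ∞ (fun q ↦ B q (v q) (w q)) q₀ :=
  (contMDiffAt_totalSpace.1
    (ContMDiffAt.clm_bundle_apply₂ (E₃ := Bundle.Trivial M ℝ) (F₃ := ℝ) hB hv hw)).2

/-- A smooth field of bilinear forms. -/
def IsSmoothForm
    (B : (x : M) → TangentSpace (𝓡 m) x →L[ℝ] TangentSpace (𝓡 m) x →L[ℝ] ℝ) : Prop :=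
  ContMDiff (𝓡 m) ((𝓡 m).prod 𝓘(ℝ, Model m →L[ℝ] Model m →L[ℝ] ℝ)) ∞
    (fun x ↦ TotalSpace.mk' (Model m →L[ℝ] Model m →L[ℝ] ℝ)
      (E := fun x : M ↦ TangentSpace (𝓡 m) x →L[ℝ] TangentSpace (𝓡 m) x →L[ℝ] ℝ) x (B x))

/-- A sufficient condition for the smoothness of a curve in the space of bilinear forms. -/
theorem contMDiff_add_smul
    {A B : (x : M) → TangentSpace (𝓡 m) x →L[ℝ] TangentSpace (𝓡 m) x →L[ℝ] ℝ}
    (hA : IsSmoothForm A) (hB : IsSmoothForm B) {b : N → M} (hb : ContMDiff IN (𝓡 m) ∞ b)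
    {r : N → ℝ} (hr : ContMDiff IN 𝓘(ℝ, ℝ) ∞ r) :
    ContMDiff IN ((𝓡 m).prod 𝓘(ℝ, Model m →L[ℝ] Model m →L[ℝ] ℝ)) ∞
      (fun q ↦ TotalSpace.mk' (Model m →L[ℝ] Model m →L[ℝ] ℝ)
        (E := fun x : M ↦ TangentSpace (𝓡 m) x →L[ℝ] TangentSpace (𝓡 m) x →L[ℝ] ℝ)
        (b q) (A (b q) + r q • B (b q))) := fun q₀ ↦ by
  refine contMDiffAt_of_components (B := fun q ↦ A (b q) + r q • B (b q)) (hb q₀) fun i j ↦ ?_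
  have hc : ∀ i, ContMDiffAt IN ((𝓡 m).prod 𝓘(ℝ, Model m)) ∞
      (fun q ↦ TotalSpace.mk' (Model m) (E := fun x : M ↦ TangentSpace (𝓡 m) x)
        (b q) (coordVec (b q₀) (b q) i)) q₀ := fun i ↦
    (contMDiffAt_coordVec (b q₀) (b q₀) (mem_chart_source _ _) i).comp q₀ (hb q₀)
  exact (contMDiffAt_form_apply ((hA (b q₀)).comp q₀ (hb q₀)) (hc i) (hc j)).add
    ((hr q₀).mul (contMDiffAt_form_apply ((hB (b q₀)).comp q₀ (hb q₀)) (hc i) (hc j)))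

end SmoothForms

/-! ### The test curves g + (e^{tφ} - 1) B. -/

section Perturbation

variable {m : ℕ} {M : Type*} [TopologicalSpace M] [ChartedSpace (Model m) M]
  [IsManifold (𝓡 m) ∞ M]

/-- A smooth symmetric bilinear form `B` with `0 ≤ B ≤ g`. -/
structure IsSubform (g : Met m M)
    (B : (x : M) → TangentSpace (𝓡 m) x →L[ℝ] TangentSpace (𝓡 m) x →L[ℝ] ℝ) : Prop where
  smooth : IsSmoothForm B
  symm : ∀ x v w, B x v w = B x w v
  nonneg : ∀ x v, 0 ≤ B x v v
  le : ∀ x v, B x v v ≤ g.inner x v v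

variable {g : Met m M}
  {B : (x : M) → TangentSpace (𝓡 m) x →L[ℝ] TangentSpace (𝓡 m) x →L[ℝ] ℝ} {φ : M → ℝ}

/-- The right side is affine in the value of B, which lies between 0 and that of g; its end values
are g and e^s g. The bound makes the test curve positive definite for every real time, as the
definition of criticality demands. -/
theorem IsSubform.lower_bound (hB : IsSubform g B) (s : ℝ) (x : M) (v : TangentSpace (𝓡 m) x) :
    min 1 (Real.exp s) * g.inner x v v ≤ g.inner x v v + (Real.exp s - 1) * B x v v := by
  have h0 := hB.nonneg x v
  have h1 := hB.le x v
  rcases le_total 1 (Real.exp s) with h | h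
  · rw [min_eq_left h]
    nlinarith
  · rw [min_eq_right h]
    nlinarith

/-- The metric `g + (e^{tφ} - 1) B`. -/
def IsSubform.perturb (hB : IsSubform g B) (hφ : ContMDiff (𝓡 m) 𝓘(ℝ, ℝ) ∞ φ) (t : ℝ) :
    Met m M where
  inner x := g.inner x + (Real.exp (t * φ x) - 1) • B x
  symm x v w := by
    change g.inner x v w + (Real.exp (t * φ x) - 1) * B x v w
      = g.inner x w v + (Real.exp (t * φ x) - 1) * B x w v
    rw [g.symm, hB.symm]
  pos x v hv := by
    change 0 < g.inner x v v + (Real.exp (t * φ x) - 1) * B x v v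
    exact (mul_pos (lt_min one_pos (Real.exp_pos _)) (g.pos x v hv)).trans_le
      (hB.lower_bound _ x v)
  -- By the lower bound, the unit ball of the perturbed metric lies in the unit ball of `g` dilated
  -- by 1 / √ε.
  isVonNBounded x := by
    set ε := min 1 (Real.exp (t * φ x)) with hε
    have hε0 : 0 < ε := lt_min one_pos (Real.exp_pos _)
    refine ((g.isVonNBounded x).image ((√ε)⁻¹ • ContinuousLinearMap.id ℝ _)).subset fun v hv ↦ ?_
    have hv' : g.inner x v v + (Real.exp (t * φ x) - 1) * B x v v < 1 := hv
    have hs : √ε ≠ 0 := (Real.sqrt_pos.2 hε0).ne'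
    refine ⟨√ε • v, ?_, ?_⟩
    · change g.inner x (√ε • v) (√ε • v) < 1
      simp only [map_smul, _root_.smul_apply, smul_eq_mul]
      rw [← mul_assoc, Real.mul_self_sqrt hε0.le]
      exact (hB.lower_bound _ x v).trans_lt hv'
    · change (√ε)⁻¹ • (√ε • v) = v
      rw [smul_smul, inv_mul_cancel₀ hs, one_smul]
  contMDiff := contMDiff_add_smul (b := id) g.contMDiff hB.smooth contMDiff_id
    (r := fun x ↦ Real.exp (t * φ x) - 1)
    ((Real.contDiff_exp.contMDiff.comp (contMDiff_const.mul hφ)).sub contMDiff_const)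

theorem IsSubform.perturb_apply (hB : IsSubform g B) (hφ : ContMDiff (𝓡 m) 𝓘(ℝ, ℝ) ∞ φ) (t : ℝ)
    (x : M) (v w : TangentSpace (𝓡 m) x) :
    (hB.perturb hφ t).inner x v w = g.inner x v w + (Real.exp (t * φ x) - 1) * B x v w := rfl

theorem IsSubform.perturb_zero (hB : IsSubform g B) (hφ : ContMDiff (𝓡 m) 𝓘(ℝ, ℝ) ∞ φ) :
    hB.perturb hφ 0 = g := by
  have h : (hB.perturb hφ 0).inner = g.inner := by
    funext x
    ext v w
    rw [hB.perturb_apply]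
    simp
  cases g
  cases hp : hB.perturb hφ 0
  rw [hp] at h
  simp_all

theorem IsSubform.isSmoothCurve_perturb (hB : IsSubform g B)
    (hφ : ContMDiff (𝓡 m) 𝓘(ℝ, ℝ) ∞ φ) : IsSmoothCurve (hB.perturb hφ) :=
  contMDiff_add_smul (b := Prod.snd) g.contMDiff hB.smooth contMDiff_snd
    (r := fun q : ℝ × M ↦ Real.exp (q.1 * φ q.2) - 1)
    ((Real.contDiff_exp.contMDiff.comp (contMDiff_fst.mul (hφ.comp contMDiff_snd))).sub
      contMDiff_const)

/-- The matrix of a field of bilinear forms in the chart at `x₀`. -/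
def formMat (B : (x : M) → TangentSpace (𝓡 m) x →L[ℝ] TangentSpace (𝓡 m) x →L[ℝ] ℝ) (x₀ : M)
    (y : Model m) : Matrix (Fin m) (Fin m) ℝ :=
  Matrix.of fun i j ↦ B ((extChartAt (𝓡 m) x₀).symm y)
    (coordVec x₀ ((extChartAt (𝓡 m) x₀).symm y) i) (coordVec x₀ ((extChartAt (𝓡 m) x₀).symm y) j)

/-- The derivative of e^{tφ} at 0 is φ, so the test curves realize all velocities φ B with φ smooth.
-/
theorem IsSubform.velocityMat_perturb (hB : IsSubform g B)
    (hφ : ContMDiff (𝓡 m) 𝓘(ℝ, ℝ) ∞ φ) {x₀ : M} {y : Model m}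
    (hy : y ∈ (extChartAt (𝓡 m) x₀).target) :
    velocityMat (hB.perturb hφ) x₀ y
      = φ ((extChartAt (𝓡 m) x₀).symm y) • formMat B x₀ y := by
  ext i j
  refine ((hB.isSmoothCurve_perturb hφ).hasDerivAt_gram hy i j).unique ?_
  set p := (extChartAt (𝓡 m) x₀).symm y
  have h : HasDerivAt (fun t : ℝ ↦ g.inner p (coordVec x₀ p i) (coordVec x₀ p j)
      + (Real.exp (t * φ p) - 1) * B p (coordVec x₀ p i) (coordVec x₀ p j))
      ((Real.exp (0 * φ p) * (1 * φ p)) * B p (coordVec x₀ p i) (coordVec x₀ p j)) 0 :=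
    (((((hasDerivAt_id (0 : ℝ)).mul_const (φ p)).exp).sub_const 1).mul_const _).const_add _
  simp only [zero_mul, Real.exp_zero, one_mul] at h
  exact h

end Perturbation

/-! ### The projections onto the subbundles, the forms g_i, and the test curves in the
multiconformal class. -/

section Projections

variable {m : ℕ} {M : Type*} [TopologicalSpace M] [ChartedSpace (Model m) M]
  [IsManifold (𝓡 m) ∞ M] {l : ℕ} {k : Fin l → ℕ} (D : Decomposition m M l k)

theorem Decomposition.proj_mem (i : Fin l) (x : M) (v : TangentSpace (𝓡 m) x) :
    D.proj i x v ∈ D.fiber i x :=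
  Subtype.property _

theorem Decomposition.proj_lof (i j : Fin l) (x : M) (v : D.fiber j x) :
    D.proj i x (v : TangentSpace (𝓡 m) x) = if i = j then (v : TangentSpace (𝓡 m) x) else 0 := by
  have h : (LinearEquiv.ofBijective (DirectSum.coeLinearMap fun j ↦ D.fiber j x)
      (D.bijective x)).symm (v : TangentSpace (𝓡 m) x)
      = DirectSum.lof ℝ (Fin l) (fun j ↦ D.fiber j x) j v := by
    rw [LinearEquiv.symm_apply_eq]
    exact (DirectSum.coeLinearMap_lof (fun j ↦ D.fiber j x) j v).symm
  simp only [Decomposition.proj, LinearMap.comp_apply, LinearEquiv.coe_coe]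
  rw [h]
  split_ifs with hij
  · subst hij
    rw [DirectSum.component.lof_self]
    rfl
  · rw [DirectSum.component.of, dif_neg (Ne.symm hij), map_zero]

variable {D}

theorem Decomposition.proj_of_mem {i : Fin l} {x : M} {v : TangentSpace (𝓡 m) x}
    (hv : v ∈ D.fiber i x) : D.proj i x v = v := by
  simpa using D.proj_lof i i x ⟨v, hv⟩

theorem Decomposition.proj_of_mem_ne {i j : Fin l} (hij : i ≠ j) {x : M}
    {v : TangentSpace (𝓡 m) x} (hv : v ∈ D.fiber j x) : D.proj i x v = 0 := by
  simpa [hij] using D.proj_lof i j x ⟨v, hv⟩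

theorem Decomposition.sum_proj (x : M) (v : TangentSpace (𝓡 m) x) :
    ∑ i, D.proj i x v = v := by
  obtain ⟨u, rfl⟩ := (D.bijective x).2 v
  have h : (∑ i, D.proj i x) ∘ₗ (DirectSum.coeLinearMap fun j ↦ D.fiber j x)
      = DirectSum.coeLinearMap fun j ↦ D.fiber j x := by
    refine DirectSum.linearMap_ext ℝ fun j ↦ LinearMap.ext fun w ↦ ?_
    simp only [LinearMap.comp_apply, DirectSum.coeLinearMap_lof, LinearMap.sum_apply]
    simp [D.proj_lof]
  simpa using LinearMap.congr_fun h u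

variable {g : Met m M}

theorem inner_proj_left (hg : g ∈ compatible D) (i : Fin l) (x : M)
    {v : TangentSpace (𝓡 m) x} (hv : v ∈ D.fiber i x) (w : TangentSpace (𝓡 m) x) :
    g.inner x v (D.proj i x w) = g.inner x v w := by
  conv_rhs => rw [← D.sum_proj x w, map_sum]
  exact (Finset.sum_eq_single i (fun j _ hj ↦ hg i j hj.symm x _ hv _ (D.proj_mem j x w))
    fun h ↦ absurd (Finset.mem_univ i) h).symm

theorem inner_eq_sum_metricPart (hg : g ∈ compatible D) (x : M) (v w : TangentSpace (𝓡 m) x) :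
    g.inner x v w = ∑ i, metricPart D g i x v w := by
  conv_lhs => rw [← D.sum_proj x v]
  simp only [map_sum, _root_.sum_apply]
  exact Finset.sum_congr rfl fun i _ ↦ (inner_proj_left hg i x (D.proj_mem i x v) w).symm

theorem metric_self_nonneg (g : Met m M) (x : M) (v : TangentSpace (𝓡 m) x) :
    0 ≤ g.inner x v v := by
  rcases eq_or_ne v 0 with rfl | h
  · simp
  · exact (g.pos x v h).le

instance (x : M) : FiniteDimensional ℝ (TangentSpace (𝓡 m) x) :=
  inferInstanceAs (FiniteDimensional ℝ (Model m))

instance (x : M) : T2Space (TangentSpace (𝓡 m) x) :=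
  inferInstanceAs (T2Space (Model m))

/-- The projection `P_i` as a continuous linear map. -/
def projL (D : Decomposition m M l k) (i : Fin l) (x : M) :
    TangentSpace (𝓡 m) x →L[ℝ] TangentSpace (𝓡 m) x :=
  LinearMap.toContinuousLinearMap (D.proj i x)

/-- `g_i` as a field of continuous bilinear forms. -/
def metricPartForm (D : Decomposition m M l k) (g : Met m M) (i : Fin l) (x : M) :
    TangentSpace (𝓡 m) x →L[ℝ] TangentSpace (𝓡 m) x →L[ℝ] ℝ :=
  LinearMap.toContinuousLinearMap
    { toFun := fun v ↦ (g.inner x (D.proj i x v)).comp (projL D i x)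
      map_add' := fun v w ↦ by ext u; simp
      map_smul' := fun r v ↦ by ext u; simp }

theorem metricPartForm_apply (i : Fin l) (x : M) (v w : TangentSpace (𝓡 m) x) :
    metricPartForm D g i x v w = metricPart D g i x v w := rfl

/-- In a frame of `E_i`, the form `g_i` is given by the inverse of the Gram matrix of the frame. -/
theorem metricPart_eq_frame (hg : g ∈ compatible D) (i : Fin l) {x : M}
    {s : Fin (k i) → TangentSpace (𝓡 m) x} (hs : LinearIndependent ℝ s)
    (hspan : Submodule.span ℝ (Set.range s) = D.fiber i x) :
    (Matrix.of fun a b ↦ g.inner x (s a) (s b)).det ≠ 0 ∧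
    ∀ v w, metricPart D g i x v w
      = ∑ a, ∑ b, (Matrix.of fun a b ↦ g.inner x (s a) (s b))⁻¹ a b
        * (g.inner x (s a) v * g.inner x (s b) w) := by
  set G : Matrix (Fin (k i)) (Fin (k i)) ℝ := Matrix.of fun a b ↦ g.inner x (s a) (s b) with hG
  have hGs : ∀ c : Fin (k i) → ℝ, ∀ a, g.inner x (s a) (∑ b, c b • s b) = (G.mulVec c) a := by
    intro c a
    simp only [map_sum, map_smul, smul_eq_mul, Matrix.mulVec, dotProduct, hG, Matrix.of_apply]
    exact Finset.sum_congr rfl fun b _ ↦ mul_comm _ _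
  have hdet : G.det ≠ 0 := by
    intro h0
    obtain ⟨c, hc, hGc⟩ := Matrix.exists_mulVec_eq_zero_iff.2 h0
    refine hc (funext fun a ↦ ?_)
    have hz : ∑ b, c b • s b = 0 := by
      by_contra hne
      refine (g.pos x _ hne).ne' ?_
      rw [g.symm]
      conv_lhs => rw [map_sum]
      refine Finset.sum_eq_zero fun b _ ↦ ?_
      rw [g.symm, map_smul, _root_.smul_apply, hGs, hGc, Pi.zero_apply, smul_zero]
    exact Fintype.linearIndependent_iff.1 hs c hz a
  refine ⟨hdet, fun v w ↦ ?_⟩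
  have hc : ∀ v, ∃ c : Fin (k i) → ℝ, ∑ b, c b • s b = D.proj i x v := fun v ↦ by
    have := D.proj_mem i x v
    rw [← hspan] at this
    exact (Submodule.mem_span_range_iff_exists_fun ℝ).1 this
  have hsm : ∀ a, s a ∈ D.fiber i x := fun a ↦ by
    rw [← hspan]; exact Submodule.subset_span ⟨a, rfl⟩
  -- Pairing with a vector of E_i sees only the E_i component, by orthogonality. The pairings of `v`
  -- with the frame thus form the vector `G c`, and cᵀ G d = (G c)ᵀ G⁻¹ (G d).
  have hu : ∀ v c, ∑ b, c b • s b = D.proj i x v → ∀ a, g.inner x (s a) v = (G.mulVec c) a :=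
    fun v c h a ↦ by rw [← inner_proj_left hg i x (hsm a) v, ← h, hGs]
  obtain ⟨c, hcv⟩ := hc v
  obtain ⟨d, hdw⟩ := hc w
  have e1 : metricPart D g i x v w = ∑ a, c a * (G.mulVec d) a := by
    rw [metricPart, ← hcv, ← hdw, g.symm, map_sum]
    exact Finset.sum_congr rfl fun a _ ↦ by
      rw [map_smul, g.symm, hGs, smul_eq_mul]
  have hsymm : G.transpose = G := by ext a b; exact g.symm _ _ _
  have e2 : ∑ a, ∑ b, G⁻¹ a b * ((G.mulVec c) a * (G.mulVec d) b)
      = (G.mulVec c) ⬝ᵥ (G⁻¹.mulVec (G.mulVec d)) := by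
    generalize G.mulVec c = p, G.mulVec d = q
    simp only [dotProduct, Matrix.mulVec, Finset.mul_sum]
    exact Finset.sum_congr rfl fun a _ ↦ Finset.sum_congr rfl fun b _ ↦ by ring
  simp only [hu v c hcv, hu w d hdw]
  rw [e1, e2, Matrix.mulVec_mulVec, Matrix.nonsing_inv_mul _ (isUnit_iff_ne_zero.2 hdet),
    Matrix.one_mulVec]
  change c ⬝ᵥ G.mulVec d = _
  rw [Matrix.dotProduct_mulVec, ← Matrix.mulVec_transpose, hsymm]

/-- The entries of the inverse of a smooth family of matrices are smooth. -/
theorem contMDiffAt_inv_entries {n : ℕ} {G : M → Matrix (Fin n) (Fin n) ℝ} {x : M}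
    (hG : ∀ a b, ContMDiffAt (𝓡 m) 𝓘(ℝ, ℝ) ∞ (fun y ↦ G y a b) x) (h0 : (G x).det ≠ 0)
    (a b : Fin n) : ContMDiffAt (𝓡 m) 𝓘(ℝ, ℝ) ∞ (fun y ↦ (G y)⁻¹ a b) x := by
  have h : SmoothMatAt (fun A : Fin n → Fin n → ℝ ↦ Matrix.of A) (fun a b ↦ G x a b) :=
    fun i j ↦ ((contDiff_apply_apply ℝ ℝ i j).contDiffAt)
  have h2 : ContMDiffAt (𝓡 m) 𝓘(ℝ, Fin n → Fin n → ℝ) ∞ (fun y ↦ (fun a b ↦ G y a b)) x :=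
    contMDiffAt_pi_space.2 fun a ↦ contMDiffAt_pi_space.2 fun b ↦ hG a b
  exact ContMDiffAt.comp x (g := fun A : Fin n → Fin n → ℝ ↦ (Matrix.of A)⁻¹ a b)
    (h.inv h0 a b).contMDiffAt h2

/-- Smoothness of the projections is not part of a `Decomposition`. The frame formula
`metricPart_eq_frame` expresses g_i through g, a smooth frame and an inverse Gram matrix, all of
which are smooth. -/
theorem isSmoothForm_metricPartForm (hg : g ∈ compatible D) (i : Fin l) :
    IsSmoothForm (metricPartForm D g i) := fun x₀ ↦ by
  refine contMDiffAt_of_components (b := fun x ↦ x) (B := metricPartForm D g i) contMDiffAt_id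
    fun p q ↦ ?_
  obtain ⟨U, hU, s, hs, hsU⟩ := D.exists_frame i x₀
  have hsm : ∀ a, ContMDiffAt (𝓡 m) ((𝓡 m).prod 𝓘(ℝ, Model m)) ∞
      (fun y ↦ TotalSpace.mk' (Model m) (E := fun x : M ↦ TangentSpace (𝓡 m) x) y (s a y)) x₀ :=
    fun a ↦ (hs a).contMDiffAt hU
  have hc := contMDiffAt_coordVec x₀ x₀ (mem_chart_source (Model m) x₀)
  have hfr := fun y (hy : y ∈ U) ↦ metricPart_eq_frame hg i (hsU y hy).1 (hsU y hy).2
  have e : (fun y ↦ metricPartForm D g i y (coordVec x₀ y p) (coordVec x₀ y q)) =ᶠ[𝓝 x₀]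
      fun y ↦ ∑ a, ∑ b, (Matrix.of fun a b ↦ g.inner y (s a y) (s b y))⁻¹ a b
        * (g.inner y (s a y) (coordVec x₀ y p) * g.inner y (s b y) (coordVec x₀ y q)) := by
    filter_upwards [hU] with y hy
    exact (hfr y hy).2 _ _
  refine ContMDiffAt.congr_of_eventuallyEq ?_ e
  refine ContMDiffAt.sum fun a _ ↦ ContMDiffAt.sum fun b _ ↦ ?_
  exact (contMDiffAt_inv_entries (fun a b ↦ contMDiffAt_form_apply (g.contMDiff x₀) (hsm a) (hsm b))
    (hfr x₀ (mem_of_mem_nhds hU)).1 a b).mul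
    ((contMDiffAt_form_apply (g.contMDiff x₀) (hsm a) (hc p)).mul
      (contMDiffAt_form_apply (g.contMDiff x₀) (hsm b) (hc q)))

/-- The bound by g holds because g is the sum of the nonnegative forms g_j. -/
theorem isSubform_metricPartForm (hg : g ∈ compatible D) (i : Fin l) :
    IsSubform g (metricPartForm D g i) where
  smooth := isSmoothForm_metricPartForm hg i
  symm x v w := g.symm _ _ _
  nonneg x v := metric_self_nonneg g x _
  le x v := by
    rw [inner_eq_sum_metricPart hg]
    exact Finset.single_le_sum (f := fun j ↦ metricPart D g j x v v)
      (fun j _ ↦ metric_self_nonneg g x _) (Finset.mem_univ i)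

/-- The curve multiplies g_i by e^{tφ} and leaves the other parts alone, so the conformal factors
are f_i = e^{tφ/2} and f_j = 1 for j ≠ i. -/
theorem perturb_metricPart_mem (hg : g ∈ compatible D) (i : Fin l) {φ : M → ℝ}
    (hφ : ContMDiff (𝓡 m) 𝓘(ℝ, ℝ) ∞ φ) (t : ℝ) :
    (isSubform_metricPartForm hg i).perturb hφ t ∈ multiconformalClass D g := by
  have hz : ∀ j x v, v ∈ D.fiber j x → ∀ w, metricPart D g i x v w
      = if i = j then g.inner x v (D.proj i x w) else 0 := fun j x v hv w ↦ by
    split_ifs with h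
    · subst h
      rw [metricPart, D.proj_of_mem hv]
    · rw [metricPart, D.proj_of_mem_ne h hv]
      simp
  refine ⟨fun j j' hj x v hv w hw ↦ ?_, fun j x ↦ if j = i then Real.exp (t * φ x / 2) else 1,
    fun j ↦ ?_, fun j x ↦ ?_, fun j x v hv w hw ↦ ?_⟩
  · rw [IsSubform.perturb_apply, hg j j' hj x v hv w hw, metricPartForm_apply, hz j x v hv w]
    split_ifs with h
    · subst h
      rw [D.proj_of_mem_ne hj hw]
      simp
    · simp
  · by_cases h : j = i
    · simp only [if_pos h]
      exact Real.contDiff_exp.contMDiff.comp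
        ((contMDiff_const.mul hφ).mul (contMDiff_const (c := (2 : ℝ)⁻¹)))
    · simp only [if_neg h]
      exact contMDiff_const
  · dsimp only
    split_ifs
    · exact Real.exp_pos _
    · exact one_pos
  · rw [IsSubform.perturb_apply, metricPartForm_apply, hz j x v hv w]
    by_cases h : j = i
    · subst h
      have he : Real.exp (t * φ x / 2) ^ 2 = Real.exp (t * φ x) := by
        rw [sq, ← Real.exp_add, add_halves]
      simp only [if_true]
      rw [D.proj_of_mem hw, he]
      ring
    · simp only [if_neg h, if_neg (Ne.symm h)]
      ring

end Projections

/-! ### The rank one test forms X♭ ⊗ X♭. -/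

section VectorSquare

variable {m : ℕ} {M : Type*} [TopologicalSpace M] [ChartedSpace (Model m) M]
  [IsManifold (𝓡 m) ∞ M] {l : ℕ} {k : Fin l → ℕ} {D : Decomposition m M l k} {g : Met m M}

/-- The form `X♭ ⊗ X♭`. -/
def squareForm (g : Met m M) (X : (x : M) → TangentSpace (𝓡 m) x) (x : M) :
    TangentSpace (𝓡 m) x →L[ℝ] TangentSpace (𝓡 m) x →L[ℝ] ℝ :=
  (g.inner x (X x)).smulRight (g.inner x (X x))

theorem squareForm_apply (X : (x : M) → TangentSpace (𝓡 m) x) (x : M)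
    (v w : TangentSpace (𝓡 m) x) :
    squareForm g X x v w = g.inner x (X x) v * g.inner x (X x) w := rfl

theorem inner_cauchy_schwarz (g : Met m M) (x : M) (u v : TangentSpace (𝓡 m) x) :
    g.inner x u v * g.inner x u v ≤ g.inner x u u * g.inner x v v := by
  have h : ∀ r : ℝ, 0 ≤ g.inner x v v * (r * r) + (2 * g.inner x u v) * r + g.inner x u u := by
    intro r
    have := metric_self_nonneg g x (u + r • v)
    simp only [map_add, map_smul, _root_.add_apply, _root_.smul_apply, smul_eq_mul] at this
    rw [g.symm x v u] at this
    linarith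
  have := discrim_le_zero h
  rw [discrim] at this
  nlinarith

/-- Cauchy–Schwarz, together with the length of X being at most 1, gives the upper bound by g. -/
theorem isSubform_squareForm {X : (x : M) → TangentSpace (𝓡 m) x}
    (hX : ContMDiff (𝓡 m) ((𝓡 m).prod 𝓘(ℝ, Model m)) ∞
      (fun x ↦ TotalSpace.mk' (Model m) (E := fun x : M ↦ TangentSpace (𝓡 m) x) x (X x)))
    (h1 : ∀ x, g.inner x (X x) (X x) ≤ 1) : IsSubform g (squareForm g X) where
  smooth x₀ := by
    refine contMDiffAt_of_components (b := fun x ↦ x) (B := squareForm g X) contMDiffAt_id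
      fun i j ↦ ?_
    have hc := contMDiffAt_coordVec x₀ x₀ (mem_chart_source (Model m) x₀)
    exact (contMDiffAt_form_apply (g.contMDiff x₀) (hX x₀) (hc i)).mul
      (contMDiffAt_form_apply (g.contMDiff x₀) (hX x₀) (hc j))
  symm x v w := mul_comm _ _
  nonneg x v := mul_self_nonneg _
  le x v := (inner_cauchy_schwarz g x (X x) v).trans
    (mul_le_of_le_one_left (metric_self_nonneg g x v) (h1 x))

/-- Vectors of different summands cannot both pair nontrivially with X, which lies in E_i, so
orthogonality persists. -/
theorem perturb_squareForm_mem (hg : g ∈ compatible D) {i : Fin l}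
    {X : (x : M) → TangentSpace (𝓡 m) x} (hXi : ∀ x, X x ∈ D.fiber i x)
    (hB : IsSubform g (squareForm g X)) {φ : M → ℝ}
    (hφ : ContMDiff (𝓡 m) 𝓘(ℝ, ℝ) ∞ φ) (t : ℝ) : hB.perturb hφ t ∈ compatible D := by
  intro j j' hj x v hv w hw
  rw [IsSubform.perturb_apply, hg j j' hj x v hv w hw, squareForm_apply]
  rcases eq_or_ne i j with rfl | h
  · rw [hg i j' hj x _ (hXi x) w hw]
    ring
  · rw [hg i j h x _ (hXi x) v hv]
    ring

/-- Every vector of `E_i` extends, up to a positive factor, to a global section of `E_i` of length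
at most one. -/
theorem exists_section [T2Space M] [CompactSpace M] (g : Met m M) {i : Fin l} {x₀ : M}
    {v : TangentSpace (𝓡 m) x₀} (hv : v ∈ D.fiber i x₀) :
    ∃ X : (x : M) → TangentSpace (𝓡 m) x, ContMDiff (𝓡 m) ((𝓡 m).prod 𝓘(ℝ, Model m)) ∞
      (fun x ↦ TotalSpace.mk' (Model m) (E := fun x : M ↦ TangentSpace (𝓡 m) x) x (X x)) ∧
      (∀ x, g.inner x (X x) (X x) ≤ 1) ∧ (∀ x, X x ∈ D.fiber i x) ∧
      ∃ r : ℝ, r ≠ 0 ∧ X x₀ = r • v := by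
  obtain ⟨U, hU, s, hs, hsU⟩ := D.exists_frame i x₀
  obtain ⟨U', hU'U, hU'o, hx₀⟩ := mem_nhds_iff.1 hU
  obtain ⟨c, hc⟩ : ∃ c : Fin (k i) → ℝ, ∑ b, c b • s b x₀ = v := by
    rw [← (hsU x₀ (mem_of_mem_nhds hU)).2] at hv
    exact (Submodule.mem_span_range_iff_exists_fun ℝ).1 hv
  obtain ⟨f, -, hf⟩ := (SmoothBumpFunction.nhds_basis_tsupport (I := 𝓡 m) x₀).mem_iff.1
    (hU'o.mem_nhds hx₀)
  -- A bump function supported in the domain of the frame extends the constant-coefficient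
  -- combination of the frame by zero.
  set Y : (x : M) → TangentSpace (𝓡 m) x := fun x ↦ f x • ∑ b, c b • s b x with hY
  have hYs : ContMDiff (𝓡 m) ((𝓡 m).prod 𝓘(ℝ, Model m)) ∞
      (fun x ↦ TotalSpace.mk' (Model m) (E := fun x : M ↦ TangentSpace (𝓡 m) x) x (Y x)) := by
    refine ContMDiffOn.smul_section_of_tsupport (u := U') f.contMDiff.contMDiffOn hU'o hf ?_
    refine ContMDiffOn.sum_section fun b _ ↦ ?_
    exact ContMDiffOn.const_smul_section ((hs b).mono hU'U)
  have hYc : Continuous fun x ↦ g.inner x (Y x) (Y x) :=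
    ContMDiff.continuous (I := 𝓡 m) (I' := 𝓘(ℝ, ℝ)) (n := ∞) fun x ↦
      contMDiffAt_form_apply (g.contMDiff x) (hYs x) (hYs x)
  obtain ⟨C, hC⟩ := isCompact_univ.bddAbove_image hYc.continuousOn
  have hC' : ∀ x, g.inner x (Y x) (Y x) ≤ C := fun x ↦ hC ⟨x, Set.mem_univ x, rfl⟩
  have hC0 : 0 ≤ C := (metric_self_nonneg g x₀ _).trans (hC' x₀)
  -- `C` bounds the squared length of `Y` on the compact manifold; `C + 1` is used since `C` may be
  -- 0.
  have hD : 0 < √(C + 1) := Real.sqrt_pos.2 (by linarith)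
  refine ⟨fun x ↦ (√(C + 1))⁻¹ • Y x, ContMDiff.const_smul_section hYs, fun x ↦ ?_, fun x ↦ ?_,
    (√(C + 1))⁻¹, (inv_pos.2 hD).ne', ?_⟩
  · simp only [map_smul, _root_.smul_apply, smul_eq_mul]
    rw [← mul_assoc, ← mul_inv, Real.mul_self_sqrt (by linarith), inv_mul_le_iff₀ (by linarith)]
    linarith [hC' x]
  · refine Submodule.smul_mem _ _ ?_
    by_cases hx : x ∈ U
    · refine Submodule.smul_mem _ _ (Submodule.sum_mem _ fun b _ ↦ Submodule.smul_mem _ _ ?_)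
      rw [← (hsU x hx).2]
      exact Submodule.subset_span ⟨b, rfl⟩
    · have : f x = 0 := image_eq_zero_of_notMem_tsupport fun h ↦ hx (hU'U (hf h))
      rw [hY]
      simp only [this, zero_smul]
      exact Submodule.zero_mem _
  · rw [hY]
    simp only [hc, f.eq_one, one_smul]

end VectorSquare

/-! ### Trace identities for projections that are self-adjoint with respect to G. -/

section MatrixProjections

variable {n : ℕ} {G P A H : Matrix (Fin n) (Fin n) ℝ}

theorem inv_mul_transpose_proj (hG : IsUnit G.det) (hPG : P.transpose * G = G * P) :
    G⁻¹ * P.transpose = P * G⁻¹ := by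
  calc G⁻¹ * P.transpose = G⁻¹ * (P.transpose * G) * G⁻¹ := by
        rw [Matrix.mul_assoc, Matrix.mul_assoc, Matrix.mul_nonsing_inv _ hG, Matrix.mul_one]
    _ = P * G⁻¹ := by
        rw [hPG, ← Matrix.mul_assoc, Matrix.nonsing_inv_mul _ hG, Matrix.one_mul]

theorem trace_inv_mul_conj_proj (hG : IsUnit G.det) (hPG : P.transpose * G = G * P)
    (hP : P * P = P) : (G⁻¹ * (P.transpose * A * P)).trace = (G⁻¹ * A * P).trace := by
  rw [← Matrix.mul_assoc, ← Matrix.mul_assoc, inv_mul_transpose_proj hG hPG, Matrix.trace_mul_comm,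
    ← Matrix.mul_assoc, ← Matrix.mul_assoc, hP, Matrix.mul_assoc, Matrix.trace_mul_comm]

theorem trace_inv_mul_metricPart (hG : IsUnit G.det) :
    (G⁻¹ * (G * P)).trace = P.trace := by
  rw [← Matrix.mul_assoc, Matrix.nonsing_inv_mul _ hG, Matrix.one_mul]

theorem trace_metricPart_ric (hG : IsUnit G.det) :
    (G⁻¹ * (G * P) * G⁻¹ * A).trace = (G⁻¹ * A * P).trace := by
  rw [← Matrix.mul_assoc, Matrix.nonsing_inv_mul _ hG, Matrix.one_mul, Matrix.mul_assoc,
    Matrix.trace_mul_comm]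

/-- A block Pᵀ H P pairs only with the corresponding block of A: using P² = P, one copy of P is
moved cyclically onto A, where the block is c times that of the metric. -/
theorem trace_conj_proj_ric (hG : IsUnit G.det) (hPG : P.transpose * G = G * P)
    (hP : P * P = P) {c : ℝ} (hA : P.transpose * A * P = c • (G * P)) :
    (G⁻¹ * (P.transpose * H * P) * G⁻¹ * A).trace = c * (G⁻¹ * (P.transpose * H * P)).trace := by
  have h1 := inv_mul_transpose_proj hG hPG
  calc (G⁻¹ * (P.transpose * H * P) * G⁻¹ * A).trace
      = ((G⁻¹ * P.transpose) * (H * ((P * G⁻¹) * A))).trace := by simp only [Matrix.mul_assoc]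
    _ = (P * (G⁻¹ * H * P * G⁻¹ * A)).trace := by rw [h1]; simp only [Matrix.mul_assoc]
    _ = (G⁻¹ * H * ((P * P) * G⁻¹) * A * P).trace := by
        rw [Matrix.trace_mul_comm, hP]; simp only [Matrix.mul_assoc]
    _ = (G⁻¹ * H * P * G⁻¹ * (P.transpose * A * P)).trace := by
        rw [Matrix.mul_assoc P P, ← h1]; simp only [Matrix.mul_assoc]
    _ = c * (G⁻¹ * H * P).trace := by
        rw [hA, Matrix.mul_smul, Matrix.trace_smul, smul_eq_mul, Matrix.mul_assoc _ G⁻¹,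
          ← Matrix.mul_assoc G⁻¹ G, Matrix.nonsing_inv_mul _ hG, Matrix.one_mul,
          Matrix.mul_assoc, hP]
    _ = _ := by rw [trace_inv_mul_conj_proj hG hPG hP]

end MatrixProjections

/-! ### Matrices at a point: g, Ric, P_i, and the traces R_i. -/

section AtPoint

variable {m : ℕ} {M : Type*} [TopologicalSpace M] [ChartedSpace (Model m) M]
  [IsManifold (𝓡 m) ∞ M] {l : ℕ} {k : Fin l → ℕ} (D : Decomposition m M l k) (g : Met m M)

/-- The coordinate basis of `T_p M`. -/
def coordBasis (p : M) : Module.Basis (Fin m) ℝ (TangentSpace (𝓡 m) p) :=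
  Module.Basis.ofEquivFun
    { toFun := fun v i ↦ coord p p v i
      map_add' := fun v w ↦ by
        funext i
        simp [coord]
      map_smul' := fun r v ↦ by
        funext i
        simp [coord]
      invFun := fun r ↦ ∑ i, r i • coordVec p p i
      left_inv := fun v ↦ coordVec_expand (mem_chart_source (Model m) p) v
      right_inv := fun r ↦ by
        funext j
        change coord p p (∑ i, r i • coordVec p p i) j = r j
        rw [coord_sum_smul]
        simp [coord_coordVec (mem_chart_source (Model m) p)] }

theorem coordBasis_repr (p : M) (v : TangentSpace (𝓡 m) p) (i : Fin m) :
    (coordBasis p).repr v i = coord p p v i := rfl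

theorem coordBasis_apply (p : M) (i : Fin m) : coordBasis p i = coordVec p p i := by
  rw [coordBasis, Module.Basis.coe_ofEquivFun]
  change ∑ j, (Pi.single i (1 : ℝ) : Fin m → ℝ) j • coordVec p p j = _
  rw [Finset.sum_eq_single i (fun j _ hj ↦ by rw [Pi.single_eq_of_ne hj, zero_smul])
    (fun h ↦ absurd (Finset.mem_univ i) h), Pi.single_eq_same, one_smul]

/-- The matrix `(g_ij)` at `p`, in the chart at `p`. -/
def gramAt (p : M) : Matrix (Fin m) (Fin m) ℝ := gram g p (extChartAt (𝓡 m) p p)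

/-- The matrix `(R_ij)` at `p`, in the chart at `p`. -/
def ricciAt (p : M) : Matrix (Fin m) (Fin m) ℝ := ricciMat g p (extChartAt (𝓡 m) p p)

/-- The matrix of `P_i` at `p`, in the chart at `p`. -/
def projAt (i : Fin l) (p : M) : Matrix (Fin m) (Fin m) ℝ :=
  LinearMap.toMatrix (coordBasis p) (coordBasis p) (D.proj i p)

/-- The matrix of a bilinear function at `p`, in the chart at `p`. -/
def bilAt {p : M} (B : TangentSpace (𝓡 m) p → TangentSpace (𝓡 m) p → ℝ) :
    Matrix (Fin m) (Fin m) ℝ :=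
  Matrix.of fun i j ↦ B (coordVec p p i) (coordVec p p j)

/-- The chart expression lives over `(extChartAt (𝓡 m) p).symm (extChartAt (𝓡 m) p p)`, which equals
`p` but not definitionally; the base point is generalized to remove this dependence. -/
theorem formMat_eq_bilAt
    (B : (x : M) → TangentSpace (𝓡 m) x →L[ℝ] TangentSpace (𝓡 m) x →L[ℝ] ℝ) (p : M) :
    formMat B p (extChartAt (𝓡 m) p p) = bilAt fun v w ↦ B p v w := by
  have h : ∀ q, q = p → (Matrix.of fun i j ↦ B q (coordVec p q i) (coordVec p q j))
      = bilAt fun v w ↦ B p v w := by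
    rintro q rfl
    rfl
  exact h _ (extChartAt_to_inv p)

theorem gramAt_eq_bilAt (p : M) : gramAt g p = bilAt fun v w ↦ g.inner p v w :=
  formMat_eq_bilAt g.inner p

variable {D g}

theorem isUnit_gramAt_det (p : M) : IsUnit (gramAt g p).det :=
  isUnit_iff_ne_zero.2 (gram_det_pos g (mem_extChartAt_target p)).ne'

theorem trace_eq_bilAt (p : M) (B : TangentSpace (𝓡 m) p → TangentSpace (𝓡 m) p → ℝ) :
    trace g p B = ((gramAt g p)⁻¹ * (bilAt B).transpose).trace := by
  simp only [trace, Matrix.trace, Matrix.diag_apply, Matrix.mul_apply, Matrix.transpose_apply,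
    bilAt, Matrix.of_apply, gramAt]

theorem proj_coordVec (i : Fin l) (p : M) (j : Fin m) :
    D.proj i p (coordVec p p j) = ∑ a, projAt D i p a j • coordVec p p a := by
  conv_lhs => rw [← (coordBasis p).sum_repr (D.proj i p (coordVec p p j))]
  refine Finset.sum_congr rfl fun a _ ↦ ?_
  rw [projAt, LinearMap.toMatrix_apply, coordBasis_apply, coordBasis_apply]

theorem ricciAt_isSymm (p : M) : (ricciAt g p).IsSymm := by
  have hy := mem_extChartAt_target (I := 𝓡 m) p
  ext i j
  exact ric_symm (Filter.eventually_of_mem ((isOpen_target p).mem_nhds hy)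
    fun z hz ↦ smoothMatAt_gram g hz) (gram_isSymm g p) (gram_det_pos g hy) j i

theorem ricci_eq_sum (p : M) (v w : TangentSpace (𝓡 m) p) :
    ricci g p v w = ∑ i, ∑ j, ricciAt g p i j * (coord p p v i * coord p p w j) :=
  ricci_eq g (mem_chart_source (Model m) p) v w

/-- The Ricci tensor as a bilinear map. -/
def ricciBilin (g : Met m M) (p : M) :
    TangentSpace (𝓡 m) p →ₗ[ℝ] TangentSpace (𝓡 m) p →ₗ[ℝ] ℝ :=
  Matrix.toLinearMap₂ (coordBasis p) (coordBasis p) (ricciAt g p)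

theorem ricciBilin_apply (p : M) (v w : TangentSpace (𝓡 m) p) :
    ricciBilin g p v w = ricci g p v w := by
  rw [ricci_eq_sum, ricciBilin, Matrix.toLinearMap₂_apply]
  refine Finset.sum_congr rfl fun i _ ↦ Finset.sum_congr rfl fun j _ ↦ ?_
  simp only [coordBasis_repr, smul_eq_mul]
  ring

theorem ricci_symm (p : M) (v w : TangentSpace (𝓡 m) p) : ricci g p v w = ricci g p w v := by
  rw [ricci_eq_sum, ricci_eq_sum, Finset.sum_comm]
  refine Finset.sum_congr rfl fun i _ ↦ Finset.sum_congr rfl fun j _ ↦ ?_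
  rw [(ricciAt_isSymm p).apply j i]
  ring

theorem bilAt_ricci (p : M) : bilAt (ricci g p) = ricciAt g p := by
  ext i j
  have hp := mem_chart_source (Model m) p
  simp only [bilAt, Matrix.of_apply]
  rw [ricci_eq_sum]
  simp [coord_coordVec hp]

theorem bilAt_proj {p : M} (B : TangentSpace (𝓡 m) p →ₗ[ℝ] TangentSpace (𝓡 m) p →ₗ[ℝ] ℝ)
    (i j : Fin l) : bilAt (fun v w ↦ B (D.proj i p v) (D.proj j p w))
      = (projAt D i p).transpose * bilAt (fun v w ↦ B v w) * projAt D j p := by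
  ext a b
  simp only [bilAt, Matrix.of_apply, proj_coordVec, map_sum, map_smul, LinearMap.sum_apply,
    LinearMap.smul_apply, smul_eq_mul, Matrix.mul_apply, Matrix.transpose_apply, Finset.mul_sum,
    Finset.sum_mul]
  exact Finset.sum_congr rfl fun c _ ↦ Finset.sum_congr rfl fun d _ ↦ by ring

theorem projAt_mul_self (i : Fin l) (p : M) : projAt D i p * projAt D i p = projAt D i p := by
  rw [projAt, ← LinearMap.toMatrix_comp]
  congr 1
  ext v : 1
  exact D.proj_of_mem (D.proj_mem i p v)

theorem sum_projAt (p : M) : ∑ i, projAt D i p = 1 := by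
  simp only [projAt]
  rw [← map_sum, ← LinearMap.toMatrix_id (coordBasis p)]
  congr 1
  ext v : 1
  rw [LinearMap.sum_apply, D.sum_proj, LinearMap.id_apply]

/-- The trace of a projection is the dimension of its range, which the local frame computes. -/
theorem trace_projAt (i : Fin l) (p : M) : (projAt D i p).trace = k i := by
  rw [projAt, ← LinearMap.trace_eq_matrix_trace]
  have h : LinearMap.IsProj (D.fiber i p) (D.proj i p) :=
    ⟨fun v ↦ D.proj_mem i p v, fun v hv ↦ D.proj_of_mem hv⟩
  rw [h.trace]
  obtain ⟨U, hU, s, -, hs⟩ := D.exists_frame i p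
  obtain ⟨h1, h2⟩ := hs p (mem_of_mem_nhds hU)
  rw [← h2, finrank_span_eq_card h1, Fintype.card_fin]

theorem sum_rank [Nonempty M] (D : Decomposition m M l k) : ∑ i, (k i : ℝ) = m := by
  obtain ⟨p⟩ := ‹Nonempty M›
  simp only [← trace_projAt (D := D) _ p]
  rw [← Matrix.trace_sum, sum_projAt, Matrix.trace_one, Fintype.card_fin]

/-- Orthogonality of the decomposition means exactly that each projection is self-adjoint for g;
this is its matrix form. -/
theorem projAt_gramAt (hg : g ∈ compatible D) (i : Fin l) (p : M) :
    (projAt D i p).transpose * gramAt g p = gramAt g p * projAt D i p := by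
  have hG := gramAt_eq_bilAt g p
  have hv : ∀ v w, g.inner p (D.proj i p v) w = g.inner p v (D.proj i p w) := fun v w ↦ by
    rw [← inner_proj_left hg i p (D.proj_mem i p v) w, g.symm p v,
      ← inner_proj_left hg i p (D.proj_mem i p w) v, g.symm]
  ext a b
  have h := hv (coordVec p p a) (coordVec p p b)
  simp only [proj_coordVec, map_sum, map_smul, _root_.sum_apply, _root_.smul_apply,
    smul_eq_mul] at h
  rw [hG]
  simp only [bilAt, Matrix.mul_apply, Matrix.transpose_apply, Matrix.of_apply]
  rw [h]
  exact Finset.sum_congr rfl fun _ _ ↦ mul_comm _ _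

/-- A continuous bilinear map as a bilinear map. -/
def toBilin {p : M} (B : TangentSpace (𝓡 m) p →L[ℝ] TangentSpace (𝓡 m) p →L[ℝ] ℝ) :
    TangentSpace (𝓡 m) p →ₗ[ℝ] TangentSpace (𝓡 m) p →ₗ[ℝ] ℝ :=
  LinearMap.mk₂ ℝ (fun v w ↦ B v w) (fun _ _ _ ↦ by simp) (fun _ _ _ ↦ by simp)
    (fun _ _ _ ↦ by simp) (fun _ _ _ ↦ by simp)

theorem bilAt_metricPart (hg : g ∈ compatible D) (i : Fin l) (p : M) :
    bilAt (metricPart D g i p) = gramAt g p * projAt D i p := by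
  have h : bilAt (metricPart D g i p)
      = (projAt D i p).transpose * gramAt g p * projAt D i p := by
    rw [gramAt_eq_bilAt]
    exact bilAt_proj (toBilin (g.inner p)) i i
  rw [h, projAt_gramAt hg, Matrix.mul_assoc, projAt_mul_self]

theorem bilAt_ricciPart (i : Fin l) (p : M) :
    bilAt (ricciPart D g i p) = (projAt D i p).transpose * ricciAt g p * projAt D i p := by
  have h := bilAt_proj (D := D) (ricciBilin g p) i i
  simp only [ricciBilin_apply] at h
  rw [← bilAt_ricci]
  exact h

/-- Of the two projections in Ric_i one suffices under the trace, by self-adjointness and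
idempotency. Being linear in P_i, this form can be summed over i. -/
theorem scalarPart_eq (hg : g ∈ compatible D) (i : Fin l) (p : M) :
    scalarPart D g i p = ((gramAt g p)⁻¹ * ricciAt g p * projAt D i p).trace := by
  rw [scalarPart, trace_eq_bilAt, bilAt_ricciPart, Matrix.transpose_mul, Matrix.transpose_mul,
    Matrix.transpose_transpose, (ricciAt_isSymm p).eq, ← Matrix.mul_assoc (projAt D i p).transpose,
    trace_inv_mul_conj_proj (isUnit_gramAt_det p) (projAt_gramAt hg i p) (projAt_mul_self i p)]

theorem scalar_eq_trace (p : M) : scalar g p = ((gramAt g p)⁻¹ * ricciAt g p).trace := by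
  rw [scalar, trace_eq_bilAt, bilAt_ricci, (ricciAt_isSymm p).eq]

theorem sum_scalarPart (hg : g ∈ compatible D) (p : M) :
    ∑ i, scalarPart D g i p = scalar g p := by
  simp only [scalarPart_eq hg]
  rw [← Matrix.trace_sum, ← Matrix.mul_sum, sum_projAt, Matrix.mul_one, scalar_eq_trace]

theorem scalarPart_of_ricciPart (hg : g ∈ compatible D) {i : Fin l} {p : M} {c : ℝ}
    (h : ∀ v w, ricciPart D g i p v w = c * metricPart D g i p v w) :
    scalarPart D g i p = c * k i := by
  have hb : bilAt (ricciPart D g i p) = c • bilAt (metricPart D g i p) := by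
    ext a b
    exact h _ _
  rw [scalarPart_eq hg, ← trace_inv_mul_conj_proj (isUnit_gramAt_det p) (projAt_gramAt hg i p)
    (projAt_mul_self i p), ← bilAt_ricciPart, hb, bilAt_metricPart hg, Matrix.mul_smul,
    Matrix.trace_smul, trace_inv_mul_metricPart (isUnit_gramAt_det p), trace_projAt, smul_eq_mul]

end AtPoint

/-! ### The Euler–Lagrange equation and the value of the multiplier. -/

section Criticality

variable {m : ℕ} {M : Type*} [TopologicalSpace M] [ChartedSpace (Model m) M]
  [IsManifold (𝓡 m) ∞ M] {l : ℕ} {k : Fin l → ℕ} {D : Decomposition m M l k} {g : Met m M}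
  {B : (x : M) → TangentSpace (𝓡 m) x →L[ℝ] TangentSpace (𝓡 m) x →L[ℝ] ℝ} {φ : M → ℝ}

theorem IsSubform.velocityTrace_perturb (hB : IsSubform g B)
    (hφ : ContMDiff (𝓡 m) 𝓘(ℝ, ℝ) ∞ φ) (p : M) :
    velocityTrace (hB.perturb hφ) p
      = φ p * ((gramAt g p)⁻¹ * bilAt fun v w ↦ B p v w).trace := by
  rw [velocityTrace, hB.velocityMat_perturb hφ (mem_extChartAt_target p), hB.perturb_zero,
    formMat_eq_bilAt, extChartAt_to_inv, Matrix.mul_smul, Matrix.trace_smul, smul_eq_mul, gramAt]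

theorem IsSubform.velocityRic_perturb (hB : IsSubform g B)
    (hφ : ContMDiff (𝓡 m) 𝓘(ℝ, ℝ) ∞ φ) (p : M) :
    velocityRic (hB.perturb hφ) p
      = φ p * ((gramAt g p)⁻¹ * (bilAt fun v w ↦ B p v w) * (gramAt g p)⁻¹
        * ricciAt g p).trace := by
  rw [velocityRic, hB.velocityMat_perturb hφ (mem_extChartAt_target p), hB.perturb_zero,
    formMat_eq_bilAt, extChartAt_to_inv, Matrix.mul_smul, Matrix.smul_mul, Matrix.smul_mul,
    Matrix.trace_smul, smul_eq_mul, gramAt, ricciAt]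

variable [MeasurableSpace M]

/-- The mean value of the scalar curvature. -/
def meanScalar (g : Met m M) : ℝ :=
  (∫ x, scalar g x ∂(riemVolume g)) / (riemVolume g).real Set.univ

/-- The function `R / 2 - (m - 2) / (2m) ⨍ R`, the coefficient of the trace in the first
variation. -/
def multiplier (g : Met m M) (p : M) : ℝ :=
  scalar g p / 2 - ((m : ℝ) - 2) / (2 * m) * meanScalar g

variable [T2Space M] [CompactSpace M] [Nonempty M] [BorelSpace M]

theorem meanScalar_of_const (g : Met m M) {c : ℝ} (h : ∀ p, scalar g p = c) :
    meanScalar g = c := by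
  have hV : (riemVolume g).real Set.univ ≠ 0 := (riemVolume_univ_pos g).ne'
  simp only [meanScalar, h, integral_const, smul_eq_mul]
  field_simp

/-- The Euler-Lagrange equation in the direction of all multiples of a form. -/
theorem IsSubform.euler_lagrange (hB : IsSubform g B) (hm : 3 ≤ m) {S : Set (Met m M)}
    (hS : ∀ (φ : M → ℝ) (hφ : ContMDiff (𝓡 m) 𝓘(ℝ, ℝ) ∞ φ) (t : ℝ), hB.perturb hφ t ∈ S)
    (hcrit : IsCriticalOn einsteinHilbert S g) (p : M) :
    multiplier g p * ((gramAt g p)⁻¹ * bilAt fun v w ↦ B p v w).trace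
      = ((gramAt g p)⁻¹ * (bilAt fun v w ↦ B p v w) * (gramAt g p)⁻¹ * ricciAt g p).trace := by
  set F : M → ℝ := fun p ↦ multiplier g p * ((gramAt g p)⁻¹ * bilAt fun v w ↦ B p v w).trace
    - ((gramAt g p)⁻¹ * (bilAt fun v w ↦ B p v w) * (gramAt g p)⁻¹ * ricciAt g p).trace with hF
  -- The test curve with φ = 1 exhibits `F` as a combination of functions already known to be
  -- continuous.
  have hone : ContMDiff (𝓡 m) 𝓘(ℝ, ℝ) ∞ (fun _ : M ↦ (1 : ℝ)) := contMDiff_const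
  have hFc : Continuous F := by
    have e : F = fun p ↦ multiplier g p * velocityTrace (hB.perturb hone) p
        - velocityRic (hB.perturb hone) p := by
      funext p
      rw [hB.velocityTrace_perturb, hB.velocityRic_perturb, one_mul, one_mul]
    rw [e]
    have hγ := hB.isSmoothCurve_perturb hone
    exact ((((continuous_scalar g).div_const 2).sub continuous_const).mul
      hγ.continuous_velocityTrace).sub hγ.continuous_velocityRic
  have hint : ∀ φ : M → ℝ, ContMDiff (𝓡 m) 𝓘(ℝ, ℝ) ∞ φ → HasCompactSupport φ →
      ∫ x, φ x • F x ∂(riemVolume g) = 0 := by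
    intro φ hφ _
    have hγ := hB.isSmoothCurve_perturb hφ
    have h0 := hB.perturb_zero hφ
    have hd := hγ.hasDerivAt_einsteinHilbert hm
    have hz := hd.unique (hcrit.2 _ hγ h0 (hS φ hφ))
    have hV : (riemVolume g).real Set.univ ^ (2 / (2 * (m : ℝ) / ((m : ℝ) - 2))) ≠ 0 :=
      (Real.rpow_pos_of_pos (riemVolume_univ_pos g) _).ne'
    simp only [h0] at hz
    rw [div_eq_zero_iff, or_iff_left hV] at hz
    rw [← hz]
    refine integral_congr_ae (Filter.Eventually.of_forall fun x ↦ ?_)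
    simp only [hF, smul_eq_mul, hB.velocityTrace_perturb, hB.velocityRic_perturb, multiplier,
      meanScalar]
    ring
  -- Fundamental lemma of the calculus of variations; continuity and positivity of the measure on
  -- open sets then give the equation at every point.
  have hae := ae_eq_zero_of_integral_contMDiff_smul_eq_zero (𝓡 m)
    (integrable_of_continuous g hFc).locallyIntegrable hint
  have h := congrFun ((hFc.ae_eq_iff_eq (riemVolume g) continuous_const).1 hae) p
  exact sub_eq_zero.1 h

/-- With R = m λ, the definition of λ reads (m - 2)(m λ - R̄) = 0. Dividing by m - 2 makes λ
constant. -/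
theorem multiplier_eq_of_scalar_eq (hm : 3 ≤ m) (h : ∀ p, scalar g p = multiplier g p * m) (p : M) :
    multiplier g p = meanScalar g / m := by
  have hm' : (3 : ℝ) ≤ m := by exact_mod_cast hm
  have hm0 : (m : ℝ) ≠ 0 := by linarith
  have hp := h p
  have e : (multiplier g p * m - meanScalar g) * (((m : ℝ) - 2)) = 0 := by
    have e1 : multiplier g p * (2 * m) = scalar g p * m - ((m : ℝ) - 2) * meanScalar g := by
      rw [multiplier]
      field_simp
    rw [hp] at e1
    have e2 : (m : ℝ) * ((multiplier g p * m - meanScalar g) * (((m : ℝ) - 2))) =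
        m * (multiplier g p * m * m - ((m : ℝ) - 2) * meanScalar g - multiplier g p * (2 * m)) := by
      ring
    rw [← e1, sub_self, mul_zero] at e2
    exact (mul_eq_zero.1 e2).resolve_left hm0
  rw [eq_div_iff hm0]
  exact sub_eq_zero.1 ((mul_eq_zero.1 e).resolve_right (by linarith))

theorem multiplier_eq_of_const (hm : 3 ≤ m) {c : ℝ} (h : ∀ p, scalar g p = c * m) (p : M) :
    multiplier g p = c := by
  have hm' : (3 : ℝ) ≤ m := by exact_mod_cast hm
  have hm0 : (m : ℝ) ≠ 0 := by linarith
  rw [multiplier, meanScalar_of_const g h, h p]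
  field_simp
  ring

end Criticality

/-! ### Velocities of curves of compatible metrics and of curves in a multiconformal class. -/

section Velocity

variable {m : ℕ} {M : Type*} [TopologicalSpace M] [ChartedSpace (Model m) M]
  [IsManifold (𝓡 m) ∞ M] {l : ℕ} {k : Fin l → ℕ} {D : Decomposition m M l k}
  {γ : ℝ → Met m M}

/-- The velocity of a curve of metrics as a bilinear form on `T_p M`. -/
def velocityBilin (γ : ℝ → Met m M) (p : M) :
    TangentSpace (𝓡 m) p →ₗ[ℝ] TangentSpace (𝓡 m) p →ₗ[ℝ] ℝ :=
  Matrix.toLinearMap₂ (coordBasis p) (coordBasis p) (velocityMat γ p (extChartAt (𝓡 m) p p))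

theorem bilAt_velocityBilin (γ : ℝ → Met m M) (p : M) :
    bilAt (fun v w ↦ velocityBilin γ p v w) = velocityMat γ p (extChartAt (𝓡 m) p p) := by
  ext i j
  simp only [bilAt, Matrix.of_apply, velocityBilin]
  rw [← coordBasis_apply, ← coordBasis_apply, ← LinearMap.toMatrix₂_apply,
    LinearMap.toMatrix₂_toLinearMap₂]

theorem IsSmoothCurve.hasDerivAt_inner (hγ : IsSmoothCurve γ) (p : M)
    (v w : TangentSpace (𝓡 m) p) :
    HasDerivAt (fun t ↦ (γ t).inner p v w) (velocityBilin γ p v w) 0 := by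
  have hp := mem_chart_source (Model m) p
  have hv : velocityBilin γ p v w = ∑ i, ∑ j, velocityMat γ p (extChartAt (𝓡 m) p p) i j
      * (coord p p v i * coord p p w j) := by
    rw [velocityBilin, Matrix.toLinearMap₂_apply]
    refine Finset.sum_congr rfl fun i _ ↦ Finset.sum_congr rfl fun j _ ↦ ?_
    simp only [coordBasis_repr, smul_eq_mul]
    ring
  have hG : ∀ t i j, (γ t).inner p (coordVec p p i) (coordVec p p j)
      = gram (γ t) p (extChartAt (𝓡 m) p p) i j := fun t i j ↦
    (congrFun (congrFun (gramAt_eq_bilAt (γ t) p) i) j).symm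
  have e : (fun t ↦ (γ t).inner p v w) = fun t ↦ ∑ i, ∑ j,
      gram (γ t) p (extChartAt (𝓡 m) p p) i j * (coord p p v i * coord p p w j) := by
    funext t
    rw [bilin_expand hp]
    simp only [hG]
  rw [e, hv]
  exact HasDerivAt.fun_sum fun i _ ↦ HasDerivAt.fun_sum fun j _ ↦
    (hγ.hasDerivAt_gram (mem_extChartAt_target p) i j).mul_const _

theorem IsSmoothCurve.velocityBilin_eq_zero (hγ : IsSmoothCurve γ)
    (hc : ∀ t, γ t ∈ compatible D) {i j : Fin l} (hij : i ≠ j) {p : M}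
    {v w : TangentSpace (𝓡 m) p} (hv : v ∈ D.fiber i p) (hw : w ∈ D.fiber j p) :
    velocityBilin γ p v w = 0 := by
  have h := hγ.hasDerivAt_inner p v w
  have e : (fun t ↦ (γ t).inner p v w) = fun _ ↦ 0 := funext fun t ↦ hc t i j hij p v hv w hw
  rw [e] at h
  exact h.unique (hasDerivAt_const _ _)

/-- The velocity of a curve of compatible metrics is block diagonal. -/
theorem IsSmoothCurve.velocityMat_eq_sum (hγ : IsSmoothCurve γ)
    (hc : ∀ t, γ t ∈ compatible D) (p : M) :
    velocityMat γ p (extChartAt (𝓡 m) p p)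
      = ∑ i, bilAt (fun v w ↦ velocityBilin γ p (D.proj i p v) (D.proj i p w)) := by
  rw [← bilAt_velocityBilin]
  ext a b
  rw [Matrix.sum_apply]
  simp only [bilAt, Matrix.of_apply]
  conv_lhs => rw [← D.sum_proj p (coordVec p p a)]
  rw [map_sum, LinearMap.sum_apply]
  refine Finset.sum_congr rfl fun i _ ↦ ?_
  conv_lhs => rw [← D.sum_proj p (coordVec p p b)]
  rw [map_sum]
  exact Finset.sum_eq_single i (fun j _ hj ↦ hγ.velocityBilin_eq_zero hc hj.symm
    (D.proj_mem i p _) (D.proj_mem j p _)) fun h ↦ absurd (Finset.mem_univ i) h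

/-- The velocity of a curve in a multiconformal class is a combination of the `g_i`. -/
theorem IsSmoothCurve.exists_velocityBilin_eq (hγ : IsSmoothCurve γ) {g : Met m M}
    (hc : ∀ t, γ t ∈ multiconformalClass D g) (i : Fin l) (p : M) :
    ∃ r : ℝ, ∀ v ∈ D.fiber i p, ∀ w ∈ D.fiber i p,
      velocityBilin γ p v w = r * g.inner p v w := by
  -- The conformal factors of `γ t` come without any regularity in `t`, so they are not
  -- differentiated. They are eliminated by comparison with a fixed vector `u`: γ_t(v, w) g(u, u) =
  -- γ_t(u, u) g(v, w) for all t, and both sides are differentiable.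
  by_cases h : ∃ u ∈ D.fiber i p, u ≠ 0
  · obtain ⟨u, hu, hu0⟩ := h
    have hpos := (g.pos p u hu0).ne'
    refine ⟨velocityBilin γ p u u / g.inner p u u, fun v hv w hw ↦ ?_⟩
    have h1 := (hγ.hasDerivAt_inner p v w).mul_const (g.inner p u u)
    have h2 := (hγ.hasDerivAt_inner p u u).mul_const (g.inner p v w)
    have e : (fun t ↦ (γ t).inner p v w * g.inner p u u)
        = fun t ↦ (γ t).inner p u u * g.inner p v w := by
      funext t
      obtain ⟨-, f, -, -, hf⟩ := hc t
      rw [hf i p v hv w hw, hf i p u hu u hu]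
      ring
    rw [e] at h1
    have := h1.unique h2
    field_simp
    linarith
  · push Not at h
    refine ⟨0, fun v hv w hw ↦ ?_⟩
    rw [h v hv]
    simp

end Velocity

/-! ### The two criticality criteria. -/

section MainResults

variable {m : ℕ} {M : Type*} [TopologicalSpace M] [T2Space M] [CompactSpace M] [Nonempty M]
  [ChartedSpace (Model m) M] [IsManifold (𝓡 m) ∞ M] [MeasurableSpace M] [BorelSpace M]
  {l : ℕ} {k : Fin l → ℕ} {D : Decomposition m M l k} {g : Met m M}

theorem self_mem_multiconformalClass (hg : g ∈ compatible D) : g ∈ multiconformalClass D g :=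
  ⟨hg, fun _ _ ↦ 1, fun _ ↦ contMDiff_const, fun _ _ ↦ one_pos, fun i x v _ w _ ↦ by ring⟩

/-- If the first variation of every curve in `S` has vanishing integrand, then `g` is critical. -/
theorem isCriticalOn_of_velocity (hm : 3 ≤ m) {S : Set (Met m M)} (hgS : g ∈ S)
    (h : ∀ γ : ℝ → Met m M, IsSmoothCurve γ → γ 0 = g → (∀ t, γ t ∈ S) → ∀ p,
      multiplier g p * velocityTrace γ p = velocityRic γ p) :
    IsCriticalOn einsteinHilbert S g := by
  refine ⟨hgS, fun γ hγ h0 hγS ↦ ?_⟩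
  have hd := hγ.hasDerivAt_einsteinHilbert hm
  refine hd.congr_deriv ?_
  rw [div_eq_zero_iff]
  left
  refine integral_eq_zero_of_ae (Filter.Eventually.of_forall fun p ↦ ?_)
  rw [h0]
  exact sub_eq_zero.2 (h γ hγ h0 hγS p)

theorem scalar_eq_of_scalarPart (hg : g ∈ compatible D) {p : M} {c : ℝ}
    (h : ∀ i, scalarPart D g i p = c * k i) : scalar g p = c * m := by
  rw [← sum_scalarPart hg, Finset.sum_congr rfl fun i _ ↦ h i, ← Finset.mul_sum, sum_rank D]

/-- Criticality in the multiconformal class. -/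
theorem isCriticalOn_multiconformalClass_iff (hm : 3 ≤ m) (hg : g ∈ compatible D) :
    IsCriticalOn einsteinHilbert (multiconformalClass D g) g ↔
      ∃ c : ℝ, ∀ i x, scalarPart D g i x = c * k i := by
  constructor
  · intro hcrit
    have h : ∀ x i, scalarPart D g i x = multiplier g x * k i := by
      intro x i
      have := (isSubform_metricPartForm hg i).euler_lagrange hm
        (fun φ hφ t ↦ perturb_metricPart_mem hg i hφ t) hcrit x
      have hb : (bilAt fun v w ↦ metricPartForm D g i x v w) = gramAt g x * projAt D i x :=
        bilAt_metricPart hg i x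
      -- For the velocity g_i, the trace is m_i and the pairing with Ric is R_i.
      rw [hb, trace_inv_mul_metricPart (isUnit_gramAt_det x), trace_projAt,
        trace_metricPart_ric (isUnit_gramAt_det x), ← scalarPart_eq hg] at this
      exact this.symm
    refine ⟨meanScalar g / m, fun i x ↦ ?_⟩
    rw [h, multiplier_eq_of_scalar_eq hm fun p ↦ scalar_eq_of_scalarPart hg (h p)]
  · rintro ⟨c, hc⟩
    have hmul := multiplier_eq_of_const hm fun p ↦ scalar_eq_of_scalarPart hg fun i ↦ hc i p
    refine isCriticalOn_of_velocity hm (self_mem_multiconformalClass hg) fun γ hγ h0 hγS p ↦ ?_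
    choose r hr using fun i ↦ hγ.exists_velocityBilin_eq hγS i p
    have hH : velocityMat γ p (extChartAt (𝓡 m) p p)
        = ∑ i, r i • (gramAt g p * projAt D i p) := by
      rw [hγ.velocityMat_eq_sum (fun t ↦ (hγS t).1) p]
      refine Finset.sum_congr rfl fun i _ ↦ ?_
      rw [← bilAt_metricPart hg]
      ext a b
      exact hr i _ (D.proj_mem i p _) _ (D.proj_mem i p _)
    have e1 : velocityTrace γ p = ∑ i, r i * k i := by
      rw [velocityTrace, h0, hH, ← gramAt, Matrix.mul_sum, Matrix.trace_sum]
      refine Finset.sum_congr rfl fun i _ ↦ ?_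
      rw [Matrix.mul_smul, Matrix.trace_smul, trace_inv_mul_metricPart (isUnit_gramAt_det p),
        trace_projAt, smul_eq_mul]
    have e2 : velocityRic γ p = ∑ i, r i * (c * k i) := by
      rw [velocityRic, h0, hH, ← gramAt, ← ricciAt, Matrix.mul_sum, Matrix.sum_mul, Matrix.sum_mul,
        Matrix.trace_sum]
      refine Finset.sum_congr rfl fun i _ ↦ ?_
      rw [Matrix.mul_smul, Matrix.smul_mul, Matrix.smul_mul, Matrix.trace_smul,
        trace_metricPart_ric (isUnit_gramAt_det p), ← scalarPart_eq hg, hc, smul_eq_mul]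
    rw [hmul, e1, e2, Finset.mul_sum]
    exact Finset.sum_congr rfl fun i _ ↦ by ring

/-- The form has rank one: with ξ the coordinate vector of X, its matrix is (G ξ)(G ξ)ᵀ, which
reduces both traces below to quadratic forms in ξ. -/
theorem bilAt_squareForm (X : (x : M) → TangentSpace (𝓡 m) x) (p : M) :
    (bilAt fun v w ↦ squareForm g X p v w)
      = Matrix.vecMulVec ((gramAt g p).mulVec fun i ↦ coord p p (X p) i)
        ((gramAt g p).mulVec fun i ↦ coord p p (X p) i) := by
  have h : ∀ i, g.inner p (X p) (coordVec p p i)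
      = ((gramAt g p).mulVec fun i ↦ coord p p (X p) i) i := fun i ↦ by
    conv_lhs => rw [← coordVec_expand (mem_chart_source (Model m) p) (X p)]
    rw [g.symm, map_sum, gramAt_eq_bilAt]
    refine Finset.sum_congr rfl fun j _ ↦ ?_
    rw [map_smul, smul_eq_mul, mul_comm]
    rfl
  ext i j
  simp only [bilAt, Matrix.of_apply, squareForm_apply, h, Matrix.vecMulVec_apply]

theorem trace_squareForm (X : (x : M) → TangentSpace (𝓡 m) x) (p : M) :
    ((gramAt g p)⁻¹ * bilAt fun v w ↦ squareForm g X p v w).trace = g.inner p (X p) (X p) := by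
  rw [bilAt_squareForm, Matrix.mul_vecMulVec, Matrix.mulVec_mulVec,
    Matrix.nonsing_inv_mul _ (isUnit_gramAt_det p), Matrix.one_mulVec, Matrix.trace_vecMulVec,
    bilin_expand (mem_chart_source (Model m) p), gramAt_eq_bilAt]
  simp only [dotProduct, Matrix.mulVec, bilAt, Matrix.of_apply, Finset.mul_sum]
  exact Finset.sum_congr rfl fun i _ ↦ Finset.sum_congr rfl fun j _ ↦ by ring

theorem trace_squareForm_ric (X : (x : M) → TangentSpace (𝓡 m) x) (p : M) :
    ((gramAt g p)⁻¹ * (bilAt fun v w ↦ squareForm g X p v w) * (gramAt g p)⁻¹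
      * ricciAt g p).trace = ricci g p (X p) (X p) := by
  have hsymm : (gramAt g p).transpose = gramAt g p := gram_isSymm g p _
  rw [bilAt_squareForm, Matrix.mul_vecMulVec, Matrix.mulVec_mulVec,
    Matrix.nonsing_inv_mul _ (isUnit_gramAt_det p), Matrix.one_mulVec, Matrix.vecMulVec_mul,
    Matrix.vecMulVec_mul, Matrix.trace_vecMulVec, ← Matrix.vecMul_transpose, hsymm,
    Matrix.vecMul_vecMul, Matrix.vecMul_vecMul, ← Matrix.mul_assoc,
    Matrix.mul_nonsing_inv _ (isUnit_gramAt_det p), Matrix.one_mul,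
    ← Matrix.mulVec_transpose, (ricciAt_isSymm p).eq, ricci_eq_sum]
  simp only [dotProduct, Matrix.mulVec, Finset.mul_sum]
  exact Finset.sum_congr rfl fun i _ ↦ Finset.sum_congr rfl fun j _ ↦ by ring

/-- Criticality among the compatible metrics. -/
theorem isCriticalOn_compatible_iff (hm : 3 ≤ m) (hg : g ∈ compatible D) :
    IsCriticalOn einsteinHilbert (compatible D) g ↔
      ∃ c : ℝ, ∀ i x v w, ricciPart D g i x v w = c * metricPart D g i x v w := by
  constructor
  · intro hcrit
    have hdiag : ∀ i x, ∀ v ∈ D.fiber i x,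
        ricciBilin g x v v = multiplier g x * g.inner x v v := by
      intro i x v hv
      -- The equation is homogeneous of degree two in the vector, so a section through a nonzero
      -- multiple `r • v` is enough; the factor r² is cancelled at the end.
      obtain ⟨X, hX, hX1, hXi, r, hr, hXv⟩ := exists_section g hv
      have hB := isSubform_squareForm hX hX1
      have := hB.euler_lagrange hm (fun φ hφ t ↦ perturb_squareForm_mem hg hXi hB hφ t) hcrit x
      rw [trace_squareForm, trace_squareForm_ric, ← ricciBilin_apply, hXv] at this
      simp only [map_smul, LinearMap.smul_apply, _root_.smul_apply, smul_eq_mul] at this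
      have hrr : r * r ≠ 0 := mul_ne_zero hr hr
      refine mul_left_cancel₀ hrr ?_
      linarith
    have hpol : ∀ i x v w, ricciPart D g i x v w = multiplier g x * metricPart D g i x v w := by
      intro i x v w
      set v' := D.proj i x v with hv'
      set w' := D.proj i x w with hw'
      have hv := D.proj_mem i x v
      have hw := D.proj_mem i x w
      have h1 := hdiag i x _ hv
      have h2 := hdiag i x _ hw
      -- Polarization: both forms are symmetric and agree on the diagonal of the fibre.
      have h3 := hdiag i x _ (Submodule.add_mem _ hv hw)
      simp only [map_add, LinearMap.add_apply, _root_.add_apply] at h3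
      have h4 : ricciBilin g x w' v' = ricciBilin g x v' w' := by
        rw [ricciBilin_apply, ricciBilin_apply, ricci_symm]
      have h5 := g.symm x w' v'
      rw [ricciPart, metricPart, ← ricciBilin_apply]
      simp only [← hv', ← hw'] at h1 h2 h3 ⊢
      rw [h4, h5] at h3
      linarith
    refine ⟨meanScalar g / m, fun i x v w ↦ ?_⟩
    rw [hpol, multiplier_eq_of_scalar_eq hm fun p ↦ scalar_eq_of_scalarPart hg fun i ↦
      scalarPart_of_ricciPart hg (hpol i p)]
  · rintro ⟨c, hc⟩
    have hmul := multiplier_eq_of_const hm fun p ↦ scalar_eq_of_scalarPart hg fun i ↦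
      scalarPart_of_ricciPart hg (hc i p)
    refine isCriticalOn_of_velocity hm hg fun γ hγ h0 hγS p ↦ ?_
    have hRic : ∀ i, (projAt D i p).transpose * ricciAt g p * projAt D i p
        = c • (gramAt g p * projAt D i p) := fun i ↦ by
      rw [← bilAt_ricciPart, ← bilAt_metricPart hg]
      ext a b
      exact hc i p _ _
    have hH := hγ.velocityMat_eq_sum hγS p
    -- The velocity is now a sum of blocks P_iᵀ H P_i. Each pairs with Ric only through Ric_i = c
    -- g_i, giving c times its trace.
    simp only [bilAt_proj] at hH
    rw [hmul, velocityTrace, velocityRic, h0, ← gramAt, ← ricciAt, hH, Matrix.mul_sum,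
      Matrix.sum_mul, Matrix.sum_mul, Matrix.trace_sum, Matrix.trace_sum, Finset.mul_sum]
    exact Finset.sum_congr rfl fun i _ ↦ (trace_conj_proj_ric (isUnit_gramAt_det p)
      (projAt_gramAt hg i p) (projAt_mul_self i p) (hRic i)).symm

end MainResults

end Multiconformal

end

theorem mainTheorem7 {m : ℕ} (hm : 3 ≤ m)
    {M : Type*} [TopologicalSpace M] [T2Space M] [CompactSpace M] [ConnectedSpace M]
    [ChartedSpace (EuclideanSpace ℝ (Fin m)) M] [IsManifold (𝓡 m) ∞ M]
    [MeasurableSpace M] [BorelSpace M]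
    {l : ℕ} {k : Fin l → ℕ} (hk : ∀ i, 1 ≤ k i)
    (D : Multiconformal.Decomposition m M l k)
    (g : Multiconformal.Met m M) (hg : g ∈ Multiconformal.compatible D) :
    (Multiconformal.IsCriticalOn Multiconformal.einsteinHilbert
        (Multiconformal.multiconformalClass D g) g ↔
      ∃ c : ℝ, ∀ i x, Multiconformal.scalarPart D g i x / (k i : ℝ) = c) ∧
    (Multiconformal.IsCriticalOn Multiconformal.einsteinHilbert
        (Multiconformal.compatible D) g ↔
      ∃ c : ℝ, ∀ i x v w,
        Multiconformal.ricciPart D g i x v w = c * Multiconformal.metricPart D g i x v w) := by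
  refine ⟨(Multiconformal.isCriticalOn_multiconformalClass_iff hm hg).trans ?_,
    Multiconformal.isCriticalOn_compatible_iff hm hg⟩
  refine exists_congr fun c ↦ forall_congr' fun i ↦ forall_congr' fun x ↦ ?_
  have hki : (k i : ℝ) ≠ 0 := Nat.cast_ne_zero.2 (Nat.one_le_iff_ne_zero.1 (hk i))
  exact (div_eq_iff hki).symm
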